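/- There are a randomized word-RAM program and absolute constants $K\in\mathbb N$ and $C,c>0$ such that the following holds for all integers $n,m\ge 1$ and $0\le s\le n$, every bipartite graph $G=(F\,\dot\cup\,U,E)$ with $|U|=n$ (the elements) and $|F|=m$ (the sets, $f\in F$ standing for the set $N(f)\subseteq U$ of its neighbours), and every word length $w\ge K(n+\lfloor\log_2 m\rfloor+1)$. Put $\sigma=s/n$. The machine has $w$-bit words and a memory of $2^w$ words, performs each arithmetic, bitwise, shift, comparison, memory-access and fair-coin-flip instruction in one step, and receives $n$, $m$, $s$ and the $m\times n$ incidence matrix of $G$ (one word per entry) as input. Then: 1. whatever the outcomes of the coin flips, the program halts with answer YES or NO after at most $C\cdot 2^{(1-c\sigma^4)n}\cdot m$ steps; 2. if no $S\subseteq F$ with $|S|\le s$ satisfies $\bigcup_{f\in S}N(f)=U$, then the program never answers YES; 3. if such an $S$ exists, then the program answers NO with probability at most $1/4$. That is, there is a Monte Carlo algorithm that decides, in time $O(2^{(1-\Omega(\sigma^4))n}m)$, whether an instance of Set Cover with $n$ elements and $m$ sets has a set cover of size at most $s=\sigma n$. -/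

import Mathlib

/-! ### The Set Cover problem

An instance with `m` sets over `n` elements is a bipartite graph between the family `Fin m` and the
universe `Fin n`, given by the neighbourhood `N f` of every member `f` of the family.  Different
members may have the same neighbourhood, and neighbourhoods may be empty. -/

namespace SetCover

/-- The sets of a Set Cover instance with `n` elements and `m` sets. -/
abbrev Family (n m : ℕ) : Type := Fin m → Finset (Fin n)

/-- There is a subfamily of at most `s` sets whose union is the whole universe. -/
def HasCover {n m : ℕ} (N : Family n m) (s : ℕ) : Prop :=
  ∃ S : Finset (Fin m), S.biUnion N = Finset.univ ∧ S.card ≤ s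

/-- The input words: `n`, `m`, `s`, followed by the `m × n` incidence matrix, row by row, with one
word (`0` or `1`) per entry; every other word is `0`. -/
def input {n m : ℕ} (N : Family n m) (s : ℕ) : ℕ → ℕ
  | 0 => n
  | 1 => m
  | 2 => s
  | k + 3 => if ∃ (f : Fin m) (u : Fin n), k = f.val * n + u.val ∧ u ∈ N f then 1 else 0

end SetCover

/-! ### Randomized word RAM

A machine with words of `w` bits, a memory of `2 ^ w` words, a constant number of registers (those
that occur in the program), the usual unit-cost word operations and fair coin flips. -/

namespace WordRAM

/-- Binary word operations; arithmetic is unsigned and modulo `2 ^ w`. -/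
inductive BinOp where
  | add | sub | mul | div | mod | and | or | xor | shl | shr

/-- The value of a word operation. Division by zero gives `0`, and `a mod 0 = a`. -/
def BinOp.eval {w : ℕ} : BinOp → BitVec w → BitVec w → BitVec w
  | .add, a, b => a + b
  | .sub, a, b => a - b
  | .mul, a, b => a * b
  | .div, a, b => a / b
  | .mod, a, b => a % b
  | .and, a, b => a &&& b
  | .or, a, b => a ||| b
  | .xor, a, b => a ^^^ b
  | .shl, a, b => a <<< b.toNat
  | .shr, a, b => a >>> b.toNat

/-- Instructions. Registers and program positions are denoted by natural numbers. -/
inductive Instr where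
  /-- `R[dst] := k` -/
  | const (dst k : ℕ)
  /-- `R[dst] := R[a] op R[b]` -/
  | bin (op : BinOp) (dst a b : ℕ)
  /-- `R[dst] := M[R[addr]]` -/
  | load (dst addr : ℕ)
  /-- `M[R[addr]] := R[src]` -/
  | store (addr src : ℕ)
  /-- `R[dst] :=` a fair random bit -/
  | coin (dst : ℕ)
  /-- go to `target` if `R[a] = R[b]` -/
  | jeq (a b target : ℕ)
  /-- go to `target` if `R[a] < R[b]` (unsigned) -/
  | jlt (a b target : ℕ)
  /-- halt with the given answer (`true` is YES, `false` is NO) -/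
  | halt (answer : Bool)

/-- A program is a finite list of instructions. -/
abbrev Program : Type := List Instr

/-- Configurations: program counter, registers, memory, number of coins flipped so far, and the
answer once the machine has halted. -/
structure Config (w : ℕ) where
  pc : ℕ
  reg : ℕ → BitVec w
  mem : BitVec w → BitVec w
  flips : ℕ
  answer : Option Bool

/-- Assign a value to a register and go to the next instruction. -/
def Config.assign {w : ℕ} (c : Config w) (dst : ℕ) (v : BitVec w) : Config w :=
  { c with reg := Function.update c.reg dst v, pc := c.pc + 1 }

/-- The effect of one instruction, where `ω i` is the outcome of the `i`-th coin flip. -/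
def Instr.exec {w : ℕ} (ω : ℕ → Bool) (c : Config w) : Instr → Config w
  | .const dst k => c.assign dst (BitVec.ofNat w k)
  | .bin op dst a b => c.assign dst (op.eval (c.reg a) (c.reg b))
  | .load dst addr => c.assign dst (c.mem (c.reg addr))
  | .store addr src =>
      { c with mem := Function.update c.mem (c.reg addr) (c.reg src), pc := c.pc + 1 }
  | .coin dst =>
      { c.assign dst (BitVec.ofNat w (ω c.flips).toNat) with flips := c.flips + 1 }
  | .jeq a b target => { c with pc := if c.reg a = c.reg b then target else c.pc + 1 }
  | .jlt a b target => { c with pc := if c.reg a < c.reg b then target else c.pc + 1 }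
  | .halt b => { c with answer := some b }

/-- One step of the machine. It does not move any more once it has halted; leaving the program
without executing `halt` does not count as halting. -/
def step (P : Program) {w : ℕ} (ω : ℕ → Bool) (c : Config w) : Config w :=
  match c.answer with
  | some _ => c
  | none =>
    match P[c.pc]? with
    | none => c
    | some i => i.exec ω c

/-- The initial configuration: the input is in the memory, and all registers are `0`. -/
def init (w : ℕ) (inp : ℕ → ℕ) : Config w where
  pc := 0
  reg := fun _ => 0
  mem := fun a => BitVec.ofNat w (inp a.toNat)
  flips := 0
  answer := none

/-- On word length `w`, input `inp` and coin flips `ω`, the machine has halted with answer `b` after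
at most `t` steps. -/
def AnswersIn (P : Program) (w : ℕ) (inp : ℕ → ℕ) (ω : ℕ → Bool) (t : ℕ) (b : Bool) : Prop :=
  ((step P ω)^[t] (init w inp)).answer = some b

/-- The machine eventually halts with answer `b`. -/
def Answers (P : Program) (w : ℕ) (inp : ℕ → ℕ) (ω : ℕ → Bool) (b : Bool) : Prop :=
  ∃ t : ℕ, AnswersIn P w inp ω t b

/-- The law of an infinite sequence of independent fair coin flips. -/
noncomputable def coinLaw : MeasureTheory.Measure (ℕ → Bool) :=
  MeasureTheory.Measure.infinitePi fun _ : ℕ => (PMF.uniformOfFintype Bool).toMeasure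

end WordRAM

/-! # A Monte Carlo algorithm for Set Cover

The program first fills a table with the least number of members of the family that cover `X`, for
the sets `X` of at most `k` elements, where `k = n / 2 - d` and the gap `d` is about
`σ ^ 2 * n / 8192` (`gap`). Sets are bit masks, visited in numerical order; `succMask` skips larger
sets. Whenever an entry is computed, the program tests whether `X`, one member of the family
and another set of the table make up a cover of at most `s` sets (`run_table`). Then it draws
`2 * 2 ^ (n - s / 4)` random sets `W`; for each of them it splits off all sets of at most `3 * d`
elements from `W` and from its complement, and tests whether one member of the family and a set of
the table account for the rest on both sides (`run_samples`). If `d * s < 2 * n`, then `σ ^ 4 * n`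
is bounded, and the full table (`k = n`) is affordable and decides the instance.

**Correctness.** Every YES comes with a cover. Conversely, a cover can be refined to a partition of
the universe into exactly `s` nonempty parts (`HasCover.nonempty_partition`). If the parts other
than some single one can be divided into two groups of at most `k` elements each, then the table
phase finds the cover. Otherwise, when a union of parts grows part by part, no part jumps over the
middle range `(k, n - k)` of sizes (`exists_sum_between`). As `d * s ≥ 2 * n`, at least half of the
parts have at most `d` elements; pairing them up by size and choosing one part of each pair gives
`2 ^ (s / 4)` unions whose sizes differ by at most `d` (`exists_balanced`). A common set of other
parts moves all of these into the middle range, up to an excess of `d`. Each of the resulting sets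
`W` and its complement has at most `k + 3 * d` elements, hence is a union of parts of total size at
most `k`, one more part, and parts of total size at most `3 * d` (`exists_peel`), so that the sample
`W` reveals the cover (`exists_many_samples`). A random set is one of these with probability at
least `2 ^ (s / 4) / 2 ^ n`, and `2 * 2 ^ (n - s / 4)` independent ones all miss them with
probability at most `exp (-2) ≤ 1 / 4` (`coinLaw_samples_le`).

**Running time.** By the identity `∑ y ^ |X| = (1 + y) ^ n` and Markov's inequality, the table has
at most `2 ^ n * exp (-2 * d ^ 2 / n)` entries (`remaining_half_le`), where `d ^ 2 / n` is of order
`σ ^ 4 * n`, and there are at most `2 ^ (s / 16)` sets of size at most `3 * d`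
(`remaining_small_le`). Every set costs `O(m)` steps.

**Verification of the program.** The machine is simulated by one on natural numbers
(`step_refines`). The predicate `Run` states what holds after a bounded number of steps, unless the
machine has halted with a justified YES before; it is established from the end of the program
backwards, with one lemma for every loop. -/

/-! ### The machine with natural numbers in place of words -/

namespace WordRAM

/-- The machine of the statement with the words replaced by their values. It runs in lock-step with
the original one (`step_refines`) and is easier to reason about. -/
structure NatConfig where
  pc : ℕ
  reg : ℕ → ℕ
  mem : ℕ → ℕ
  flips : ℕ
  answer : Option Bool

/-- The value of a word operation in terms of the values of its arguments. -/
def BinOp.natEval (w : ℕ) : BinOp → ℕ → ℕ → ℕ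
  | .add, a, b => (a + b) % 2 ^ w
  | .sub, a, b => (2 ^ w - b + a) % 2 ^ w
  | .mul, a, b => (a * b) % 2 ^ w
  | .div, a, b => a / b
  | .mod, a, b => a % b
  | .and, a, b => a &&& b
  | .or, a, b => a ||| b
  | .xor, a, b => a ^^^ b
  | .shl, a, b => (a <<< b) % 2 ^ w
  | .shr, a, b => a >>> b

lemma BinOp.toNat_eval {w : ℕ} (op : BinOp) (a b : BitVec w) :
    (op.eval a b).toNat = op.natEval w a.toNat b.toNat := by
  cases op <;> simp [BinOp.eval, BinOp.natEval]

/-- The effect of one instruction on the values. -/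
def Instr.natExec (w : ℕ) (ω : ℕ → Bool) (c : NatConfig) : Instr → NatConfig
  | .const dst k => ⟨c.pc + 1, Function.update c.reg dst (k % 2 ^ w), c.mem, c.flips, c.answer⟩
  | .bin op dst a b =>
      ⟨c.pc + 1, Function.update c.reg dst (op.natEval w (c.reg a) (c.reg b)), c.mem, c.flips,
        c.answer⟩
  | .load dst addr =>
      ⟨c.pc + 1, Function.update c.reg dst (c.mem (c.reg addr)), c.mem, c.flips, c.answer⟩
  | .store addr src =>
      ⟨c.pc + 1, c.reg, Function.update c.mem (c.reg addr) (c.reg src), c.flips, c.answer⟩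
  | .coin dst =>
      ⟨c.pc + 1, Function.update c.reg dst ((ω c.flips).toNat % 2 ^ w), c.mem, c.flips + 1,
        c.answer⟩
  | .jeq a b target =>
      ⟨if c.reg a = c.reg b then target else c.pc + 1, c.reg, c.mem, c.flips, c.answer⟩
  | .jlt a b target =>
      ⟨if c.reg a < c.reg b then target else c.pc + 1, c.reg, c.mem, c.flips, c.answer⟩
  | .halt b => ⟨c.pc, c.reg, c.mem, c.flips, some b⟩

/-- One step of the machine on values. -/
def natStep (P : Program) (w : ℕ) (ω : ℕ → Bool) (c : NatConfig) : NatConfig :=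
  match c.answer with
  | some _ => c
  | none =>
    match P[c.pc]? with
    | none => c
    | some i => i.natExec w ω c

/-- `d` holds the values of the words of `c`. -/
structure Refines {w : ℕ} (c : Config w) (d : NatConfig) : Prop where
  pc : c.pc = d.pc
  reg : ∀ r, (c.reg r).toNat = d.reg r
  mem : ∀ a, (c.mem a).toNat = d.mem a.toNat
  flips : c.flips = d.flips
  answer : c.answer = d.answer

lemma step_refines (P : Program) {w : ℕ} (ω : ℕ → Bool) {c : Config w} {d : NatConfig}
    (h : Refines c d) : Refines (step P ω c) (natStep P w ω d) := by
  obtain ⟨pc, reg, mem, fl, ans⟩ := c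
  obtain ⟨pc', reg', mem', fl', ans'⟩ := d
  obtain ⟨h1, h2, h3, h4, h5⟩ := h
  simp only at h1 h2 h3 h4 h5
  subst h1 h4 h5
  have upd : ∀ (dst : ℕ) (v : BitVec w) (v' : ℕ), v.toNat = v' → ∀ r,
      (Function.update reg dst v r).toNat = Function.update reg' dst v' r := by
    intro dst v v' hv r
    by_cases hr : r = dst
    · subst hr; simpa using hv
    · simpa [hr] using h2 r
  unfold step natStep
  cases ans with
  | some b => exact ⟨rfl, h2, h3, rfl, rfl⟩
  | none =>
    simp only
    cases P[pc]? with
    | none => exact ⟨rfl, h2, h3, rfl, rfl⟩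
    | some i =>
      cases i with
      | const dst k => exact ⟨rfl, upd _ _ _ (by simp), h3, rfl, rfl⟩
      | bin op dst a b =>
        exact ⟨rfl, upd _ _ _ (by rw [BinOp.toNat_eval, h2, h2]), h3, rfl, rfl⟩
      | load dst addr => exact ⟨rfl, upd _ _ _ (by rw [h3, h2]), h3, rfl, rfl⟩
      | store addr src =>
        refine ⟨rfl, h2, fun a => ?_, rfl, rfl⟩
        simp only [Instr.exec, Instr.natExec]
        by_cases ha : a = reg addr
        · subst ha
          rw [Function.update_self, h2 addr, Function.update_self, h2]
        · have ha' : a.toNat ≠ reg' addr := by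
            rw [← h2 addr]; exact fun hh => ha (BitVec.eq_of_toNat_eq hh)
          rw [Function.update_of_ne ha, Function.update_of_ne ha', h3]
      | coin dst => exact ⟨rfl, upd _ _ _ (by simp), h3, rfl, rfl⟩
      | jeq a b t =>
        refine ⟨?_, h2, h3, rfl, rfl⟩
        simp only [Instr.exec, Instr.natExec, ← h2, BitVec.toNat_inj]
      | jlt a b t =>
        refine ⟨?_, h2, h3, rfl, rfl⟩
        simp only [Instr.exec, Instr.natExec, ← h2, BitVec.lt_def]
      | halt b => exact ⟨rfl, h2, h3, rfl, rfl⟩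

/-- The initial configuration on values. -/
def natInit (w : ℕ) (inp : ℕ → ℕ) : NatConfig where
  pc := 0
  reg := fun _ => 0
  mem := fun a => inp a % 2 ^ w
  flips := 0
  answer := none

lemma iterate_refines (P : Program) (w : ℕ) (inp : ℕ → ℕ) (ω : ℕ → Bool) (t : ℕ) :
    Refines ((step P ω)^[t] (init w inp)) ((natStep P w ω)^[t] (natInit w inp)) := by
  induction t with
  | zero => exact ⟨rfl, by simp [init, natInit], by simp [init, natInit], rfl, rfl⟩
  | succ t ih =>
    rw [Function.iterate_succ_apply', Function.iterate_succ_apply']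
    exact step_refines P ω ih

lemma answersIn_iff (P : Program) (w : ℕ) (inp : ℕ → ℕ) (ω : ℕ → Bool) (t : ℕ) (b : Bool) :
    AnswersIn P w inp ω t b ↔ ((natStep P w ω)^[t] (natInit w inp)).answer = some b := by
  unfold AnswersIn
  rw [(iterate_refines P w inp ω t).answer]

lemma step_of_answer (P : Program) {w : ℕ} (ω : ℕ → Bool) {c : Config w} {b : Bool}
    (h : c.answer = some b) : step P ω c = c := by
  simp [step, h]

lemma AnswersIn.mono {P : Program} {w : ℕ} {inp : ℕ → ℕ} {ω : ℕ → Bool} {t t' : ℕ} {b : Bool}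
    (h : AnswersIn P w inp ω t b) (htt : t ≤ t') : AnswersIn P w inp ω t' b := by
  induction t', htt using Nat.le_induction with
  | base => exact h
  | succ t' _ ih =>
    unfold AnswersIn at ih ⊢
    rw [Function.iterate_succ_apply', step_of_answer P ω ih, ih]

lemma Answers.unique {P : Program} {w : ℕ} {inp : ℕ → ℕ} {ω : ℕ → Bool} {b b' : Bool}
    (h : Answers P w inp ω b) (h' : Answers P w inp ω b') : b = b' := by
  obtain ⟨t, ht⟩ := h
  obtain ⟨t', ht'⟩ := h'
  have h1 := ht.mono (le_max_left t t')
  have h2 := ht'.mono (le_max_right t t')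
  unfold AnswersIn at h1 h2
  rw [h1] at h2
  exact Option.some.inj h2

/-! ### Reasoning about runs with a time bound -/

/-- From `c`, within `t` steps, the machine reaches a configuration that satisfies `Q`, unless it
answers YES; the latter happens only if `φ` is true. -/
def Run (P : Program) (w : ℕ) (ω : ℕ → Bool) (φ : Prop) (Q : NatConfig → Prop) (t : ℕ)
    (c : NatConfig) : Prop :=
  ∃ t' ≤ t, Q ((natStep P w ω)^[t'] c) ∨ φ ∧ ((natStep P w ω)^[t'] c).answer = some true

section Run

variable {P : Program} {w : ℕ} {ω : ℕ → Bool} {φ : Prop} {Q : NatConfig → Prop} {t : ℕ}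
  {pc : ℕ} {reg mem : ℕ → ℕ} {fl : ℕ}

lemma Run.done {c : NatConfig} (h : Q c) : Run P w ω φ Q t c := ⟨0, Nat.zero_le _, Or.inl h⟩

lemma Run.mono {c : NatConfig} {t' : ℕ} (h : Run P w ω φ Q t c) (ht : t ≤ t') :
    Run P w ω φ Q t' c := by
  obtain ⟨u, hu, h⟩ := h
  exact ⟨u, hu.trans ht, h⟩

lemma Run.next {c : NatConfig} (h : Run P w ω φ Q t (natStep P w ω c)) :
    Run P w ω φ Q (t + 1) c := by
  obtain ⟨u, hu, h⟩ := h
  exact ⟨u + 1, by omega, by simpa only [Function.iterate_succ_apply] using h⟩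

lemma natStep_of {i : Instr} (hi : P[pc]? = some i) :
    natStep P w ω ⟨pc, reg, mem, fl, none⟩ = i.natExec w ω ⟨pc, reg, mem, fl, none⟩ := by
  simp [natStep, hi]

/-- The effect of a straight-line block on registers and memory. -/
def block (w : ℕ) : List Instr → (ℕ → ℕ) → (ℕ → ℕ) → (ℕ → ℕ) × (ℕ → ℕ)
  | .const dst k :: l, reg, mem => block w l (Function.update reg dst (k % 2 ^ w)) mem
  | .bin op dst a b :: l, reg, mem =>
      block w l (Function.update reg dst (op.natEval w (reg a) (reg b))) mem
  | .load dst addr :: l, reg, mem => block w l (Function.update reg dst (mem (reg addr))) mem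
  | .store addr src :: l, reg, mem => block w l reg (Function.update mem (reg addr) (reg src))
  | _, reg, mem => (reg, mem)

/-- Instructions that neither jump nor halt nor flip a coin. -/
def Instr.straight : Instr → Bool
  | .const _ _ | .bin _ _ _ _ | .load _ _ | .store _ _ => true
  | _ => false

lemma Run.block_aux (l : List Instr) : ∀ (pc : ℕ) (reg mem : ℕ → ℕ),
    l.all Instr.straight = true → (P.drop pc).take l.length = l →
    Run P w ω φ Q t ⟨pc + l.length, (block w l reg mem).1, (block w l reg mem).2, fl, none⟩ →
    Run P w ω φ Q (t + l.length) ⟨pc, reg, mem, fl, none⟩ := by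
  induction l with
  | nil => intro pc reg mem _ _ h; simpa [block] using h
  | cons i l ih =>
    intro pc reg mem hs hl h
    rw [List.all_cons, Bool.and_eq_true] at hs
    have hi : P[pc]? = some i := by
      have := congrArg (fun l => l[0]?) hl
      simpa [List.getElem?_take] using this
    have hl' : (P.drop (pc + 1)).take l.length = l := by
      have hlt := (List.getElem?_eq_some_iff.1 hi).1
      rw [List.drop_eq_getElem_cons hlt, List.length_cons, List.take_succ_cons] at hl
      exact (List.cons.inj hl).2
    have h3 : pc + (i :: l).length = pc + 1 + l.length := by simp; omega
    rw [h3] at h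
    refine Run.next (t := t + l.length) ?_
    rw [natStep_of hi]
    cases i with
    | const dst k => exact ih _ _ _ hs.2 hl' h
    | bin op dst a b => exact ih _ _ _ hs.2 hl' h
    | load dst addr => exact ih _ _ _ hs.2 hl' h
    | store addr src => exact ih _ _ _ hs.2 hl' h
    | coin _ => simp [Instr.straight] at hs
    | jeq _ _ _ => simp [Instr.straight] at hs
    | jlt _ _ _ => simp [Instr.straight] at hs
    | halt _ => simp [Instr.straight] at hs

/-- Execute `k` straight-line instructions, up to position `pc'`. -/
lemma Run.block (k pc' : ℕ) (hpc : pc + k = pc')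
    (hs : ((P.drop pc).take k).all Instr.straight = true)
    (hk : ((P.drop pc).take k).length = k)
    (h : Run P w ω φ Q t ⟨pc', (block w ((P.drop pc).take k) reg mem).1,
      (WordRAM.block w ((P.drop pc).take k) reg mem).2, fl, none⟩) :
    Run P w ω φ Q (t + k) ⟨pc, reg, mem, fl, none⟩ := by
  have := Run.block_aux (P := P) (w := w) (ω := ω) (φ := φ) (Q := Q) (t := t) (fl := fl)
    ((P.drop pc).take k) pc reg mem hs (by rw [hk])
  rw [hk, hpc] at this
  exact this h

lemma Run.jeq {a b target : ℕ} (hP : P[pc]? = some (.jeq a b target)) (hab : reg a = reg b)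
    (h : Run P w ω φ Q t ⟨target, reg, mem, fl, none⟩) :
    Run P w ω φ Q (t + 1) ⟨pc, reg, mem, fl, none⟩ := by
  refine Run.next ?_
  rw [natStep_of hP]
  simpa [Instr.natExec, hab] using h

lemma Run.jeq_not {a b target : ℕ} (hP : P[pc]? = some (.jeq a b target)) (hab : reg a ≠ reg b)
    (h : Run P w ω φ Q t ⟨pc + 1, reg, mem, fl, none⟩) :
    Run P w ω φ Q (t + 1) ⟨pc, reg, mem, fl, none⟩ := by
  refine Run.next ?_
  rw [natStep_of hP]
  simpa [Instr.natExec, hab] using h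

lemma Run.jlt {a b target : ℕ} (hP : P[pc]? = some (.jlt a b target)) (hab : reg a < reg b)
    (h : Run P w ω φ Q t ⟨target, reg, mem, fl, none⟩) :
    Run P w ω φ Q (t + 1) ⟨pc, reg, mem, fl, none⟩ := by
  refine Run.next ?_
  rw [natStep_of hP]
  simpa [Instr.natExec, hab] using h

lemma Run.jlt_not {a b target : ℕ} (hP : P[pc]? = some (.jlt a b target)) (hab : ¬ reg a < reg b)
    (h : Run P w ω φ Q t ⟨pc + 1, reg, mem, fl, none⟩) :
    Run P w ω φ Q (t + 1) ⟨pc, reg, mem, fl, none⟩ := by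
  refine Run.next ?_
  rw [natStep_of hP]
  simpa [Instr.natExec, hab] using h

lemma Run.coin {dst : ℕ} (hP : P[pc]? = some (.coin dst))
    (h : Run P w ω φ Q t
      ⟨pc + 1, Function.update reg dst ((ω fl).toNat % 2 ^ w), mem, fl + 1, none⟩) :
    Run P w ω φ Q (t + 1) ⟨pc, reg, mem, fl, none⟩ := by
  refine Run.next ?_
  rw [natStep_of hP]
  exact h

lemma Run.halt_yes (hP : P[pc]? = some (.halt true)) (h : φ) :
    Run P w ω φ Q (t + 1) ⟨pc, reg, mem, fl, none⟩ :=
  ⟨1, by omega, Or.inr ⟨h, by rw [Function.iterate_one, natStep_of hP]; rfl⟩⟩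

lemma Run.halt_no (hP : P[pc]? = some (.halt false))
    (h : Q ⟨pc, reg, mem, fl, some false⟩) :
    Run P w ω φ Q (t + 1) ⟨pc, reg, mem, fl, none⟩ := by
  refine Run.next ?_
  rw [natStep_of hP]
  exact Run.done h

end Run

end WordRAM

/-! ### Sets as bit masks -/

namespace SetCover

/-- The number of ones in the binary representation. -/
def pop (x : ℕ) : ℕ := x.bitIndices.length

@[simp] lemma pop_zero : pop 0 = 0 := by simp [pop]

@[simp] lemma pop_two_mul (x : ℕ) : pop (2 * x) = pop x := by simp [pop]

@[simp] lemma pop_two_mul_add_one (x : ℕ) : pop (2 * x + 1) = pop x + 1 := by simp [pop]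

lemma pop_eq (x : ℕ) : pop x = pop (x / 2) + x % 2 := by
  obtain ⟨y, rfl | rfl⟩ := x.even_or_odd'
  · simp
  · rw [pop_two_mul_add_one, show (2 * y + 1) / 2 = y by omega]
    omega

lemma pop_succ_le (x : ℕ) : pop (x + 1) ≤ pop x + 1 := by
  induction x using Nat.strong_induction_on with
  | _ x ih =>
    obtain ⟨y, rfl | rfl⟩ := x.even_or_odd'
    · simp
    · rw [show 2 * y + 1 + 1 = 2 * (y + 1) by ring, pop_two_mul, pop_two_mul_add_one]
      have := ih y (by omega)
      omega

lemma pop_div_two_le (x : ℕ) : pop (x / 2) ≤ pop x := by rw [pop_eq x]; omega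

lemma pop_eq_card (x : ℕ) : pop x = x.bitIndices.toFinset.card := by
  rw [List.toFinset_card_of_nodup Nat.bitIndices_nodup, pop]

lemma pop_mono {x y : ℕ} (h : ∀ i, x.testBit i = true → y.testBit i = true) : pop x ≤ pop y := by
  rw [pop_eq_card, pop_eq_card]
  refine Finset.card_le_card fun i hi => ?_
  simp only [List.mem_toFinset, Nat.mem_bitIndices] at hi ⊢
  exact h i hi

lemma pop_le_of_lt {n x : ℕ} (h : x < 2 ^ n) : pop x ≤ n := by
  rw [pop_eq_card]
  have : x.bitIndices.toFinset ⊆ Finset.range n := by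
    intro i hi
    simp only [List.mem_toFinset, Nat.mem_bitIndices] at hi
    rw [Finset.mem_range]
    exact (Nat.pow_lt_pow_iff_right (by norm_num)).1
      (lt_of_le_of_lt (Nat.ge_two_pow_of_testBit hi) h)
  simpa using Finset.card_le_card this

/-- The mask obtained by adding the lowest one of `x` to `x`. -/
def addLowBit (x : ℕ) : ℕ := (x ||| (x - 1)) + 1

lemma addLowBit_odd (y : ℕ) : addLowBit (2 * y + 1) = 2 * y + 1 + 1 := by
  unfold addLowBit
  congr 1
  refine Nat.eq_of_testBit_eq fun i => ?_
  cases i with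
  | zero => simp
  | succ i =>
    rw [Nat.testBit_or, Nat.testBit_succ, Nat.testBit_succ, show (2 * y + 1 - 1) / 2 = y by omega,
      show (2 * y + 1) / 2 = y by omega, Bool.or_self]

lemma addLowBit_even {y : ℕ} (hy : 0 < y) : addLowBit (2 * y) = 2 * addLowBit y := by
  have : 2 * y ||| (2 * y - 1) = 2 * (y ||| (y - 1)) + 1 := by
    refine Nat.eq_of_testBit_eq fun i => ?_
    cases i with
    | zero => simp; omega
    | succ i =>
      rw [Nat.testBit_or, Nat.testBit_succ, Nat.testBit_succ, Nat.testBit_succ,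
        show (2 * y - 1) / 2 = y - 1 by omega, show 2 * y / 2 = y by omega,
        show (2 * (y ||| y - 1) + 1) / 2 = y ||| y - 1 by omega, Nat.testBit_or]
  unfold addLowBit
  omega

lemma lt_addLowBit (x : ℕ) : x < addLowBit x := Nat.lt_succ_of_le Nat.left_le_or

lemma pop_addLowBit_le {x : ℕ} (hx : 0 < x) : pop (addLowBit x) ≤ pop x := by
  induction x using Nat.strong_induction_on with
  | _ x ih =>
    obtain ⟨y, rfl | rfl⟩ := x.even_or_odd'
    · rw [addLowBit_even (by omega), pop_two_mul, pop_two_mul]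
      exact ih y (by omega) (by omega)
    · rw [addLowBit_odd, show 2 * y + 1 + 1 = 2 * (y + 1) by ring, pop_two_mul,
        pop_two_mul_add_one]
      exact pop_succ_le y

lemma pop_lt_of_lt_addLowBit {x z : ℕ} (hx : 0 < x) (hxz : x < z) (hz : z < addLowBit x) :
    pop x < pop z := by
  induction x using Nat.strong_induction_on generalizing z with
  | _ x ih =>
    obtain ⟨y, rfl | rfl⟩ := x.even_or_odd'
    · rw [addLowBit_even (by omega)] at hz
      rw [pop_two_mul]
      obtain ⟨u, rfl | rfl⟩ := z.even_or_odd'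
      · rw [pop_two_mul]
        exact ih y (by omega) (by omega) (by omega) (by omega)
      · rw [pop_two_mul_add_one]
        rcases (show y = u ∨ y < u by omega) with rfl | h
        · omega
        · have := ih y (by omega) (by omega) h (by omega)
          omega
    · rw [addLowBit_odd] at hz
      omega

/-- The successor of `x` among the numbers with at most `b` ones. -/
def succMask (b x : ℕ) : ℕ := if pop x < b then x + 1 else addLowBit x

lemma lt_succMask (b x : ℕ) : x < succMask b x := by
  unfold succMask
  split
  · omega
  · exact lt_addLowBit x

lemma pop_succMask_le {b x : ℕ} (hb : 0 < b) (hx : pop x ≤ b) : pop (succMask b x) ≤ b := by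
  unfold succMask
  split
  · exact (pop_succ_le x).trans (by omega)
  · refine (pop_addLowBit_le ?_).trans hx
    by_contra h
    obtain rfl : x = 0 := by omega
    simp at *
    omega

lemma lt_pop_of_lt_succMask {b x z : ℕ} (hb : 0 < b) (hxz : x < z) (hz : z < succMask b x) :
    b < pop z := by
  unfold succMask at hz
  split at hz
  · omega
  · have hx : 0 < x := by
      by_contra h
      obtain rfl : x = 0 := by omega
      simp at *
      omega
    have := pop_lt_of_lt_addLowBit hx hxz hz
    omega

lemma addLowBit_le_two_pow {n x : ℕ} (hx : x < 2 ^ n) : addLowBit x ≤ 2 ^ n :=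
  Nat.succ_le_of_lt (Nat.or_lt_two_pow hx (by omega))

/-- The number of masks from `x` on below `2 ^ n` with at most `b` ones. -/
def remaining (n b x : ℕ) : ℕ := ((Finset.Ico x (2 ^ n)).filter fun y => pop y ≤ b).card

lemma remaining_lt {n b x y : ℕ} (h : x < y) (hx : x < 2 ^ n) (hp : pop x ≤ b) :
    remaining n b y + 1 ≤ remaining n b x := by
  refine Nat.succ_le_of_lt (Finset.card_lt_card ?_)
  rw [Finset.ssubset_iff_of_subset
    (Finset.filter_subset_filter _ (Finset.Ico_subset_Ico_left h.le))]
  exact ⟨x, by simp [hx, hp], by simp [h]⟩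

/-- The set difference of two masks. -/
def diff (x y : ℕ) : ℕ := (x ||| y) ^^^ y

@[simp] lemma testBit_diff (x y i : ℕ) : (diff x y).testBit i = (x.testBit i && !y.testBit i) := by
  simp only [diff, Nat.testBit_xor, Nat.testBit_or]
  cases x.testBit i <;> cases y.testBit i <;> rfl

lemma diff_le (x y : ℕ) : diff x y ≤ x :=
  Nat.le_of_testBit fun i hi => by
    rw [testBit_diff, Bool.and_eq_true] at hi
    exact hi.1

/-- The mask of the universe. -/
def full (n : ℕ) : ℕ := 2 ^ n - 1

@[simp] lemma testBit_full (n i : ℕ) : (full n).testBit i = decide (i < n) := by simp [full]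

lemma full_lt (n : ℕ) : full n < 2 ^ n := Nat.sub_lt (Nat.two_pow_pos n) one_pos

lemma xor_full {n x : ℕ} (hx : x < 2 ^ n) : x ^^^ full n = diff (full n) x := by
  refine Nat.eq_of_testBit_eq fun i => ?_
  rw [Nat.testBit_xor, testBit_diff, testBit_full]
  by_cases hi : i < n
  · simp [hi]
  · rw [Nat.testBit_lt_two_pow (hx.trans_le (Nat.pow_le_pow_right (by norm_num) (by omega)))]
    simp [hi]

variable {n m : ℕ}

/-- The mask of a set of elements. -/
def mask (A : Finset (Fin n)) : ℕ := ∑ i ∈ A.map Fin.valEmbedding, 2 ^ i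

lemma bitIndices_mask (A : Finset (Fin n)) :
    (mask A).bitIndices.toFinset = A.map Fin.valEmbedding :=
  Finset.toFinset_bitIndices_sum_two_pow _

lemma testBit_mask_iff (A : Finset (Fin n)) (i : ℕ) :
    (mask A).testBit i = true ↔ ∃ u ∈ A, u.val = i := by
  rw [← Nat.mem_bitIndices, ← List.mem_toFinset, bitIndices_mask]
  simp

lemma testBit_mask (A : Finset (Fin n)) (u : Fin n) : (mask A).testBit u.val = decide (u ∈ A) := by
  rw [Bool.eq_iff_iff, testBit_mask_iff, decide_eq_true_iff]
  exact ⟨fun ⟨v, hv, h⟩ => Fin.ext h ▸ hv, fun h => ⟨u, h, rfl⟩⟩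

lemma pop_mask (A : Finset (Fin n)) : pop (mask A) = A.card := by
  rw [pop_eq_card, bitIndices_mask, Finset.card_map]

lemma mask_lt (A : Finset (Fin n)) : mask A < 2 ^ n := by
  refine Nat.lt_pow_two_of_testBit _ fun i hi => ?_
  rw [Bool.eq_false_iff]
  intro h
  obtain ⟨u, _, rfl⟩ := (testBit_mask_iff A i).1 h
  omega

lemma mask_injective : Function.Injective (mask : Finset (Fin n) → ℕ) := by
  intro A B h
  ext u
  have := testBit_mask A u
  rw [h, testBit_mask] at this
  simpa using this.symm

/-- The elements of the mask `X` can be covered by `j` sets of the family. -/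
def CoverBy (N : Family n m) (j X : ℕ) : Prop :=
  ∃ S : Finset (Fin m), S.card ≤ j ∧
    ∀ i, X.testBit i = true → ∃ f ∈ S, (mask (N f)).testBit i = true

lemma CoverBy.mono {N : Family n m} {j j' X X' : ℕ} (h : CoverBy N j X) (hj : j ≤ j')
    (hX : ∀ i, X'.testBit i = true → X.testBit i = true) : CoverBy N j' X' := by
  obtain ⟨S, hS, h⟩ := h
  exact ⟨S, hS.trans hj, fun i hi => h i (hX i hi)⟩

lemma CoverBy.zero (N : Family n m) (j : ℕ) : CoverBy N j 0 := ⟨∅, by simp, by simp⟩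

lemma CoverBy.union {N : Family n m} {j j' X X' Z : ℕ} (h : CoverBy N j X) (h' : CoverBy N j' X')
    (hZ : ∀ i, Z.testBit i = true → X.testBit i = true ∨ X'.testBit i = true) :
    CoverBy N (j + j') Z := by
  classical
  obtain ⟨S, hS, h⟩ := h
  obtain ⟨S', hS', h'⟩ := h'
  refine ⟨S ∪ S', (Finset.card_union_le _ _).trans (by omega), fun i hi => ?_⟩
  rcases hZ i hi with hi | hi
  · obtain ⟨f, hf, h⟩ := h i hi
    exact ⟨f, Finset.mem_union_left _ hf, h⟩
  · obtain ⟨f, hf, h⟩ := h' i hi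
    exact ⟨f, Finset.mem_union_right _ hf, h⟩

lemma CoverBy.of_diff {N : Family n m} {j X : ℕ} {f : Fin m}
    (h : CoverBy N j (diff X (mask (N f)))) : CoverBy N (j + 1) X := by
  refine h.union (j' := 1) (X' := mask (N f)) ⟨{f}, by simp, fun i hi => ⟨f, by simp, hi⟩⟩ ?_
  intro i hi
  rw [testBit_diff]
  cases (mask (N f)).testBit i <;> simp [hi]

/-- A cover of a nonempty mask contains a set that meets the mask. -/
lemma CoverBy.exists_diff {N : Family n m} {j X : ℕ} (h : CoverBy N j X) (hX : X ≠ 0) :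
    ∃ f : Fin m, 0 < j ∧ CoverBy N (j - 1) (diff X (mask (N f))) ∧ diff X (mask (N f)) < X := by
  classical
  obtain ⟨S, hS, h⟩ := h
  obtain ⟨i, hi⟩ := Nat.exists_testBit_of_ne_zero hX
  obtain ⟨f, hf, hfi⟩ := h i hi
  have hpos := Finset.card_pos.2 ⟨f, hf⟩
  refine ⟨f, by omega, ⟨S.erase f, ?_, ?_⟩, ?_⟩
  · rw [Finset.card_erase_of_mem hf]; omega
  · intro i' hi'
    rw [testBit_diff, Bool.and_eq_true] at hi'
    obtain ⟨g, hg, hgi⟩ := h i' hi'.1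
    refine ⟨g, Finset.mem_erase.2 ⟨?_, hg⟩, hgi⟩
    rintro rfl
    rw [hgi] at hi'
    simp at hi'
  · refine lt_of_le_of_ne (diff_le _ _) fun heq => ?_
    rw [← heq, testBit_diff, hfi] at hi
    simp at hi

lemma hasCover_of_coverBy {N : Family n m} {s : ℕ} (h : CoverBy N s (full n)) : HasCover N s := by
  obtain ⟨S, hS, h⟩ := h
  refine ⟨S, Finset.eq_univ_iff_forall.2 fun u => ?_, hS⟩
  obtain ⟨f, hf, hfu⟩ := h u.val (by simp)
  rw [testBit_mask, decide_eq_true_iff] at hfu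
  exact Finset.mem_biUnion.2 ⟨f, hf, hfu⟩

end SetCover

/-! ### The program -/

namespace SetCover

open WordRAM

/-- The instructions of the program. Registers `0`–`12` hold constants: `n`, `s`, the address
`3 + m * n` of the table, the address `3 + m * n + 2 ^ n` of the popcounts, `2 ^ n`, the size bound
`k` of the table, the size bound `e` of the enumerated sets, `1`, `0`, `3`, the mask of the
universe, `2 * n + 3` and `4 * n + 6`. Register `24` holds the number of remaining samples and
register `28` tells whether the sampling phase has begun. -/
def instructions : List Instr := [
  -- `0`: read the input
  .const 7 1, .const 9 3, .load 0 8, .load 13 7, .const 19 2, .load 1 19, .bin .mul 2 13 0,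
  .bin .add 2 2 9, .const 18 3,
  -- `9`: replace the first entry of every row by the mask of the row
  .jeq 18 2 22, .const 16 0, .const 17 0,
  .jeq 17 0 19, .bin .add 19 18 17, .load 19 19, .bin .shl 19 19 17, .bin .or 16 16 19,
  .bin .add 17 17 7, .jeq 8 8 12,
  .store 18 16, .bin .add 18 18 0, .jeq 8 8 9,
  -- `22`: compute the parameters
  .const 19 8192, .bin .mul 19 19 0, .bin .mul 20 1 1, .bin .div 21 20 19, .bin .shl 4 7 0,
  .bin .add 3 2 4, .bin .sub 10 4 7, .bin .add 20 0 0, .bin .add 11 20 9, .bin .add 12 11 11,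
  .bin .mul 19 21 1, .bin .add 5 0 8,
  .jlt 19 20 43,
  .const 19 2, .bin .div 20 0 19, .bin .sub 5 20 21, .bin .mul 6 9 21, .const 20 4,
  .bin .div 20 1 20, .bin .sub 20 0 20, .bin .shl 24 19 20,
  -- `43`: the table entry of the empty set
  .bin .add 19 0 7, .store 2 19, .const 13 0,
  -- `46`: fill the table; the current set is in register `13`
  .jlt 13 4 48, .jeq 8 8 96,
  .bin .shr 19 13 7, .bin .add 19 19 3, .load 19 19, .bin .and 20 13 7, .bin .add 19 19 20,
  .bin .add 20 13 3, .store 20 19, .bin .add 14 13 8, .bin .xor 15 13 10,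
  -- `57`: the best table entries of the sets in registers `14` and `15` minus one member
  .const 16 0, .const 17 0, .const 18 3,
  .jeq 18 2 76,
  .load 19 18, .bin .or 20 14 19, .bin .xor 20 20 19, .bin .add 20 20 2, .load 20 20,
  .jlt 20 16 68, .bin .add 16 20 8,
  .bin .or 20 15 19, .bin .xor 20 20 19, .bin .add 20 20 2, .load 20 20,
  .jlt 20 17 74, .bin .add 17 20 8,
  .bin .add 18 18 0, .jeq 8 8 60,
  -- `76`: return to the loop that asked for them
  .jeq 28 8 78, .jeq 8 8 118,
  -- `78`: update the table entry, test for a cover and go to the next set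
  .bin .add 20 13 2, .load 19 20, .bin .add 21 19 7,
  .jlt 21 16 83, .jeq 8 8 85,
  .bin .sub 19 16 7, .store 20 19,
  .bin .add 19 19 17, .bin .add 19 19 1,
  .jlt 19 11 89, .halt true,
  .bin .add 20 13 3, .load 19 20,
  .jlt 19 5 94, .bin .sub 19 13 7, .bin .or 13 13 19,
  .bin .add 13 13 7, .jeq 8 8 46,
  -- `96`: draw the samples; the current one is in register `26`, its complement in register `27`
  .const 28 1,
  .jeq 24 8 137, .bin .sub 24 24 7, .const 26 0, .bin .add 25 0 8,
  .jeq 25 8 107, .coin 19, .bin .add 26 26 26, .bin .add 26 26 19, .bin .sub 25 25 7, .jeq 8 8 101,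
  -- `107`: enumerate the small sets, in register `13`
  .const 13 0, .const 22 0, .const 23 0, .bin .xor 27 26 10,
  .jlt 13 4 113, .jeq 8 8 133,
  .bin .or 14 26 13, .bin .xor 14 14 13, .bin .or 15 27 13, .bin .xor 15 15 13, .jeq 8 8 57,
  -- `118`: update the best values for the two sides and go to the next small set
  .bin .add 20 13 2, .load 19 20, .bin .add 20 19 16,
  .jlt 20 22 123, .bin .add 22 20 8,
  .bin .add 20 19 17,
  .jlt 20 23 126, .bin .add 23 20 8,
  .bin .add 20 13 3, .load 19 20,
  .jlt 19 6 131, .bin .sub 19 13 7, .bin .or 13 13 19,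
  .bin .add 13 13 7, .jeq 8 8 111,
  -- `133`: test for a cover
  .bin .add 19 22 23, .bin .add 19 19 1,
  .jlt 19 12 97, .halt true,
  .halt false]

/-- The algorithm as a word-RAM program. -/
def prog : Program := instructions

section Eval

variable {w a b : ℕ}

lemma natEval_add (h : a + b < 2 ^ w) : BinOp.natEval w .add a b = a + b := Nat.mod_eq_of_lt h

lemma natEval_sub (hb : b ≤ a) (h : a < 2 ^ w) : BinOp.natEval w .sub a b = a - b := by
  rw [BinOp.natEval, show 2 ^ w - b + a = a - b + 2 ^ w by omega, Nat.add_mod_right,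
    Nat.mod_eq_of_lt (by omega)]

lemma natEval_mul (h : a * b < 2 ^ w) : BinOp.natEval w .mul a b = a * b := Nat.mod_eq_of_lt h

lemma natEval_shl (h : a * 2 ^ b < 2 ^ w) : BinOp.natEval w .shl a b = a * 2 ^ b := by
  rw [BinOp.natEval, Nat.shiftLeft_eq, Nat.mod_eq_of_lt h]

lemma natEval_diff (x y : ℕ) :
    BinOp.natEval w .xor (BinOp.natEval w .or x y) y = diff x y := rfl

lemma natEval_and_one (x : ℕ) : BinOp.natEval w .and x 1 = x % 2 := Nat.and_one_is_mod x

lemma natEval_shr_one (x : ℕ) : BinOp.natEval w .shr x 1 = x / 2 := rfl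

lemma natEval_div : BinOp.natEval w .div a b = a / b := rfl

lemma natEval_or : BinOp.natEval w .or a b = a ||| b := rfl

lemma natEval_xor : BinOp.natEval w .xor a b = a ^^^ b := rfl

end Eval

/-- The registers that hold constants have their values. -/
structure Consts (n m s k e : ℕ) (reg : ℕ → ℕ) : Prop where
  r0 : reg 0 = n
  r1 : reg 1 = s
  r2 : reg 2 = 3 + m * n
  r3 : reg 3 = 3 + m * n + 2 ^ n
  r4 : reg 4 = 2 ^ n
  r5 : reg 5 = k
  r6 : reg 6 = e
  r7 : reg 7 = 1
  r8 : reg 8 = 0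
  r9 : reg 9 = 3
  r10 : reg 10 = full n
  r11 : reg 11 = 2 * n + 3
  r12 : reg 12 = 4 * n + 6

lemma Consts.congr {n m s k e : ℕ} {reg reg' : ℕ → ℕ} (h : Consts n m s k e reg)
    (h' : ∀ r, r < 13 → reg' r = reg r) : Consts n m s k e reg' := by
  obtain ⟨h0, h1, h2, h3, h4, h5, h6, h7, h8, h9, h10, h11, h12⟩ := h
  constructor <;> rw [h' _ (by norm_num)] <;> assumption

lemma Consts.update {n m s k e r v : ℕ} {reg : ℕ → ℕ} (h : Consts n m s k e reg) (hr : 13 ≤ r) :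
    Consts n m s k e (Function.update reg r v) :=
  h.congr fun _ hr' => Function.update_of_ne (by omega) _ _

/-- `h` is the best table entry of the set `Z` minus one member of the family. -/
def IsBest {n m : ℕ} (N : Family n m) (mem : ℕ → ℕ) (Z h : ℕ) : Prop :=
  (∀ f, mem (diff Z (mask (N f)) + (3 + m * n)) ≤ h) ∧
    (h = 0 ∨ ∃ f, h = mem (diff Z (mask (N f)) + (3 + m * n)))

/-- Words are long enough for all values that occur. -/
structure Fits (n m s w : ℕ) : Prop where
  n_pos : 1 ≤ n
  m_pos : 1 ≤ m
  s_le : s ≤ n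
  big : 10000 + m * n + 4 * 2 ^ n + 8192 * n + n * n < 2 ^ w

section

variable {n m s k e w : ℕ} {N : Family n m} {ω : ℕ → Bool} {φ : Prop} {Q : NatConfig → Prop}
  {reg mem : ℕ → ℕ} {fl t : ℕ}

/-- `Run.block` for the program at hand. -/
lemma run_block {pc : ℕ} (l pc' : ℕ) (hpc : pc + l = pc')
    (hs : ((instructions.drop pc).take l).all Instr.straight = true)
    (hl : ((instructions.drop pc).take l).length = l)
    (h : Run prog w ω φ Q t ⟨pc', (block w ((instructions.drop pc).take l) reg mem).1,
      (block w ((instructions.drop pc).take l) reg mem).2, fl, none⟩) :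
    Run prog w ω φ Q (t + l) ⟨pc, reg, mem, fl, none⟩ :=
  Run.block l pc' hpc hs hl h

lemma run_best (hfit : Fits n m s w) (hc : Consts n m s k e reg)
    (hrows : ∀ f : Fin m, mem (3 + f.val * n) = mask (N f))
    (hv : ∀ X < 2 ^ n, mem (X + (3 + m * n)) ≤ n + 1)
    (h14 : reg 14 < 2 ^ n) (h15 : reg 15 < 2 ^ n)
    (hk : ∀ reg' : ℕ → ℕ, (∀ r, r < 16 ∨ 20 < r → reg' r = reg r) →
      IsBest N mem (reg 14) (reg' 16) → IsBest N mem (reg 15) (reg' 17) →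
      Run prog w ω φ Q t ⟨76, reg', mem, fl, none⟩) :
    Run prog w ω φ Q (t + 20 * m + 4) ⟨57, reg, mem, fl, none⟩ := by
  obtain ⟨hn, hm, hs, hbig⟩ := hfit
  have main : ∀ j f : ℕ, f + j = m → ∀ reg' : ℕ → ℕ, (∀ r, r < 16 ∨ 20 < r → reg' r = reg r) →
      reg' 18 = 3 + f * n →
      ((∀ g : Fin m, g.val < f → mem (diff (reg 14) (mask (N g)) + (3 + m * n)) ≤ reg' 16) ∧
        (reg' 16 = 0 ∨ ∃ g, reg' 16 = mem (diff (reg 14) (mask (N g)) + (3 + m * n)))) →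
      ((∀ g : Fin m, g.val < f → mem (diff (reg 15) (mask (N g)) + (3 + m * n)) ≤ reg' 17) ∧
        (reg' 17 = 0 ∨ ∃ g, reg' 17 = mem (diff (reg 15) (mask (N g)) + (3 + m * n)))) →
      Run prog w ω φ Q (t + 20 * j + 1) ⟨60, reg', mem, fl, none⟩ := by
    intro j
    induction j with
    | zero =>
      intro f hf reg' hfr h18 h16 h17
      obtain rfl : f = m := by omega
      have hc' := hc.congr (reg' := reg') fun r hr => hfr r (by omega)
      exact Run.jeq rfl (by rw [h18, hc'.r2]) (hk reg' hfr ⟨fun g => h16.1 g g.2, h16.2⟩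
        ⟨fun g => h17.1 g g.2, h17.2⟩)
    | succ j ih =>
      intro f hf reg' hfr h18 h16 h17
      have hc' := hc.congr (reg' := reg') fun r hr => hfr r (by omega)
      have hfm : f < m := by omega
      have hmul : f * n + n ≤ m * n := by
        rw [← Nat.succ_mul]; exact Nat.mul_le_mul_right n hfm
      have hrow : mem (3 + f * n) = mask (N ⟨f, hfm⟩) := hrows ⟨f, hfm⟩
      have e14 := hfr 14 (by omega)
      have e15 := hfr 15 (by omega)
      have d1 := diff_le (reg 14) (mask (N ⟨f, hfm⟩))
      have d2 := diff_le (reg 15) (mask (N ⟨f, hfm⟩))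
      have hv1 := hv _ (d1.trans_lt h14)
      have hv2 := hv _ (d2.trans_lt h15)
      -- taking the maximum with the entry for `f` preserves the invariant
      have upd : ∀ {Z h h' : ℕ},
          ((∀ g : Fin m, g.val < f → mem (diff Z (mask (N g)) + (3 + m * n)) ≤ h) ∧
            (h = 0 ∨ ∃ g, h = mem (diff Z (mask (N g)) + (3 + m * n)))) →
          h' = max h (mem (diff Z (mask (N ⟨f, hfm⟩)) + (3 + m * n))) →
          ((∀ g : Fin m, g.val < f + 1 → mem (diff Z (mask (N g)) + (3 + m * n)) ≤ h') ∧
            (h' = 0 ∨ ∃ g, h' = mem (diff Z (mask (N g)) + (3 + m * n)))) := by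
        rintro Z h h' ⟨ha, hb⟩ rfl
        refine ⟨fun g hg => ?_, ?_⟩
        · rcases Nat.lt_succ_iff_lt_or_eq.1 hg with hg | hg
          · exact (ha g hg).trans (le_max_left _ _)
          · obtain rfl : g = ⟨f, hfm⟩ := Fin.ext hg
            exact le_max_right _ _
        · rcases max_cases h (mem (diff Z (mask (N ⟨f, hfm⟩)) + (3 + m * n))) with ⟨h1, _⟩ | ⟨h1, _⟩
          · rw [h1]; exact hb
          · rw [h1]; exact Or.inr ⟨_, rfl⟩
      have last : ∀ reg'' : ℕ → ℕ, (∀ r, r < 16 ∨ 20 < r → reg'' r = reg r) →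
          reg'' 18 = 3 + f * n →
          reg'' 16 = max (reg' 16) (mem (diff (reg 14) (mask (N ⟨f, hfm⟩)) + (3 + m * n))) →
          reg'' 17 = max (reg' 17) (mem (diff (reg 15) (mask (N ⟨f, hfm⟩)) + (3 + m * n))) →
          Run prog w ω φ Q (t + 20 * j + 1 + 1 + 1) ⟨74, reg'', mem, fl, none⟩ := by
        intro reg'' hfr' h18' h16' h17'
        have hc'' := hc.congr (reg' := reg'') fun r hr => hfr' r (by omega)
        refine run_block 1 75 rfl rfl rfl ?_
        simp (disch := omega) only [instructions, List.drop_succ_cons, List.drop_zero,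
          List.take_succ_cons, List.take_zero, block, natEval_add, h18', hc''.r0]
        refine Run.jeq rfl rfl (ih (f + 1) (by omega) _ ?_ ?_ ?_ ?_)
        · intro r hr
          rw [Function.update_of_ne (by omega)]
          exact hfr' r (by omega)
        · rw [Function.update_self]; ring
        · rw [Function.update_of_ne (by omega)]; exact upd h16 h16'
        · rw [Function.update_of_ne (by omega)]; exact upd h17 h17'
      have second : ∀ reg'' : ℕ → ℕ,
          (∀ r, r < 16 ∨ 20 < r → reg'' r = reg r) →
          reg'' 18 = 3 + f * n → reg'' 19 = mask (N ⟨f, hfm⟩) → reg'' 17 = reg' 17 →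
          reg'' 16 = max (reg' 16) (mem (diff (reg 14) (mask (N ⟨f, hfm⟩)) + (3 + m * n))) →
          Run prog w ω φ Q (t + 20 * j + 1 + 1 + 1 + 1 + 1 + 4) ⟨68, reg'', mem, fl, none⟩ := by
        intro reg'' hfr' h18' h19' h17' h16'
        have hc'' := hc.congr (reg' := reg'') fun r hr => hfr' r (by omega)
        have e15 := hfr' 15 (by omega)
        refine run_block 4 72 rfl rfl rfl ?_
        simp (disch := omega) only [instructions, List.drop_succ_cons, List.drop_zero,
          List.take_succ_cons, List.take_zero, block, Function.update_self, Function.update_of_ne,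
          Function.update_idem, natEval_diff, natEval_add, h19', hc''.r2, e15]
        by_cases hlt : mem (diff (reg 15) (mask (N ⟨f, hfm⟩)) + (3 + m * n)) < reg' 17
        · refine Run.jlt rfl (by
            simp (disch := omega) only [Function.update_self, Function.update_of_ne, h17']
            exact hlt) (Run.mono (last _ ?_ ?_ ?_ ?_) (by omega))
          · intro r hr
            rw [Function.update_of_ne (by omega)]; exact hfr' r hr
          all_goals simp (disch := omega) only [Function.update_of_ne]
          · exact h18'
          · exact h16'
          · rw [h17', max_eq_left hlt.le]
        · refine Run.jlt_not rfl (by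
            simp (disch := omega) only [Function.update_self, Function.update_of_ne, h17']
            exact hlt) ?_
          refine run_block 1 74 rfl rfl rfl ?_
          simp (disch := omega) only [instructions, List.drop_succ_cons, List.drop_zero,
            List.take_succ_cons, List.take_zero, block, Function.update_self,
            Function.update_of_ne, natEval_add, hc''.r8, add_zero]
          refine last _ ?_ ?_ ?_ ?_
          · intro r hr
            rw [Function.update_of_ne (by omega), Function.update_of_ne (by omega)]
            exact hfr' r hr
          all_goals simp (disch := omega) only [Function.update_of_ne, Function.update_self]
          · exact h18'
          · exact h16'
          · rw [max_eq_right (not_lt.1 hlt)]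
      refine Run.mono (t := t + 20 * j + 1 + 1 + 1 + 1 + 1 + 4 + 1 + 1 + 5 + 1) ?_ (by omega)
      refine Run.jeq_not rfl (by rw [h18, hc'.r2]; omega) ?_
      refine run_block 5 66 rfl rfl rfl ?_
      simp (disch := omega) only [instructions, List.drop_succ_cons, List.drop_zero,
        List.take_succ_cons, List.take_zero, block, Function.update_self, Function.update_of_ne,
        Function.update_idem, natEval_diff, natEval_add, h18, hrow, hc'.r2, e14]
      by_cases hlt : mem (diff (reg 14) (mask (N ⟨f, hfm⟩)) + (3 + m * n)) < reg' 16
      · refine Run.jlt rfl (by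
          simp (disch := omega) only [Function.update_self, Function.update_of_ne]
          exact hlt) (Run.mono (second _ ?_ ?_ ?_ ?_ ?_) (by omega))
        · intro r hr
          rw [Function.update_of_ne (by omega), Function.update_of_ne (by omega)]
          exact hfr r (by omega)
        all_goals simp (disch := omega) only [Function.update_of_ne, Function.update_self]
        · exact h18
        · rw [max_eq_left hlt.le]
      · refine Run.jlt_not rfl (by
          simp (disch := omega) only [Function.update_self, Function.update_of_ne]
          exact hlt) ?_
        refine run_block 1 68 rfl rfl rfl ?_
        simp (disch := omega) only [instructions, List.drop_succ_cons, List.drop_zero,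
          List.take_succ_cons, List.take_zero, block, Function.update_self,
          Function.update_of_ne, natEval_add, hc'.r8, add_zero]
        refine second _ ?_ ?_ ?_ ?_ ?_
        · intro r hr
          rw [Function.update_of_ne (by omega), Function.update_of_ne (by omega),
            Function.update_of_ne (by omega)]
          exact hfr r (by omega)
        all_goals simp (disch := omega) only [Function.update_of_ne, Function.update_self]
        · exact h18
        · rw [max_eq_right (not_lt.1 hlt)]
  refine run_block 3 60 rfl rfl rfl ?_
  have hw3 : 3 % 2 ^ w = 3 := Nat.mod_eq_of_lt (by omega)
  simp only [instructions, List.drop_succ_cons, List.drop_zero, List.take_succ_cons,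
    List.take_zero, block, Nat.zero_mod, hw3]
  refine main m 0 (by omega) _ ?_ ?_ ?_ ?_
  · intro r hr
    rw [Function.update_of_ne (by omega), Function.update_of_ne (by omega),
      Function.update_of_ne (by omega)]
  all_goals simp (disch := omega) [Function.update_of_ne, Function.update_self]

end

end SetCover

/-! ### Filling the table -/

namespace SetCover

open WordRAM

section

variable {n m s k e w : ℕ} {N : Family n m} {ω : ℕ → Bool} {Q : NatConfig → Prop}
  {reg mem : ℕ → ℕ} {fl t : ℕ}

/-- The state of the memory when the table has been filled below `x`. The entry of a set that can
be covered by `j` sets, but not by fewer, is `n + 1 - j`; the entry `0` means that no cover is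
known. Soundness of the entries holds for all sets, their optimality only below `x`. According to
`no_cover`, the tests made so far would have revealed any cover that consists of one member of the
family and of covers of two sets with at most `k` elements each. -/
structure TableInv (N : Family n m) (s k : ℕ) (mem : ℕ → ℕ) (x : ℕ) : Prop where
  rows : ∀ f : Fin m, mem (3 + f.val * n) = mask (N f)
  le : ∀ X < 2 ^ n, mem (X + (3 + m * n)) ≤ n + 1
  sound : ∀ X < 2 ^ n, 0 < mem (X + (3 + m * n)) → CoverBy N (n + 1 - mem (X + (3 + m * n))) X
  empty : n + 1 ≤ mem (0 + (3 + m * n))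
  complete : ∀ X < 2 ^ n, X < x → pop X ≤ k → ∀ j, CoverBy N j X →
    n + 1 ≤ mem (X + (3 + m * n)) + j
  pops : ∀ X < 2 ^ n, X < x ∨ X = 0 → pop X ≤ k → mem (X + (3 + m * n + 2 ^ n)) = pop X
  no_cover : ∀ Y < 2 ^ n, Y < x → pop Y ≤ k → ∀ Z ≤ Y, pop Z ≤ k → ∀ f,
    (∀ i < n, Y.testBit i = true ∨ Z.testBit i = true ∨ (mask (N f)).testBit i = true) →
    ∀ j j', CoverBy N j Y → CoverBy N j' Z → s < j + 1 + j'

lemma diff_lt {X Y : ℕ} (hX : X < 2 ^ n) : diff X Y < 2 ^ n := (diff_le X Y).trans_lt hX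

lemma TableInv.coverBy_of_isBest {x Z h : ℕ} (hT : TableInv N s k mem x) (hZ : Z < 2 ^ n)
    (hb : IsBest N mem Z h) (h0 : 0 < h) : h ≤ n + 1 ∧ CoverBy N (n + 2 - h) Z := by
  obtain ⟨_, h' | ⟨f, hf⟩⟩ := hb
  · omega
  · have h1 := hT.le _ (diff_lt (Y := mask (N f)) hZ)
    have h2 := hT.sound _ (diff_lt (Y := mask (N f)) hZ)
    rw [← hf] at h1 h2
    exact ⟨h1, (h2 h0).of_diff.mono (by omega) fun i hi => hi⟩

/-- The test of the table loop is sound: `v` is the entry of `x`, and `h₂` accounts for the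
complement of `x`. -/
lemma TableInv.hasCover {x h₂ v : ℕ} (hs : s ≤ n) (hT : TableInv N s k mem x)
    (hv : v ≤ n + 1) (hvc : 0 < v → CoverBy N (n + 1 - v) x)
    (h2 : IsBest N mem (diff (full n) x) h₂) (hc : 2 * n + 3 ≤ v + h₂ + s) : HasCover N s := by
  have h20 : 0 < h₂ := by omega
  have ⟨h2le, h2c⟩ := hT.coverBy_of_isBest (diff_lt (full_lt n)) h2 h20
  refine hasCover_of_coverBy (((hvc (by omega)).union h2c (Z := full n) ?_).mono
    (by omega) fun i hi => hi)
  intro i hi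
  rw [testBit_diff, hi]
  cases x.testBit i <;> simp

/-- The new entry of `x` is sound. -/
lemma TableInv.entry {x h₁ : ℕ} (hT : TableInv N s k mem x) (hx : x < 2 ^ n)
    (h1 : IsBest N mem x h₁) :
    max (mem (x + (3 + m * n))) (h₁ - 1) ≤ n + 1 ∧
      (0 < max (mem (x + (3 + m * n))) (h₁ - 1) →
        CoverBy N (n + 1 - max (mem (x + (3 + m * n))) (h₁ - 1)) x) := by
  rcases le_total (h₁ - 1) (mem (x + (3 + m * n))) with h | h
  · rw [max_eq_left h]
    exact ⟨hT.le x hx, hT.sound x hx⟩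
  · rw [max_eq_right h]
    by_cases h0 : 0 < h₁
    · have ⟨h1le, h1c⟩ := hT.coverBy_of_isBest hx h1 h0
      exact ⟨by omega, fun h' => h1c.mono (by omega) fun i hi => hi⟩
    · exact ⟨by omega, fun h' => by omega⟩

/-- If the test at `x` does not reveal a cover, then the invariant extends to the next set. The sets
skipped by `succMask` have more than `k` elements, so that nothing is claimed about them. -/
lemma TableInv.step {x h₁ h₂ : ℕ} (hn : 1 ≤ n) (hk : 0 < k) (hT : TableInv N s k mem x)
    (hx : x < 2 ^ n) (hxk : pop x ≤ k) (h1 : IsBest N mem x h₁)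
    (h2 : IsBest N mem (diff (full n) x) h₂)
    (hc : max (mem (x + (3 + m * n))) (h₁ - 1) + h₂ + s < 2 * n + 3) :
    TableInv N s k (Function.update (Function.update mem (x + (3 + m * n + 2 ^ n)) (pop x))
      (x + (3 + m * n)) (max (mem (x + (3 + m * n))) (h₁ - 1))) (succMask k x) := by
  set v := max (mem (x + (3 + m * n))) (h₁ - 1) with hv
  set mem' := Function.update (Function.update mem (x + (3 + m * n + 2 ^ n)) (pop x))
      (x + (3 + m * n)) v with hmem'
  have hent := hT.entry hx h1
  rw [← hv] at hent
  have tab_self : mem' (x + (3 + m * n)) = v := by rw [hmem', Function.update_self]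
  have tab_ne : ∀ X < 2 ^ n, X ≠ x → mem' (X + (3 + m * n)) = mem (X + (3 + m * n)) := by
    intro X hX hne
    rw [hmem', Function.update_of_ne (by omega), Function.update_of_ne (by omega)]
  have tab_ge : ∀ X < 2 ^ n, mem (X + (3 + m * n)) ≤ mem' (X + (3 + m * n)) := by
    intro X hX
    by_cases hne : X = x
    · subst hne; rw [tab_self]; exact le_max_left _ _
    · rw [tab_ne X hX hne]
  have opt : ∀ j, CoverBy N j x → n + 1 ≤ v + j := by
    intro j hj
    by_cases hx0 : x = 0
    · subst hx0
      have := hT.empty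
      have := le_max_left (mem (0 + (3 + m * n))) (h₁ - 1)
      omega
    · obtain ⟨f, hj0, hjf, hlt⟩ := hj.exists_diff hx0
      have h3 := hT.complete _ (hlt.trans hx) hlt
        ((pop_mono fun i hi => by
          rw [testBit_diff, Bool.and_eq_true] at hi; exact hi.1).trans hxk) _ hjf
      have h4 := h1.1 f
      have := le_max_right (mem (x + (3 + m * n))) (h₁ - 1)
      omega
  have cases_lt : ∀ X, X < succMask k x → pop X ≤ k → X < x ∨ X = x := by
    intro X hX hXk
    by_contra hcon
    have := lt_pop_of_lt_succMask hk (show x < X by omega) hX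
    omega
  refine ⟨?_, ?_, ?_, ?_, ?_, ?_, ?_⟩
  · intro f
    have hf : f.val * n + n ≤ m * n := by
      rw [← Nat.succ_mul]; exact Nat.mul_le_mul_right n f.2
    rw [hmem', Function.update_of_ne (by omega), Function.update_of_ne (by omega), hT.rows]
  · intro X hX
    by_cases hne : X = x
    · subst hne; rw [tab_self]; exact hent.1
    · rw [tab_ne X hX hne]; exact hT.le X hX
  · intro X hX
    by_cases hne : X = x
    · subst hne; rw [tab_self]; exact hent.2
    · rw [tab_ne X hX hne]; exact hT.sound X hX
  · exact hT.empty.trans (tab_ge 0 (Nat.two_pow_pos n))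
  · intro X hX hlt hXk j hj
    rcases cases_lt X hlt hXk with h | rfl
    · rw [tab_ne X hX h.ne]; exact hT.complete X hX h hXk j hj
    · rw [tab_self]; exact opt j hj
  · intro X hX hlt hXk
    rw [hmem', Function.update_of_ne (by omega)]
    by_cases hne : X = x
    · subst hne; rw [Function.update_self]
    · rw [Function.update_of_ne (by omega)]
      refine hT.pops X hX ?_ hXk
      rcases hlt with h | h
      · rcases cases_lt X h hXk with h | h
        · exact Or.inl h
        · exact absurd h hne
      · exact Or.inr h
  · intro Y hY hlt hYk Z hZ hZk f hf j j' hj hj'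
    rcases cases_lt Y hlt hYk with h | rfl
    · exact hT.no_cover Y hY h hYk Z hZ hZk f hf j j' hj hj'
    · set Z' := diff (diff (full n) Y) (mask (N f)) with hZ'
      have hsub : ∀ i, Z'.testBit i = true → Z.testBit i = true ∧ Y.testBit i = false := by
        intro i hi
        simp only [hZ', testBit_diff, testBit_full, Bool.and_eq_true, decide_eq_true_eq,
          Bool.not_eq_true'] at hi
        rcases hf i hi.1.1 with h | h | h
        · rw [hi.1.2] at h; simp at h
        · exact ⟨h, hi.1.2⟩
        · rw [hi.2] at h; simp at h
      have hle : Z' ≤ Z := Nat.le_of_testBit fun i hi => (hsub i hi).1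
      have hbest : mem (Z' + (3 + m * n)) ≤ h₂ := h2.1 f
      have hcov := hj'.mono le_rfl fun i hi => (hsub i hi).1
      have hZtab : n + 1 ≤ mem (Z' + (3 + m * n)) + j' := by
        by_cases hne : Z' = Y
        · -- only possible if both are empty
          have h0 : Z' = 0 := by
            refine Nat.zero_of_testBit_eq_false fun i => ?_
            by_contra hcon
            rw [Bool.not_eq_false] at hcon
            have := (hsub i hcon).2
            rw [← hne, hcon] at this
            simp at this
          rw [h0]
          have := hT.empty
          omega
        · exact hT.complete Z' (by omega) (by omega)
            ((pop_mono fun i hi => (hsub i hi).1).trans hZk) j' hcov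
      have := opt j hj
      omega

/-- The size of `x` is computed from the size of `x / 2`. -/
lemma TableInv.mem_pop {x : ℕ} (hT : TableInv N s k mem x) (hx : x < 2 ^ n) (hxk : pop x ≤ k) :
    mem (x / 2 + (3 + m * n + 2 ^ n)) + x % 2 = pop x := by
  rw [hT.pops (x / 2) (by omega) (by omega) ((pop_div_two_le x).trans hxk), ← pop_eq]

lemma IsBest.congr {mem' : ℕ → ℕ} {Z h : ℕ} (hb : IsBest N mem Z h) (hZ : Z < 2 ^ n)
    (hmem : ∀ X < 2 ^ n, mem' (X + (3 + m * n)) = mem (X + (3 + m * n))) : IsBest N mem' Z h := by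
  obtain ⟨h1, h2⟩ := hb
  refine ⟨fun f => ?_, h2.imp id fun ⟨f, hf⟩ => ⟨f, ?_⟩⟩
  · rw [hmem _ (diff_lt hZ)]; exact h1 f
  · rw [hmem _ (diff_lt hZ)]; exact hf

/-- One round of the loop that fills the table. -/
lemma run_table_step (hfit : Fits n m s w) (hk0 : 0 < k) (hkn : k ≤ n) {x : ℕ}
    (hc : Consts n m s k e reg) (hT : TableInv N s k mem x) (h13 : reg 13 = x) (h28 : reg 28 = 0)
    (hx : x < 2 ^ n) (hxk : pop x ≤ k)
    (hk : ∀ reg' mem' : ℕ → ℕ, Consts n m s k e reg' → TableInv N s k mem' (succMask k x) →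
      reg' 13 = succMask k x → reg' 28 = 0 → reg' 24 = reg 24 →
      Run prog w ω (HasCover N s) Q t ⟨46, reg', mem', fl, none⟩) :
    Run prog w ω (HasCover N s) Q (t + 20 * m + 40) ⟨46, reg, mem, fl, none⟩ := by
  obtain ⟨hn, hm, hs, hbig⟩ := hfit
  have hpop := hT.mem_pop hx hxk
  have hpn : pop x ≤ n := hxk.trans hkn
  set mem₁ := Function.update mem (x + (3 + m * n + 2 ^ n)) (pop x) with hmem₁
  have tab₁ : ∀ X < 2 ^ n, mem₁ (X + (3 + m * n)) = mem (X + (3 + m * n)) := by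
    intro X hX
    rw [hmem₁, Function.update_of_ne (by omega)]
  refine Run.mono (t := t + 10 + 2 + 1 + 3 + 1 + 20 * m + 4 + 9 + 1) ?_ (by omega)
  refine Run.jlt (target := 48) rfl (by rw [h13, hc.r4]; exact hx) ?_
  refine run_block 9 57 rfl rfl rfl ?_
  simp (disch := decide) only [instructions, List.drop_succ_cons, List.drop_zero,
    List.take_succ_cons, List.take_zero, block, Function.update_self, Function.update_of_ne, h13,
    hc.r3, hc.r7, hc.r8, hc.r10]
  simp (disch := omega) only [natEval_add, natEval_shr_one, natEval_and_one, natEval_xor]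
  simp only [hpop, add_zero, xor_full hx, ← hmem₁]
  have hT₁ : ∀ f : Fin m, mem₁ (3 + f.val * n) = mask (N f) := by
    intro f
    have hf : f.val * n + n ≤ m * n := by
      rw [← Nat.succ_mul]; exact Nat.mul_le_mul_right n f.2
    rw [hmem₁, Function.update_of_ne (by omega), hT.rows]
  refine run_best ⟨hn, hm, hs, hbig⟩ ((((((((hc.update ?_).update ?_).update ?_).update ?_).update
    ?_).update ?_).update ?_).update ?_) hT₁ (fun X hX => by rw [tab₁ X hX]; exact hT.le X hX)
    ?_ ?_ ?_
  iterate 8 norm_num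
  · simp (disch := decide) only [Function.update_self, Function.update_of_ne]; exact hx
  · simp (disch := decide) only [Function.update_self]; exact diff_lt (full_lt n)
  intro reg₁ hfr h16 h17
  simp (disch := decide) only [Function.update_self, Function.update_of_ne] at h16 h17
  replace h16 := h16.congr (mem' := mem) hx fun X hX => (tab₁ X hX).symm
  replace h17 := h17.congr (mem' := mem) (diff_lt (full_lt n)) fun X hX => (tab₁ X hX).symm
  have hc₁ : Consts n m s k e reg₁ := hc.congr fun r hr => by
    rw [hfr r (by omega)]
    iterate 8 rw [Function.update_of_ne (by omega)]
  have f13 : reg₁ 13 = x := by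
    rw [hfr 13 (by omega)]
    simpa (disch := decide) only [Function.update_self, Function.update_of_ne] using h13
  have f28 : reg₁ 28 = 0 := by
    rw [hfr 28 (by omega)]
    simpa (disch := decide) only [Function.update_self, Function.update_of_ne] using h28
  have f24 : reg₁ 24 = reg 24 := by
    rw [hfr 24 (by omega)]
    simp (disch := decide) only [Function.update_of_ne]
  clear hfr
  have hle := hT.le x hx
  have tabx := tab₁ x hx
  have hh₁ : reg₁ 16 ≤ n + 1 := by
    rcases Nat.eq_zero_or_pos (reg₁ 16) with h | h
    · omega
    · exact (hT.coverBy_of_isBest hx h16 h).1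
  have hh₂ : reg₁ 17 ≤ n + 1 := by
    rcases Nat.eq_zero_or_pos (reg₁ 17) with h | h
    · omega
    · exact (hT.coverBy_of_isBest (diff_lt (full_lt n)) h17 h).1
  have hent := hT.entry hx h16
  set v := max (mem (x + (3 + m * n))) (reg₁ 16 - 1) with hv
  have rest : ∀ reg₂ : ℕ → ℕ, (∀ r, r < 19 ∨ 21 < r → reg₂ r = reg₁ r) → reg₂ 19 = v →
      Run prog w ω (HasCover N s) Q (t + 4 + 1 + 2 + 1 + 2)
        ⟨85, reg₂, Function.update mem₁ (x + (3 + m * n)) v, fl, none⟩ := by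
    intro reg₂ hfr₂ h19
    have hc₂ := hc₁.congr (reg' := reg₂) fun r hr => hfr₂ r (by omega)
    have g17 := hfr₂ 17 (by omega)
    have g13 := (hfr₂ 13 (by omega)).trans f13
    refine run_block 2 87 rfl rfl rfl ?_
    simp (disch := decide) only [instructions, List.drop_succ_cons, List.drop_zero,
    List.take_succ_cons, List.take_zero, block, Function.update_self, Function.update_of_ne, h19,
      g17, hc₂.r1]
    simp (disch := omega) only [natEval_add]
    by_cases hchk : v + reg₁ 17 + s < 2 * n + 3
    · refine Run.jlt (target := 89) rfl (by
        simp (disch := decide) only [Function.update_self, Function.update_of_ne, hc₂.r11]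
        exact hchk) ?_
      have hT' := hT.step hn hk0 hx hxk h16 h17 hchk
      refine run_block 2 91 rfl rfl rfl ?_
      simp (disch := decide) only [instructions, List.drop_succ_cons, List.drop_zero,
    List.take_succ_cons, List.take_zero, block, Function.update_self, Function.update_of_ne, g13,
        hc₂.r3]
      simp (disch := omega) only [natEval_add]
      have hp : Function.update mem₁ (x + (3 + m * n)) v (x + (3 + m * n + 2 ^ n)) = pop x := by
        rw [Function.update_of_ne (by omega), hmem₁, Function.update_self]
      rw [hp]
      by_cases hlt : pop x < k
      · refine Run.jlt (target := 94) rfl (by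
          simp (disch := decide) only [Function.update_self, Function.update_of_ne, hc₂.r5]
          exact hlt) (Run.mono (t := t + 1 + 1) ?_ (by omega))
        refine run_block 1 95 rfl rfl rfl ?_
        simp (disch := decide) only [instructions, List.drop_succ_cons, List.drop_zero,
    List.take_succ_cons, List.take_zero, block, Function.update_of_ne, g13, hc₂.r7]
        simp (disch := omega) only [natEval_add]
        have hsucc : succMask k x = x + 1 := by rw [succMask, if_pos hlt]
        refine Run.jeq rfl rfl (hk _ _ ?_ hT' ?_ ?_ ?_)
        · exact ((((hc₂.update (by norm_num)).update (by norm_num)).update (by norm_num)).update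
            (by norm_num)).update (by norm_num)
        all_goals simp (disch := decide) only [Function.update_self, Function.update_of_ne]
        · exact hsucc.symm
        · rw [hfr₂ 28 (by omega), f28]
        · rw [hfr₂ 24 (by omega), f24]
      · have hx0 : 1 ≤ x := by
          by_contra h
          obtain rfl : x = 0 := by omega
          rw [pop_zero] at hlt
          omega
        have hor := addLowBit_le_two_pow hx
        have hsucc : succMask k x = addLowBit x := by rw [succMask, if_neg hlt]
        refine Run.jlt_not rfl (by
          simp (disch := decide) only [Function.update_self, Function.update_of_ne, hc₂.r5]
          exact hlt) (Run.mono (t := t + 1 + 3) ?_ (by omega))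
        refine run_block 3 95 rfl rfl rfl ?_
        simp (disch := decide) only [instructions, List.drop_succ_cons, List.drop_zero,
    List.take_succ_cons, List.take_zero, block, Function.update_self, Function.update_of_ne, g13,
          hc₂.r7]
        simp (disch := omega) only [natEval_sub, natEval_or]
        rw [addLowBit] at hor hsucc
        simp (disch := omega) only [natEval_add]
        refine Run.jeq rfl rfl (hk _ _ ?_ hT' ?_ ?_ ?_)
        · exact ((((((hc₂.update (by norm_num)).update (by norm_num)).update (by norm_num)).update
            (by norm_num)).update (by norm_num)).update (by norm_num)).update (by norm_num)
        all_goals simp (disch := decide) only [Function.update_self, Function.update_of_ne]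
        · exact hsucc.symm
        · rw [hfr₂ 28 (by omega), f28]
        · rw [hfr₂ 24 (by omega), f24]
    · refine Run.jlt_not rfl (by
        simp (disch := decide) only [Function.update_self, Function.update_of_ne, hc₂.r11]
        exact hchk) (Run.mono (t := 0 + 1) ?_ (by omega))
      exact Run.halt_yes rfl (hT.hasCover hs hent.1 hent.2 h17 (by omega))
  refine Run.jeq (target := 78) rfl (by rw [f28, hc₁.r8]) ?_
  refine Run.mono (t := t + 10 + 2 + 1 + 3) ?_ (by omega)
  refine run_block 3 81 rfl rfl rfl ?_
  simp (disch := decide) only [instructions, List.drop_succ_cons, List.drop_zero,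
    List.take_succ_cons, List.take_zero, block, Function.update_self, Function.update_of_ne, f13,
    hc₁.r2, hc₁.r7]
  simp (disch := omega) only [natEval_add]
  simp only [tabx]
  by_cases hlt : mem (x + (3 + m * n)) + 1 < reg₁ 16
  · refine Run.jlt (target := 83) rfl (by
      simp (disch := decide) only [Function.update_self, Function.update_of_ne]
      exact hlt) ?_
    refine run_block 2 85 rfl rfl rfl ?_
    simp (disch := decide) only [instructions, List.drop_succ_cons, List.drop_zero,
    List.take_succ_cons, List.take_zero, block, Function.update_self, Function.update_of_ne, hc₁.r7]
    simp (disch := omega) only [natEval_sub]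
    have hv' : reg₁ 16 - 1 = v := by rw [hv, max_eq_right (by omega)]
    rw [hv']
    refine rest _ ?_ ?_
    · intro r hr
      iterate 4 rw [Function.update_of_ne (by omega)]
    · rw [Function.update_self]
  · refine Run.jlt_not rfl (by
      simp (disch := decide) only [Function.update_self, Function.update_of_ne]
      exact hlt) (Run.mono (t := t + 10 + 1) ?_ (by omega))
    have hv' : mem (x + (3 + m * n)) = v := by rw [hv, max_eq_left (by omega)]
    have := rest (Function.update (Function.update (Function.update reg₁ 20 (x + (3 + m * n))) 19
      (mem (x + (3 + m * n)))) 21 (mem (x + (3 + m * n)) + 1)) ?_ ?_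
    · rw [← hv', ← tabx, Function.update_eq_self, tabx] at this
      exact Run.jeq rfl rfl this
    · intro r hr
      iterate 3 rw [Function.update_of_ne (by omega)]
    · simp (disch := decide) only [Function.update_self, Function.update_of_ne]
      exact hv'

/-- The loop that fills the table. -/
lemma run_table (hfit : Fits n m s w) (hk0 : 0 < k) (hkn : k ≤ n) (d : ℕ) :
    ∀ (reg mem : ℕ → ℕ) (x : ℕ), Consts n m s k e reg → TableInv N s k mem x → reg 13 = x →
    reg 28 = 0 → (x < 2 ^ n → pop x ≤ k) → 2 ^ n ≤ x + d →
    (∀ reg' mem' : ℕ → ℕ, Consts n m s k e reg' → TableInv N s k mem' (2 ^ n) →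
      reg' 24 = reg 24 → Run prog w ω (HasCover N s) Q t ⟨96, reg', mem', fl, none⟩) →
    Run prog w ω (HasCover N s) Q (t + 2 + remaining n k x * (20 * m + 40))
      ⟨46, reg, mem, fl, none⟩ := by
  induction d with
  | zero =>
    intro reg mem x hc hT h13 h28 hxk hd hk
    refine Run.mono (t := t + 1 + 1) ?_ (by omega)
    refine Run.jlt_not rfl (by rw [h13, hc.r4]; omega) (Run.jeq rfl rfl (hk _ _ hc ?_ rfl))
    obtain ⟨h1, h2, h3, h4, h5, h6, h7⟩ := hT
    exact ⟨h1, h2, h3, h4, fun X hX _ => h5 X hX (by omega), fun X hX _ => h6 X hX (by omega),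
      fun Y hY _ => h7 Y hY (by omega)⟩
  | succ d ih =>
    intro reg mem x hc hT h13 h28 hxk hd hk
    by_cases hx : x < 2 ^ n
    · have hrem := remaining_lt (b := k) (lt_succMask k x) hx (hxk hx)
      refine Run.mono (t := t + 2 + remaining n k (succMask k x) * (20 * m + 40) + 20 * m + 40)
        ?_ ?_
      · refine run_table_step hfit hk0 hkn hc hT h13 h28 hx (hxk hx) ?_
        intro reg' mem' hc' hT' h13' h28' h24'
        refine ih reg' mem' _ hc' hT' h13' h28' (fun _ => pop_succMask_le hk0 (hxk hx)) ?_ ?_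
        · have := lt_succMask k x
          omega
        · intro reg'' mem'' hc'' hT'' h24''
          exact hk reg'' mem'' hc'' hT'' (h24''.trans h24')
      · calc _ = t + 2 + (remaining n k (succMask k x) + 1) * (20 * m + 40) := by ring
          _ ≤ _ := Nat.add_le_add_left (Nat.mul_le_mul_right _ hrem) _
    · refine Run.mono (t := t + 1 + 1) ?_ (by omega)
      refine Run.jlt_not rfl (by rw [h13, hc.r4]; omega) (Run.jeq rfl rfl (hk _ _ hc ?_ rfl))
      obtain ⟨h1, h2, h3, h4, h5, h6, h7⟩ := hT
      exact ⟨h1, h2, h3, h4, fun X hX _ => h5 X hX (by omega), fun X hX _ => h6 X hX (by omega),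
        fun Y hY _ => h7 Y hY (by omega)⟩

end

end SetCover

/-! ### Sampling -/

namespace SetCover

open WordRAM

section

variable {n m s k e w : ℕ} {N : Family n m} {ω : ℕ → Bool} {φ : Prop} {Q : NatConfig → Prop}
  {reg mem : ℕ → ℕ} {fl t : ℕ}

/-- The state of the search for a cheap way to write `W` as the union of a set with at most `e`
elements, a part of a member of the family and a set of the table: `a` is the best sum of table
entries among the small sets below `y`. -/
structure SplitInv (N : Family n m) (e : ℕ) (mem : ℕ → ℕ) (W y a : ℕ) : Prop where
  upper : ∀ Y < 2 ^ n, Y < y → pop Y ≤ e → ∀ f,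
    mem (Y + (3 + m * n)) + mem (diff (diff W Y) (mask (N f)) + (3 + m * n)) ≤ a
  attained : a = 0 ∨ ∃ Y < 2 ^ n, ∃ h, IsBest N mem (diff W Y) h ∧ a = mem (Y + (3 + m * n)) + h

lemma SplitInv.zero (W : ℕ) : SplitInv N e mem W 0 0 :=
  ⟨fun _ _ h => absurd h (Nat.not_lt_zero _), Or.inl rfl⟩

lemma SplitInv.step {W y a h : ℕ} (he : 0 < e) (hS : SplitInv N e mem W y a) (hy : y < 2 ^ n)
    (hb : IsBest N mem (diff W y) h) :
    SplitInv N e mem W (succMask e y) (max a (mem (y + (3 + m * n)) + h)) := by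
  refine ⟨fun Y hY hlt hYe f => ?_, ?_⟩
  · by_cases h1 : Y < y
    · exact (hS.upper Y hY h1 hYe f).trans (le_max_left _ _)
    · rcases (not_lt.1 h1).eq_or_lt with rfl | h1
      · exact (Nat.add_le_add_left (hb.1 f) _).trans (le_max_right _ _)
      · have := lt_pop_of_lt_succMask he h1 hlt
        omega
  · rcases max_cases a (mem (y + (3 + m * n)) + h) with ⟨h1, _⟩ | ⟨h1, _⟩
    · rw [h1]; exact hS.attained
    · rw [h1]; exact Or.inr ⟨y, hy, h, hb, rfl⟩

lemma SplitInv.final {W y a : ℕ} (hS : SplitInv N e mem W y a) (hy : 2 ^ n ≤ y) :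
    SplitInv N e mem W (2 ^ n) a :=
  ⟨fun Y hY _ => hS.upper Y hY (by omega), hS.attained⟩

lemma SplitInv.le {x W y a : ℕ} (hT : TableInv N s k mem x) (hW : W < 2 ^ n)
    (hS : SplitInv N e mem W y a) : a ≤ 2 * n + 2 := by
  rcases hS.attained with h | ⟨Y, hY, h, hb, rfl⟩
  · omega
  · have h1 := hT.le Y hY
    rcases Nat.eq_zero_or_pos h with h0 | h0
    · omega
    · have := (hT.coverBy_of_isBest (diff_lt hW) hb h0).1
      omega

lemma SplitInv.coverBy {x W y a : ℕ} (hT : TableInv N s k mem x) (hW : W < 2 ^ n)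
    (hS : SplitInv N e mem W y a) (ha : n + 2 ≤ a) : CoverBy N (2 * n + 3 - a) W := by
  rcases hS.attained with h | ⟨Y, hY, h, hb, rfl⟩
  · omega
  · have h1 := hT.le Y hY
    have h0 : 0 < h := by omega
    have ⟨h2, h3⟩ := hT.coverBy_of_isBest (diff_lt hW) hb h0
    have h4 := hT.sound Y hY (by omega)
    refine (h4.union h3 (Z := W) fun i hi => ?_).mono (by omega) fun i hi => hi
    rw [testBit_diff, hi]
    cases Y.testBit i <;> simp

/-- The set `W` does not lead to a cover with at most `s` sets when `W` and its complement are both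
written as the union of a set with at most `e` elements, a part of a member of the family and a set
with at most `k` elements. -/
def Fails (N : Family n m) (s k e W : ℕ) : Prop :=
  ∀ Y₁ Y₂ : ℕ, Y₁ < 2 ^ n → Y₂ < 2 ^ n → pop Y₁ ≤ e → pop Y₂ ≤ e → ∀ f₁ f₂ : Fin m,
    pop (diff (diff W Y₁) (mask (N f₁))) ≤ k →
    pop (diff (diff (diff (full n) W) Y₂) (mask (N f₂))) ≤ k → ∀ i₁ i₂ j₁ j₂ : ℕ,
    CoverBy N i₁ Y₁ → CoverBy N j₁ (diff (diff W Y₁) (mask (N f₁))) →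
    CoverBy N i₂ Y₂ → CoverBy N j₂ (diff (diff (diff (full n) W) Y₂) (mask (N f₂))) →
    s < i₁ + 1 + j₁ + (i₂ + 1 + j₂)

/-- The test after a sample is complete. Table entries are `n + 1` minus the number of sets used, so
the threshold `4 * n + 6` is four times `n + 1` plus the two members taken from the family. -/
lemma fails_of_splitInv {W a b : ℕ} (hek : e ≤ k) (hT : TableInv N s k mem (2 ^ n))
    (hW : W < 2 ^ n) (ha : SplitInv N e mem W (2 ^ n) a)
    (hb : SplitInv N e mem (diff (full n) W) (2 ^ n) b) (hc : a + b + s < 4 * n + 6) :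
    Fails N s k e W := by
  intro Y₁ Y₂ hY₁ hY₂ hp₁ hp₂ f₁ f₂ hq₁ hq₂ i₁ i₂ j₁ j₂ hi₁ hj₁ hi₂ hj₂
  have h1 := ha.upper Y₁ hY₁ hY₁ hp₁ f₁
  have h2 := hb.upper Y₂ hY₂ hY₂ hp₂ f₂
  have c1 := hT.complete Y₁ hY₁ hY₁ (hp₁.trans hek) _ hi₁
  have c2 := hT.complete Y₂ hY₂ hY₂ (hp₂.trans hek) _ hi₂
  have l1 : diff (diff W Y₁) (mask (N f₁)) < 2 ^ n := diff_lt (diff_lt hW)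
  have l2 : diff (diff (diff (full n) W) Y₂) (mask (N f₂)) < 2 ^ n :=
    diff_lt (diff_lt (diff_lt (full_lt n)))
  have c3 := hT.complete _ l1 l1 hq₁ _ hj₁
  have c4 := hT.complete _ l2 l2 hq₂ _ hj₂
  omega

lemma hasCover_of_splitInv {x y W a b : ℕ} (hs : s ≤ n) (hT : TableInv N s k mem x)
    (hW : W < 2 ^ n) (ha : SplitInv N e mem W y a)
    (hb : SplitInv N e mem (diff (full n) W) y b) (hc : 4 * n + 6 ≤ a + b + s) :
    HasCover N s := by
  have h1 := ha.le hT hW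
  have h2 := hb.le hT (diff_lt (full_lt n))
  refine hasCover_of_coverBy (((ha.coverBy hT hW (by omega)).union
    (hb.coverBy hT (diff_lt (full_lt n)) (by omega)) (Z := full n) fun i hi => ?_).mono
    (by omega) fun i hi => hi)
  rw [testBit_diff, hi]
  cases W.testBit i <;> simp

/-- One round of the loop over the small sets. -/
lemma run_small_step (hfit : Fits n m s w) (he0 : 0 < e) (hek : e ≤ k) {W y a b : ℕ}
    (hT : TableInv N s k mem (2 ^ n)) (hW : W < 2 ^ n) (hc : Consts n m s k e reg)
    (h13 : reg 13 = y) (h28 : reg 28 = 1) (h26 : reg 26 = W) (h27 : reg 27 = diff (full n) W)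
    (h22 : reg 22 = a) (h23 : reg 23 = b) (hy : y < 2 ^ n) (hye : pop y ≤ e)
    (ha : SplitInv N e mem W y a) (hb : SplitInv N e mem (diff (full n) W) y b)
    (hk : ∀ (reg' : ℕ → ℕ) (a' b' : ℕ), Consts n m s k e reg' → reg' 13 = succMask e y →
      reg' 28 = 1 → reg' 26 = W → reg' 27 = diff (full n) W → reg' 22 = a' → reg' 23 = b' →
      reg' 24 = reg 24 → SplitInv N e mem W (succMask e y) a' →
      SplitInv N e mem (diff (full n) W) (succMask e y) b' →
      Run prog w ω φ Q t ⟨111, reg', mem, fl, none⟩) :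
    Run prog w ω φ Q (t + 20 * m + 40) ⟨111, reg, mem, fl, none⟩ := by
  obtain ⟨hn, hm, hs, hbig⟩ := hfit
  refine Run.mono (t := t + 11 + 3 + 2 + 1 + 1 + 20 * m + 4 + 1 + 4 + 1) ?_ (by omega)
  refine Run.jlt (target := 113) rfl (by rw [h13, hc.r4]; exact hy) ?_
  refine run_block 4 117 rfl rfl rfl ?_
  simp (disch := decide) only [instructions, List.drop_succ_cons, List.drop_zero,
    List.take_succ_cons, List.take_zero, block, Function.update_self, Function.update_of_ne, h13,
    h26, h27, natEval_diff]
  refine Run.jeq rfl rfl (run_best ⟨hn, hm, hs, hbig⟩ ((((hc.update ?_).update ?_).update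
    ?_).update ?_) hT.rows hT.le ?_ ?_ ?_)
  iterate 4 norm_num
  · simp (disch := decide) only [Function.update_self, Function.update_of_ne]; exact diff_lt hW
  · simp (disch := decide) only [Function.update_self]; exact diff_lt (diff_lt (full_lt n))
  intro reg₁ hfr h16 h17
  simp (disch := decide) only [Function.update_self, Function.update_of_ne] at h16 h17
  replace hfr : ∀ r, r < 14 ∨ 20 < r → reg₁ r = reg r := fun r hr => by
    rw [hfr r (by omega)]
    iterate 4 rw [Function.update_of_ne (by omega)]
  have hc₁ : Consts n m s k e reg₁ := hc.congr fun r hr => hfr r (by omega)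
  have f13 := (hfr 13 (by omega)).trans h13
  have f28 := (hfr 28 (by omega)).trans h28
  have f26 := (hfr 26 (by omega)).trans h26
  have f27 := (hfr 27 (by omega)).trans h27
  have f22 := (hfr 22 (by omega)).trans h22
  have f23 := (hfr 23 (by omega)).trans h23
  have f24 := hfr 24 (by omega)
  clear hfr
  have hle := hT.le y hy
  have hh₁ : reg₁ 16 ≤ n + 1 := by
    rcases Nat.eq_zero_or_pos (reg₁ 16) with h | h
    · omega
    · exact (hT.coverBy_of_isBest (diff_lt hW) h16 h).1
  have hh₂ : reg₁ 17 ≤ n + 1 := by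
    rcases Nat.eq_zero_or_pos (reg₁ 17) with h | h
    · omega
    · exact (hT.coverBy_of_isBest (diff_lt (diff_lt (full_lt n))) h17 h).1
  have ha' := ha.step he0 hy h16
  have hb' := hb.step he0 hy h17
  set v := mem (y + (3 + m * n)) with hv
  have last : ∀ reg₂ : ℕ → ℕ, (∀ r, r < 19 ∨ 20 < r ∧ r < 22 ∨ 23 < r → reg₂ r = reg₁ r) →
      reg₂ 22 = max a (v + reg₁ 16) → reg₂ 23 = max b (v + reg₁ 17) →
      Run prog w ω φ Q (t + 1 + 3 + 1 + 2) ⟨126, reg₂, mem, fl, none⟩ := by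
    intro reg₂ hfr₂ g22 g23
    have hc₂ := hc₁.congr (reg' := reg₂) fun r hr => hfr₂ r (by omega)
    have g13 := (hfr₂ 13 (by omega)).trans f13
    refine run_block 2 128 rfl rfl rfl ?_
    simp (disch := decide) only [instructions, List.drop_succ_cons, List.drop_zero,
      List.take_succ_cons, List.take_zero, block, Function.update_self, g13, hc₂.r3]
    simp (disch := omega) only [natEval_add]
    rw [hT.pops y hy (Or.inl hy) (hye.trans hek)]
    by_cases hlt : pop y < e
    · refine Run.jlt (target := 131) rfl (by
        simp (disch := decide) only [Function.update_self, Function.update_of_ne, hc₂.r6]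
        exact hlt) (Run.mono (t := t + 1 + 1) ?_ (by omega))
      refine run_block 1 132 rfl rfl rfl ?_
      simp (disch := decide) only [instructions, List.drop_succ_cons, List.drop_zero,
        List.take_succ_cons, List.take_zero, block, Function.update_of_ne, g13, hc₂.r7]
      simp (disch := omega) only [natEval_add]
      have hsucc : succMask e y = y + 1 := by rw [succMask, if_pos hlt]
      refine Run.jeq rfl rfl (hk _ _ _ ?_ ?_ ?_ ?_ ?_ ?_ ?_ ?_ ha' hb')
      · exact ((hc₂.update (by norm_num)).update (by norm_num)).update (by norm_num)
      all_goals simp (disch := decide) only [Function.update_self, Function.update_of_ne]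
      · exact hsucc.symm
      · rw [hfr₂ 28 (by omega), f28]
      · rw [hfr₂ 26 (by omega), f26]
      · rw [hfr₂ 27 (by omega), f27]
      · exact g22
      · exact g23
      · rw [hfr₂ 24 (by omega), f24]
    · have hy0 : 1 ≤ y := by
        by_contra h
        obtain rfl : y = 0 := by omega
        rw [pop_zero] at hlt
        omega
      have hor := addLowBit_le_two_pow hy
      have hsucc : succMask e y = addLowBit y := by rw [succMask, if_neg hlt]
      refine Run.jlt_not rfl (by
        simp (disch := decide) only [Function.update_self, Function.update_of_ne, hc₂.r6]
        exact hlt) (Run.mono (t := t + 1 + 3) ?_ (by omega))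
      refine run_block 3 132 rfl rfl rfl ?_
      simp (disch := decide) only [instructions, List.drop_succ_cons, List.drop_zero,
        List.take_succ_cons, List.take_zero, block, Function.update_self, Function.update_of_ne,
        g13, hc₂.r7]
      simp (disch := omega) only [natEval_sub, natEval_or]
      rw [addLowBit] at hor hsucc
      simp (disch := omega) only [natEval_add]
      refine Run.jeq rfl rfl (hk _ _ _ ?_ ?_ ?_ ?_ ?_ ?_ ?_ ?_ ha' hb')
      · exact ((((hc₂.update (by norm_num)).update (by norm_num)).update (by norm_num)).update
          (by norm_num)).update (by norm_num)
      all_goals simp (disch := decide) only [Function.update_self, Function.update_of_ne]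
      · exact hsucc.symm
      · rw [hfr₂ 28 (by omega), f28]
      · rw [hfr₂ 26 (by omega), f26]
      · rw [hfr₂ 27 (by omega), f27]
      · exact g22
      · exact g23
      · rw [hfr₂ 24 (by omega), f24]
  have second : ∀ reg₂ : ℕ → ℕ, (∀ r, r < 19 ∨ 20 < r ∧ r ≠ 22 → reg₂ r = reg₁ r) →
      reg₂ 19 = v → reg₂ 22 = max a (v + reg₁ 16) →
      Run prog w ω φ Q (t + 1 + 3 + 1 + 2 + 1 + 1 + 1) ⟨123, reg₂, mem, fl, none⟩ := by
    intro reg₂ hfr₂ g19 g22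
    have hc₂ := hc₁.congr (reg' := reg₂) fun r hr => hfr₂ r (by omega)
    have g17 := hfr₂ 17 (by omega)
    have g23 := (hfr₂ 23 (by omega)).trans f23
    refine run_block 1 124 rfl rfl rfl ?_
    simp (disch := decide) only [instructions, List.drop_succ_cons, List.drop_zero,
      List.take_succ_cons, List.take_zero, block, g19, g17]
    simp (disch := omega) only [natEval_add]
    by_cases hlt : v + reg₁ 17 < b
    · refine Run.jlt (target := 126) rfl (by
        simp (disch := decide) only [Function.update_self, Function.update_of_ne, g23]
        exact hlt) (Run.mono (last _ ?_ ?_ ?_) (by omega))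
      · intro r hr
        rw [Function.update_of_ne (by omega)]
        exact hfr₂ r (by omega)
      · simp (disch := decide) only [Function.update_of_ne]; exact g22
      · simp (disch := decide) only [Function.update_of_ne]; rw [g23, max_eq_left hlt.le]
    · refine Run.jlt_not rfl (by
        simp (disch := decide) only [Function.update_self, Function.update_of_ne, g23]
        exact hlt) ?_
      refine run_block 1 126 rfl rfl rfl ?_
      simp (disch := decide) only [instructions, List.drop_succ_cons, List.drop_zero,
        List.take_succ_cons, List.take_zero, block, Function.update_self, Function.update_of_ne,
        hc₂.r8]
      simp (disch := omega) only [natEval_add]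
      refine last _ ?_ ?_ ?_
      · intro r hr
        rw [Function.update_of_ne (by omega), Function.update_of_ne (by omega)]
        exact hfr₂ r (by omega)
      · simp (disch := decide) only [Function.update_of_ne]; exact g22
      · rw [Function.update_self, max_eq_right (not_lt.1 hlt), add_zero]
  refine Run.jeq_not rfl (by rw [f28, hc₁.r8]; norm_num) (Run.jeq (target := 118) rfl rfl ?_)
  refine Run.mono (t := t + 1 + 3 + 1 + 2 + 1 + 1 + 1 + 1 + 1 + 3) ?_ (by omega)
  refine run_block 3 121 rfl rfl rfl ?_
  simp (disch := decide) only [instructions, List.drop_succ_cons, List.drop_zero,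
    List.take_succ_cons, List.take_zero, block, Function.update_self, Function.update_of_ne,
    f13, hc₁.r2]
  simp (disch := omega) only [natEval_add]
  simp only [← hv]
  by_cases hlt : v + reg₁ 16 < a
  · refine Run.jlt (target := 123) rfl (by
      simp (disch := decide) only [Function.update_self, Function.update_of_ne, f22]
      exact hlt) (Run.mono (second _ ?_ ?_ ?_) (by omega))
    · intro r hr
      iterate 3 rw [Function.update_of_ne (by omega)]
    · simp (disch := decide) only [Function.update_self, Function.update_of_ne]
    · simp (disch := decide) only [Function.update_of_ne]; rw [f22, max_eq_left hlt.le]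
  · refine Run.jlt_not rfl (by
      simp (disch := decide) only [Function.update_self, Function.update_of_ne, f22]
      exact hlt) ?_
    refine run_block 1 123 rfl rfl rfl ?_
    simp (disch := decide) only [instructions, List.drop_succ_cons, List.drop_zero,
      List.take_succ_cons, List.take_zero, block, Function.update_self, Function.update_of_ne,
      hc₁.r8]
    simp (disch := omega) only [natEval_add]
    refine second _ ?_ ?_ ?_
    · intro r hr
      iterate 4 rw [Function.update_of_ne (by omega)]
    · simp (disch := decide) only [Function.update_self, Function.update_of_ne]
    · rw [Function.update_self, max_eq_right (not_lt.1 hlt), add_zero]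

/-- The loop over the small sets. -/
lemma run_small (hfit : Fits n m s w) (he0 : 0 < e) (hek : e ≤ k) {W : ℕ}
    (hT : TableInv N s k mem (2 ^ n)) (hW : W < 2 ^ n) (d : ℕ) :
    ∀ (reg : ℕ → ℕ) (y a b : ℕ), Consts n m s k e reg → reg 13 = y → reg 28 = 1 → reg 26 = W →
    reg 27 = diff (full n) W → reg 22 = a → reg 23 = b → (y < 2 ^ n → pop y ≤ e) →
    SplitInv N e mem W y a → SplitInv N e mem (diff (full n) W) y b → 2 ^ n ≤ y + d →
    (∀ (reg' : ℕ → ℕ) (a' b' : ℕ), Consts n m s k e reg' → reg' 28 = 1 →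
      reg' 22 = a' → reg' 23 = b' → reg' 24 = reg 24 → SplitInv N e mem W (2 ^ n) a' →
      SplitInv N e mem (diff (full n) W) (2 ^ n) b' →
      Run prog w ω φ Q t ⟨133, reg', mem, fl, none⟩) →
    Run prog w ω φ Q (t + 2 + remaining n e y * (20 * m + 40)) ⟨111, reg, mem, fl, none⟩ := by
  have fin : ∀ (reg : ℕ → ℕ) (y a b : ℕ), ¬ y < 2 ^ n → Consts n m s k e reg → reg 13 = y →
      reg 28 = 1 → reg 22 = a → reg 23 = b →
      SplitInv N e mem W y a → SplitInv N e mem (diff (full n) W) y b →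
      (∀ (reg' : ℕ → ℕ) (a' b' : ℕ), Consts n m s k e reg' → reg' 28 = 1 →
        reg' 22 = a' → reg' 23 = b' → reg' 24 = reg 24 → SplitInv N e mem W (2 ^ n) a' →
        SplitInv N e mem (diff (full n) W) (2 ^ n) b' →
        Run prog w ω φ Q t ⟨133, reg', mem, fl, none⟩) →
      Run prog w ω φ Q (t + 1 + 1) ⟨111, reg, mem, fl, none⟩ := by
    intro reg y a b hy hc h13 h28 h22 h23 ha hb hk
    exact Run.jlt_not rfl (by rw [h13, hc.r4]; exact hy) (Run.jeq rfl rfl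
      (hk _ _ _ hc h28 h22 h23 rfl (ha.final (not_lt.1 hy)) (hb.final (not_lt.1 hy))))
  induction d with
  | zero =>
    intro reg y a b hc h13 h28 _ _ h22 h23 _ ha hb hd hk
    exact (fin reg y a b (by omega) hc h13 h28 h22 h23 ha hb hk).mono (by omega)
  | succ d ih =>
    intro reg y a b hc h13 h28 h26 h27 h22 h23 hye ha hb hd hk
    by_cases hy : y < 2 ^ n
    · have hrem := remaining_lt (b := e) (lt_succMask e y) hy (hye hy)
      refine Run.mono (t := t + 2 + remaining n e (succMask e y) * (20 * m + 40) + 20 * m + 40)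
        ?_ ?_
      · refine run_small_step hfit he0 hek hT hW hc h13 h28 h26 h27 h22 h23 hy (hye hy) ha hb ?_
        intro reg' a' b' hc' h13' h28' h26' h27' h22' h23' h24' ha' hb'
        refine ih reg' _ a' b' hc' h13' h28' h26' h27' h22' h23'
          (fun _ => pop_succMask_le he0 (hye hy)) ha' hb' ?_ ?_
        · have := lt_succMask e y
          omega
        · intro reg'' a'' b'' hc'' h28'' h22'' h23'' h24''
          exact hk reg'' a'' b'' hc'' h28'' h22'' h23'' (h24''.trans h24')
      · calc _ = t + 2 + (remaining n e (succMask e y) + 1) * (20 * m + 40) := by ring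
          _ ≤ _ := Nat.add_le_add_left (Nat.mul_le_mul_right _ hrem) _
    · exact (fin reg y a b hy hc h13 h28 h22 h23 ha hb hk).mono (by omega)

/-- The number whose binary digits, from the most significant one on, are the `i` coin flips from
position `p` on. -/
def sample (ω : ℕ → Bool) (p : ℕ) : ℕ → ℕ
  | 0 => 0
  | i + 1 => 2 * sample ω p i + (ω (p + i)).toNat

lemma sample_lt (ω : ℕ → Bool) (p i : ℕ) : sample ω p i < 2 ^ i := by
  induction i with
  | zero => simp [sample]
  | succ i ih =>
    have := Bool.toNat_lt (ω (p + i))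
    rw [sample, pow_succ]
    omega

/-- The loop that flips the coins of one sample. -/
lemma run_coins (hfit : Fits n m s w) (p : ℕ) (d : ℕ) :
    ∀ (reg : ℕ → ℕ) (i : ℕ), i + d = n → Consts n m s k e reg → reg 25 = d →
    reg 26 = sample ω p i →
    (∀ reg' : ℕ → ℕ, Consts n m s k e reg' → reg' 28 = reg 28 → reg' 24 = reg 24 →
      reg' 26 = sample ω p n → Run prog w ω φ Q t ⟨107, reg', mem, p + n, none⟩) →
    Run prog w ω φ Q (t + 1 + 6 * d) ⟨101, reg, mem, p + i, none⟩ := by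
  induction d with
  | zero =>
    intro reg i hi hc h25 h26 hk
    obtain rfl : i = n := by omega
    exact Run.jeq rfl (by rw [h25, hc.r8]) (hk reg hc rfl rfl h26)
  | succ d ih =>
    intro reg i hi hc h25 h26 hk
    have hlt := sample_lt ω p (i + 1)
    have hle : 2 ^ (i + 1) ≤ 2 ^ n := Nat.pow_le_pow_right (by norm_num) (by omega)
    have hbig := hfit.big
    have hsam : sample ω p (i + 1) = 2 * sample ω p i + (ω (p + i)).toNat := rfl
    have hmod : (ω (p + i)).toNat % 2 ^ w = (ω (p + i)).toNat := Nat.mod_eq_of_lt (by omega)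
    refine Run.mono (t := t + 1 + 6 * d + 1 + 3 + 1 + 1) ?_ (by omega)
    refine Run.jeq_not rfl (by rw [h25, hc.r8]; omega) (Run.coin rfl ?_)
    refine run_block 3 106 rfl rfl rfl ?_
    simp (disch := decide) only [instructions, List.drop_succ_cons, List.drop_zero,
      List.take_succ_cons, List.take_zero, block, Function.update_self, Function.update_of_ne,
      h25, h26, hmod, hc.r7]
    simp (disch := omega) only [natEval_add, natEval_sub]
    refine Run.jeq rfl rfl (ih _ (i + 1) (by omega) ?_ ?_ ?_ ?_)
    · exact (((hc.update (by norm_num)).update (by norm_num)).update (by norm_num)).update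
        (by norm_num)
    · rw [Function.update_self]; omega
    · simp (disch := decide) only [Function.update_self, Function.update_of_ne]
      rw [hsam]; ring
    · intro reg' hc' h28' h24' h26'
      simp (disch := decide) only [Function.update_of_ne] at h28' h24'
      exact hk reg' hc' h28' h24' h26'

/-- The sampling loop. -/
lemma run_samples (hfit : Fits n m s w) (he0 : 0 < e) (hek : e ≤ k) {M : ℕ} (hM : M < 2 ^ w)
    (hT : TableInv N s k mem (2 ^ n))
    (hQ : (∀ i < M, Fails N s k e (sample ω (i * n) n)) →
      ∀ (reg : ℕ → ℕ) (fl : ℕ), Q ⟨137, reg, mem, fl, some false⟩) (d : ℕ) :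
    ∀ (reg : ℕ → ℕ) (j : ℕ), j + d = M → Consts n m s k e reg → reg 28 = 1 → reg 24 = d →
    (∀ i < j, Fails N s k e (sample ω (i * n) n)) →
    Run prog w ω (HasCover N s) Q (2 + d * (6 * n + 20 + remaining n e 0 * (20 * m + 40)))
      ⟨97, reg, mem, j * n, none⟩ := by
  induction d with
  | zero =>
    intro reg j hj hc h28 h24 hf
    obtain rfl : j = M := by omega
    refine Run.mono (t := 0 + 1 + 1) ?_ (by omega)
    exact Run.jeq (target := 137) rfl (by rw [h24, hc.r8])
      (Run.halt_no rfl (hQ hf _ _))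
  | succ d ih =>
    intro reg j hj hc h28 h24 hf
    have hbig := hfit.big
    have hn := hfit.n_pos
    set T := 2 + d * (6 * n + 20 + remaining n e 0 * (20 * m + 40)) with hTdef
    refine Run.mono (t := T + 1 + 2 + 2 + remaining n e 0 * (20 * m + 40) + 4 + 1 + 6 * n + 3 + 1)
      ?_ ?_
    swap
    · rw [hTdef]
      nlinarith
    refine Run.jeq_not rfl (by rw [h24, hc.r8]; omega) ?_
    refine run_block 3 101 rfl rfl rfl ?_
    simp (disch := decide) only [instructions, List.drop_succ_cons, List.drop_zero,
      List.take_succ_cons, List.take_zero, block, Function.update_of_ne, h24, hc.r7, hc.r8, hc.r0,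
      Nat.zero_mod]
    simp (disch := omega) only [natEval_add, natEval_sub]
    have hzero : sample ω (j * n) 0 = 0 := rfl
    refine run_coins hfit (j * n) n _ 0 (by omega) (((hc.update ?_).update ?_).update ?_) ?_ ?_ ?_
    iterate 3 norm_num
    · rw [Function.update_self, add_zero]
    · simp (disch := decide) only [Function.update_self, Function.update_of_ne, hzero]
    intro reg₁ hc₁ h28₁ h24₁ h26₁
    simp (disch := decide) only [Function.update_self, Function.update_of_ne] at h28₁ h24₁
    set W := sample ω (j * n) n with hW
    have hWlt : W < 2 ^ n := sample_lt ω (j * n) n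
    refine run_block 4 111 rfl rfl rfl ?_
    simp (disch := decide) only [instructions, List.drop_succ_cons, List.drop_zero,
      List.take_succ_cons, List.take_zero, block, Function.update_of_ne,
      Nat.zero_mod, h26₁, hc₁.r10, natEval_xor]
    refine run_small hfit he0 hek hT hWlt (2 ^ n) _ 0 0 0 ((((hc₁.update ?_).update ?_).update
      ?_).update ?_) ?_ ?_ ?_ ?_ ?_ ?_ ?_ (SplitInv.zero _) (SplitInv.zero _) (by omega) ?_
    iterate 4 norm_num
    all_goals try simp (disch := decide) only [Function.update_self, Function.update_of_ne]
    · rw [h28₁, h28]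
    · exact h26₁
    · exact xor_full hWlt
    · simp
    intro reg₂ a b hc₂ h28₂ h22₂ h23₂ h24₂ ha hb
    have hale := ha.le hT hWlt
    have hble := hb.le hT (diff_lt (full_lt n))
    have hs := hfit.s_le
    refine run_block 2 135 rfl rfl rfl ?_
    simp (disch := decide) only [instructions, List.drop_succ_cons, List.drop_zero,
      List.take_succ_cons, List.take_zero, block, Function.update_self, Function.update_of_ne,
      h22₂, h23₂, hc₂.r1]
    simp (disch := omega) only [natEval_add]
    by_cases hchk : a + b + s < 4 * n + 6
    · refine Run.jlt (target := 97) rfl (by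
        simp (disch := decide) only [Function.update_self, Function.update_of_ne, hc₂.r12]
        exact hchk) ?_
      have hpos : j * n + n = (j + 1) * n := by ring
      rw [hpos]
      refine ih _ (j + 1) (by omega) ((hc₂.update ?_).update ?_) ?_ ?_ ?_
      iterate 2 norm_num
      · simp (disch := decide) only [Function.update_of_ne]; exact h28₂
      · simp (disch := decide) only [Function.update_of_ne]; rw [h24₂, h24₁]; omega
      · intro i hi
        rcases Nat.lt_succ_iff_lt_or_eq.1 hi with hi | rfl
        · exact hf i hi
        · exact fails_of_splitInv hek hT hWlt ha hb hchk
    · refine Run.jlt_not rfl (by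
        simp (disch := decide) only [Function.update_self, Function.update_of_ne, hc₂.r12]
        exact hchk) (Run.mono (t := 0 + 1) ?_ (by omega))
      exact Run.halt_yes rfl (hasCover_of_splitInv hs hT hWlt ha hb (by omega))

end

end SetCover

/-! ### The whole run -/

namespace SetCover

open WordRAM

section

variable {n m s k e w : ℕ} {N : Family n m} {ω : ℕ → Bool} {φ : Prop} {Q : NatConfig → Prop}
  {reg mem : ℕ → ℕ} {fl t : ℕ}

/-- The state of the memory when the first `f` rows of the incidence matrix have been replaced by
their masks. -/
structure RowsInv (N : Family n m) (mem : ℕ → ℕ) (f : ℕ) : Prop where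
  done : ∀ g : Fin m, g.val < f → mem (3 + g.val * n) = mask (N g)
  todo : ∀ g : Fin m, f ≤ g.val → ∀ u < n,
    mem (3 + g.val * n + u) = ((mask (N g)).testBit u).toNat
  zero : ∀ a, 3 + m * n ≤ a → mem a = 0

lemma rowsInv_input (hw : 10000 + n ≤ 2 ^ w) :
    RowsInv N (fun a => input N s a % 2 ^ w) 0 := by
  refine ⟨fun g hg => absurd hg (Nat.not_lt_zero _), fun g _ u hu => ?_, fun a ha => ?_⟩
  · have hin : input N s (3 + g.val * n + u) = ((mask (N g)).testBit u).toNat := by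
      rw [show 3 + g.val * n + u = (g.val * n + u) + 3 by ring, input, testBit_mask (N g) ⟨u, hu⟩]
      by_cases h : (⟨u, hu⟩ : Fin n) ∈ N g
      · rw [if_pos ⟨g, ⟨u, hu⟩, rfl, h⟩]; simp [h]
      · rw [if_neg]
        · simp [h]
        · rintro ⟨g', v, heq, hv⟩
          have hg : g.val = g'.val := by
            have := congrArg (· / n) heq
            simpa [Nat.add_comm, Nat.add_mul_div_right, Nat.div_eq_of_lt hu,
              Nat.div_eq_of_lt v.2, (by omega : 0 < n)] using this
          have hu' : u = v.val := by rw [hg] at heq; omega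
          have hg' := Fin.ext hg
          subst hg'
          exact h (by convert hv)
    show input N s _ % 2 ^ w = _
    rw [hin, Nat.mod_eq_of_lt]
    have := Bool.toNat_lt ((mask (N g)).testBit u)
    omega
  · obtain ⟨b, rfl⟩ : ∃ b, a = b + 3 := ⟨a - 3, by omega⟩
    show input N s (b + 3) % 2 ^ w = 0
    rw [input, if_neg, Nat.zero_mod]
    rintro ⟨f, u, heq, _⟩
    have hf : f.val * n + n ≤ m * n := by
      rw [← Nat.succ_mul]; exact Nat.mul_le_mul_right n f.2
    omega

lemma mod_two_pow_succ_eq_or (x u : ℕ) :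
    x % 2 ^ (u + 1) = x % 2 ^ u ||| (x.testBit u).toNat * 2 ^ u := by
  refine Nat.eq_of_testBit_eq fun i => ?_
  rw [Nat.testBit_or, Nat.testBit_mod_two_pow, Nat.testBit_mod_two_pow]
  rcases lt_trichotomy i u with h | rfl | h
  · cases x.testBit u <;> simp [h, Nat.lt_succ_of_lt h, h.ne']
  · cases hb : x.testBit i <;> simp
  · rw [decide_eq_false (by omega : ¬ i < u + 1), decide_eq_false (by omega : ¬ i < u)]
    cases x.testBit u <;> simp [h.ne]

/-- The loop that computes the mask of a row. -/
lemma run_row (hfit : Fits n m s w) {f : Fin m} (hR : RowsInv N mem f) (d : ℕ) :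
    ∀ (reg : ℕ → ℕ) (u : ℕ), u + d = n → reg 0 = n → reg 7 = 1 →
    reg 18 = 3 + f.val * n → reg 17 = u → reg 16 = mask (N f) % 2 ^ u →
    (∀ reg' : ℕ → ℕ, (∀ r, r < 16 ∨ 17 < r ∧ r ≠ 19 → reg' r = reg r) → reg' 16 = mask (N f) →
      Run prog w ω φ Q t ⟨19, reg', mem, fl, none⟩) →
    Run prog w ω φ Q (t + 1 + 7 * d) ⟨12, reg, mem, fl, none⟩ := by
  induction d with
  | zero =>
    intro reg u hu h0 h7 h18 h17 h16 hk
    obtain rfl : u = n := by omega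
    refine Run.jeq rfl (by rw [h17, h0]) (hk reg (fun _ _ => rfl) ?_)
    rw [h16, Nat.mod_eq_of_lt (mask_lt _)]
  | succ d ih =>
    intro reg u hu h0 h7 h18 h17 h16 hk
    have hbig := hfit.big
    have hf : f.val * n + n ≤ m * n := by
      rw [← Nat.succ_mul]; exact Nat.mul_le_mul_right n f.2
    have hbit := hR.todo f le_rfl u (by omega)
    have hle : 2 ^ u ≤ 2 ^ n := Nat.pow_le_pow_right (by norm_num) (by omega)
    have hb1 : ((mask (N f)).testBit u).toNat * 2 ^ u ≤ 1 * 2 ^ u :=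
      Nat.mul_le_mul_right _ (Nat.lt_succ_iff.1 (Bool.toNat_lt _))
    refine Run.mono (t := t + 1 + 7 * d + 1 + 5 + 1) ?_ (by omega)
    refine Run.jeq_not rfl (by rw [h17, h0]; omega) ?_
    refine run_block 5 18 rfl rfl rfl ?_
    simp (disch := decide) only [instructions, List.drop_succ_cons, List.drop_zero,
      List.take_succ_cons, List.take_zero, block, Function.update_self, Function.update_of_ne,
      h17, h18, h16, h7]
    simp (disch := omega) only [natEval_add]
    simp only [hbit]
    simp (disch := omega) only [natEval_shl]
    simp only [natEval_or, ← mod_two_pow_succ_eq_or]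
    refine Run.jeq rfl rfl (ih _ (u + 1) (by omega) ?_ ?_ ?_ ?_ ?_ ?_)
    all_goals try simp (disch := decide) only [Function.update_self, Function.update_of_ne]
    · exact h0
    · exact h7
    · exact h18
    intro reg' hfr h16'
    refine hk reg' (fun r hr => ?_) h16'
    rw [hfr r hr]
    iterate 5 rw [Function.update_of_ne (by omega)]

/-- The loop over the rows. -/
lemma run_rows (hfit : Fits n m s w) (d : ℕ) :
    ∀ (reg mem : ℕ → ℕ) (f : ℕ), f + d = m → RowsInv N mem f → reg 0 = n → reg 7 = 1 →
    reg 8 = 0 → reg 2 = 3 + m * n → reg 18 = 3 + f * n →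
    (∀ reg' mem' : ℕ → ℕ, (∀ r, r < 16 ∨ 19 < r → reg' r = reg r) → RowsInv N mem' m →
      Run prog w ω φ Q t ⟨22, reg', mem', fl, none⟩) →
    Run prog w ω φ Q (t + 1 + d * (7 * n + 10)) ⟨9, reg, mem, fl, none⟩ := by
  induction d with
  | zero =>
    intro reg mem f hf hR h0 h7 h8 h2 h18 hk
    obtain rfl : f = m := by omega
    exact Run.mono (Run.jeq rfl (by rw [h18, h2]) (hk reg mem (fun _ _ => rfl) hR)) (by omega)
  | succ d ih =>
    intro reg mem f hf hR h0 h7 h8 h2 h18 hk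
    have hbig := hfit.big
    have hn := hfit.n_pos
    have hfm : f < m := by omega
    have hmul : f * n + n ≤ m * n := by
      rw [← Nat.succ_mul]; exact Nat.mul_le_mul_right n hfm
    set T := t + 1 + d * (7 * n + 10) with hT
    refine Run.mono (t := T + 1 + 2 + 1 + 7 * n + 2 + 1) ?_ (by rw [hT]; nlinarith)
    refine Run.jeq_not rfl (by rw [h18, h2]; omega) ?_
    refine run_block 2 12 rfl rfl rfl ?_
    simp only [instructions, List.drop_succ_cons, List.drop_zero,
      List.take_succ_cons, List.take_zero, block, Nat.zero_mod]
    refine run_row hfit (f := ⟨f, hfm⟩) hR n _ 0 (by omega) ?_ ?_ ?_ ?_ ?_ ?_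
    all_goals try simp (disch := decide) only [Function.update_self, Function.update_of_ne]
    · exact h0
    · exact h7
    · exact h18
    · rw [pow_zero, Nat.mod_one]
    intro reg₁ hfr h16
    have f18 : reg₁ 18 = 3 + f * n := by
      rw [hfr 18 (by omega)]
      simpa (disch := decide) only [Function.update_of_ne] using h18
    replace hfr : ∀ r, r < 16 ∨ 19 < r → reg₁ r = reg r := fun r hr => by
      rw [hfr r (by omega)]
      iterate 2 rw [Function.update_of_ne (by omega)]
    have f0 := hfr 0 (by omega)
    refine run_block 2 21 rfl rfl rfl ?_
    simp only [instructions, List.drop_succ_cons, List.drop_zero,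
      List.take_succ_cons, List.take_zero, block, f18, f0, h0, h16]
    simp (disch := omega) only [natEval_add]
    refine Run.jeq rfl rfl (ih _ _ (f + 1) (by omega) ?_ ?_ ?_ ?_ ?_ ?_ ?_)
    · refine ⟨fun g hg => ?_, fun g hg u hu => ?_, fun a ha => ?_⟩
      · by_cases hgf : g.val = f
        · obtain rfl : g = ⟨f, hfm⟩ := Fin.ext hgf
          rw [Function.update_self]
        · have hlt : g.val < f := by omega
          have : g.val * n + n ≤ f * n := by
            rw [← Nat.succ_mul]; exact Nat.mul_le_mul_right n hlt
          rw [Function.update_of_ne (by omega), hR.done g hlt]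
      · have : f * n + n ≤ g.val * n := by
          rw [← Nat.succ_mul]; exact Nat.mul_le_mul_right n hg
        rw [Function.update_of_ne (by omega), hR.todo g (by omega) u hu]
      · rw [Function.update_of_ne (by omega), hR.zero a ha]
    · rw [Function.update_of_ne (by decide), hfr 0 (by omega), h0]
    · rw [Function.update_of_ne (by decide), hfr 7 (by omega), h7]
    · rw [Function.update_of_ne (by decide), hfr 8 (by omega), h8]
    · rw [Function.update_of_ne (by decide), hfr 2 (by omega), h2]
    · rw [Function.update_self]; ring
    intro reg' mem' hfr' hR'
    refine hk reg' mem' (fun r hr => ?_) hR'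
    rw [hfr' r hr, Function.update_of_ne (by omega), hfr r hr]

lemma RowsInv.tableInv (hn : 1 ≤ n) (hR : RowsInv N mem m) :
    TableInv N s k (Function.update mem (3 + m * n) (n + 1)) 0 := by
  have tab : ∀ X, X ≠ 0 → Function.update mem (3 + m * n) (n + 1) (X + (3 + m * n)) = 0 := by
    intro X hX
    rw [Function.update_of_ne (by omega), hR.zero _ (by omega)]
  have tab0 : Function.update mem (3 + m * n) (n + 1) (0 + (3 + m * n)) = n + 1 := by
    rw [zero_add, Function.update_self]
  refine ⟨fun f => ?_, fun X _ => ?_, fun X _ => ?_, ?_, fun X _ h => absurd h (Nat.not_lt_zero _),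
    fun X _ h _ => ?_, fun Y _ h => absurd h (Nat.not_lt_zero _)⟩
  · have : f.val * n + n ≤ m * n := by
      rw [← Nat.succ_mul]; exact Nat.mul_le_mul_right n f.2
    rw [Function.update_of_ne (by omega), hR.done f f.2]
  · by_cases hX : X = 0
    · subst hX; rw [tab0]
    · rw [tab X hX]; omega
  · by_cases hX : X = 0
    · subst hX; exact fun _ => CoverBy.zero N _
    · rw [tab X hX]; exact fun h => absurd h (lt_irrefl _)
  · rw [tab0]
  · obtain rfl : X = 0 := by omega
    have := Nat.two_pow_pos n
    rw [Function.update_of_ne (by omega), hR.zero _ (by omega), pop_zero]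

end

/-- The distance of the size bound of the table from `n / 2`, about `σ ^ 2 * n / 8192`. -/
def gap (n s : ℕ) : ℕ := s * s / (8192 * n)

/-- The program fills the whole table, instead of sampling, if the gap is too small. -/
def Exhaustive (n s : ℕ) : Prop := gap n s * s < 2 * n

/-- The number of samples. -/
def samples (n s : ℕ) : ℕ := 2 * 2 ^ (n - s / 4)

lemma gap_mul_le {n s : ℕ} (hn : 1 ≤ n) (hs : s ≤ n) : 8192 * gap n s ≤ n := by
  have h1 : gap n s * (8192 * n) ≤ s * s := Nat.div_mul_le_self _ _
  have h2 : s * s ≤ n * n := Nat.mul_le_mul hs hs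
  have h3 : (8192 * gap n s) * n ≤ n * n := by
    calc (8192 * gap n s) * n = gap n s * (8192 * n) := by ring
      _ ≤ n * n := h1.trans h2
  exact Nat.le_of_mul_le_mul_right h3 hn

lemma one_le_gap {n s : ℕ} (hn : 1 ≤ n) (h : ¬ Exhaustive n s) : 1 ≤ gap n s := by
  by_contra h0
  apply h
  rw [Exhaustive, show gap n s = 0 by omega]
  omega

section

variable {n m s w : ℕ} {N : Family n m} {ω : ℕ → Bool}

/-- What is known when the program answers NO. -/
def NoReport (N : Family n m) (s : ℕ) (ω : ℕ → Bool) : Prop :=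
  (Exhaustive n s ∧ ∃ mem, TableInv N s n mem (2 ^ n)) ∨
  (¬ Exhaustive n s ∧ (∃ mem, TableInv N s (n / 2 - gap n s) mem (2 ^ n)) ∧
    ∀ i < samples n s, Fails N s (n / 2 - gap n s) (3 * gap n s) (sample ω (i * n) n))

open Classical in
/-- A bound on the running time. -/
noncomputable def timeBound (n m s : ℕ) : ℕ :=
  100 + m * (7 * n + 10) +
    if Exhaustive n s then remaining n n 0 * (20 * m + 40)
    else remaining n (n / 2 - gap n s) 0 * (20 * m + 40) +
      samples n s * (6 * n + 20 + remaining n (3 * gap n s) 0 * (20 * m + 40))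

/-- The whole program halts within `timeBound` steps; it answers YES only if there is a cover. -/
lemma run_prog (hfit : Fits n m s w) :
    Run prog w ω (HasCover N s) (fun c => c.answer = some false ∧ NoReport N s ω)
      (timeBound n m s) (natInit w (input N s)) := by
  obtain ⟨hn, hm, hs, hbig⟩ := id hfit
  have c1 : 1 % 2 ^ w = 1 := Nat.mod_eq_of_lt (by omega)
  have c2 : 2 % 2 ^ w = 2 := Nat.mod_eq_of_lt (by omega)
  have c3 : 3 % 2 ^ w = 3 := Nat.mod_eq_of_lt (by omega)
  have c4 : 4 % 2 ^ w = 4 := Nat.mod_eq_of_lt (by omega)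
  have c5 : 8192 % 2 ^ w = 8192 := Nat.mod_eq_of_lt (by omega)
  have hmn : m ≤ m * n := Nat.le_mul_of_pos_right m hn
  have i0 : input N s 0 % 2 ^ w = n := Nat.mod_eq_of_lt (show n < 2 ^ w by omega)
  have i1 : input N s 1 % 2 ^ w = m := Nat.mod_eq_of_lt (show m < 2 ^ w by omega)
  have i2 : input N s 2 % 2 ^ w = s := Nat.mod_eq_of_lt (show s < 2 ^ w by omega)
  have hss : s * s ≤ n * n := Nat.mul_le_mul hs hs
  have hgap := gap_mul_le hn hs
  have hgs : gap n s * s ≤ n * n := Nat.mul_le_mul (by omega) hs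
  have hdiv : s * s / (8192 * n) = gap n s := rfl
  obtain ⟨R, hR⟩ : ∃ R, timeBound n m s = 100 + m * (7 * n + 10) + R := ⟨_, rfl⟩
  rw [hR]
  refine Run.mono (t := R + 50 + 1 + m * (7 * n + 10) + 9) ?_ (by omega)
  refine run_block 9 9 rfl rfl rfl ?_
  simp (disch := decide) only [instructions, List.drop_zero,
    List.take_succ_cons, List.take_zero, block, Function.update_self,
    Function.update_of_ne, c1, c2, c3, i0, i1, i2]
  simp (disch := omega) only [natEval_mul]
  simp (disch := omega) only [natEval_add]
  refine run_rows hfit m _ _ 0 (by omega) (rowsInv_input (by omega)) ?_ ?_ ?_ ?_ ?_ ?_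
  all_goals try simp (disch := decide) only [Function.update_self, Function.update_of_ne]
  · ring
  · ring
  intro reg mem hfr hRows
  have f0 : reg 0 = n := by
    rw [hfr 0 (by omega)]
    simp (disch := decide) only [Function.update_self, Function.update_of_ne]
  have f1 : reg 1 = s := by
    rw [hfr 1 (by omega)]
    simp (disch := decide) only [Function.update_self, Function.update_of_ne]
  have f2 : reg 2 = 3 + m * n := by
    rw [hfr 2 (by omega)]
    simp (disch := decide) only [Function.update_self, Function.update_of_ne]
    ring
  have f6 : reg 6 = 0 := by
    rw [hfr 6 (by omega)]
    simp (disch := decide) only [Function.update_of_ne]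
  have f7 : reg 7 = 1 := by
    rw [hfr 7 (by omega)]
    simp (disch := decide) only [Function.update_self, Function.update_of_ne]
  have f8 : reg 8 = 0 := by
    rw [hfr 8 (by omega)]
    simp (disch := decide) only [Function.update_of_ne]
  have f9 : reg 9 = 3 := by
    rw [hfr 9 (by omega)]
    simp (disch := decide) only [Function.update_self, Function.update_of_ne]
  have f24 : reg 24 = 0 := by
    rw [hfr 24 (by omega)]
    simp (disch := decide) only [Function.update_of_ne]
  have f28 : reg 28 = 0 := by
    rw [hfr 28 (by omega)]
    simp (disch := decide) only [Function.update_of_ne]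
  clear hfr
  -- with the parameters in place, fill the table and go on to the samples
  have main : ∀ (k e : ℕ) (reg : ℕ → ℕ) (T : ℕ), 0 < k → k ≤ n → Consts n m s k e reg →
      reg 28 = 0 → (∀ reg' mem' : ℕ → ℕ, Consts n m s k e reg' → TableInv N s k mem' (2 ^ n) →
      reg' 24 = reg 24 → Run prog w ω (HasCover N s)
        (fun c => c.answer = some false ∧ NoReport N s ω) T ⟨96, reg', mem', 0, none⟩) →
      Run prog w ω (HasCover N s) (fun c => c.answer = some false ∧ NoReport N s ω)
        (T + 2 + remaining n k 0 * (20 * m + 40) + 3) ⟨43, reg, mem, 0, none⟩ := by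
    intro k e reg T hk0 hkn hc h28 hk
    refine run_block 3 46 rfl rfl rfl ?_
    simp (disch := decide) only [instructions, List.drop_succ_cons, List.drop_zero,
      List.take_succ_cons, List.take_zero, block, Function.update_self,
      Function.update_of_ne, hc.r0, hc.r2, hc.r7, Nat.zero_mod]
    simp (disch := omega) only [natEval_add]
    refine run_table hfit hk0 hkn (2 ^ n) _ _ 0 ((hc.update ?_).update ?_)
      (hRows.tableInv hn) ?_ ?_ ?_ (by omega) ?_
    iterate 2 norm_num
    all_goals try simp (disch := decide) only [Function.update_self, Function.update_of_ne]
    · exact h28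
    · simp
    · exact hk
  have sampling : ¬ Exhaustive n s → ∀ reg : ℕ → ℕ, reg 0 = n → reg 1 = s → reg 2 = 3 + m * n →
      reg 3 = 3 + m * n + 2 ^ n → reg 4 = 2 ^ n → reg 7 = 1 → reg 8 = 0 → reg 9 = 3 →
      reg 10 = full n → reg 11 = 2 * n + 3 → reg 12 = 4 * n + 6 → reg 21 = gap n s → reg 28 = 0 →
      Run prog w ω (HasCover N s) (fun c => c.answer = some false ∧ NoReport N s ω)
        (R + 8 + 8) ⟨35, reg, mem, 0, none⟩ := by
    intro hex reg f0 f1 f2 f3 f4 f7 f8 f9 f10 f11 f12 f21 f28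
    have hd := one_le_gap hn hex
    have hR' : R = remaining n (n / 2 - gap n s) 0 * (20 * m + 40) +
      samples n s * (6 * n + 20 + remaining n (3 * gap n s) 0 * (20 * m + 40)) := by
      rw [timeBound, if_neg hex] at hR
      omega
    have hsam : samples n s < 2 ^ w := by
      have : 2 ^ (n - s / 4) ≤ 2 ^ n := Nat.pow_le_pow_right (by norm_num) (by omega)
      rw [samples]
      omega
    have hsam' := hsam
    rw [samples] at hsam'
    refine run_block 8 43 rfl rfl rfl ?_
    simp (disch := decide) only [instructions, List.drop_succ_cons, List.drop_zero,
      List.take_succ_cons, List.take_zero, block, Function.update_self,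
      Function.update_of_ne, f0, f1, f9, f21, c2, c4, natEval_div]
    simp (disch := omega) only [natEval_mul, natEval_sub]
    simp (disch := omega) only [natEval_shl]
    refine Run.mono (t := (2 + samples n s *
      (6 * n + 20 + remaining n (3 * gap n s) 0 * (20 * m + 40)) + 1) + 2 +
      remaining n (n / 2 - gap n s) 0 * (20 * m + 40) + 3) ?_ (by omega)
    refine main (n / 2 - gap n s) (3 * gap n s) _ _ (by omega) (by omega) ?_ ?_ ?_
    · constructor <;>
        simp (disch := decide) only [Function.update_self, Function.update_of_ne, f0, f1, f2, f3,
          f4, f7, f8, f9, f10, f11, f12]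
    · simp (disch := decide) only [Function.update_of_ne, f28]
    intro reg' mem' hc' hT' h24'
    simp (disch := decide) only [Function.update_self] at h24'
    refine run_block 1 97 rfl rfl rfl ?_
    simp only [instructions, List.drop_succ_cons, List.drop_zero,
      List.take_succ_cons, List.take_zero, block, c1]
    have := run_samples (ω := ω) (Q := fun c => c.answer = some false ∧ NoReport N s ω)
      hfit (by omega) (by omega) hsam hT'
      (fun hf _ _ => ⟨rfl, Or.inr ⟨hex, ⟨_, hT'⟩, hf⟩⟩) (samples n s)
      (Function.update reg' 28 1) 0 (by omega) (hc'.update (by norm_num)) (Function.update_self ..)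
      (by rw [Function.update_of_ne (by decide), h24']; rfl)
      (fun i hi => absurd hi (Nat.not_lt_zero _))
    rwa [Nat.zero_mul] at this
  have params : ∀ reg : ℕ → ℕ, reg 0 = n → reg 1 = s → reg 2 = 3 + m * n →
      reg 3 = 3 + m * n + 2 ^ n → reg 4 = 2 ^ n → reg 6 = 0 → reg 7 = 1 → reg 8 = 0 → reg 9 = 3 →
      reg 21 = gap n s → reg 24 = 0 → reg 28 = 0 →
      Run prog w ω (HasCover N s) (fun c => c.answer = some false ∧ NoReport N s ω)
        (R + 10 + 1 + 11 + 1 + 6) ⟨28, reg, mem, 0, none⟩ := by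
    intro reg f0 f1 f2 f3 f4 f6 f7 f8 f9 f21 f24 f28
    refine run_block 6 34 rfl rfl rfl ?_
    simp (disch := decide) only [instructions, List.drop_succ_cons, List.drop_zero,
      List.take_succ_cons, List.take_zero, block, Function.update_self,
      Function.update_of_ne, f0, f1, f4, f7, f8, f9, f21]
    have hpos := Nat.two_pow_pos n
    simp (disch := omega) only [natEval_mul]
    simp (disch := omega) only [natEval_add, natEval_sub]
    by_cases hex : Exhaustive n s
    · have hR' : R = remaining n n 0 * (20 * m + 40) := by
        rw [timeBound, if_pos hex] at hR
        omega
      refine Run.jlt (target := 43) rfl (by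
        simp (disch := decide) only [Function.update_self, Function.update_of_ne]
        have := hex
        rw [Exhaustive] at this
        omega) ?_
      refine Run.mono (t := 3 + 2 + remaining n n 0 * (20 * m + 40) + 3) ?_ (by omega)
      refine main n 0 _ 3 hn le_rfl ?_ ?_ ?_
      · constructor <;>
          simp (disch := decide) only [Function.update_self, Function.update_of_ne, f0, f1, f2, f3,
            f4, f6, f7, f8, f9, full, add_zero] <;> ring
      · simp (disch := decide) only [Function.update_of_ne, f28]
      intro reg' mem' hc' hT' h24'
      simp (disch := decide) only [Function.update_of_ne, f24] at h24'
      refine run_block 1 97 rfl rfl rfl ?_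
      simp only [instructions, List.drop_succ_cons, List.drop_zero,
        List.take_succ_cons, List.take_zero, block]
      refine Run.jeq (target := 137) rfl ?_ (Run.halt_no rfl ⟨rfl, Or.inl ⟨hex, _, hT'⟩⟩)
      simp (disch := decide) only [Function.update_of_ne]
      rw [h24', hc'.r8]
    · refine Run.jlt_not rfl (by
        simp (disch := decide) only [Function.update_self, Function.update_of_ne]
        have := hex
        rw [Exhaustive] at this
        omega) ?_
      refine Run.mono (t := R + 8 + 8) (sampling hex _ ?_ ?_ ?_ ?_ ?_ ?_ ?_ ?_ ?_ ?_ ?_ ?_ ?_)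
        (by omega)
      all_goals simp (disch := decide) only [Function.update_self, Function.update_of_ne, f0, f1,
        f2, f3, f4, f7, f8, f9, f21, f28, full]
      all_goals ring
  refine Run.mono (t := R + 10 + 1 + 11 + 1 + 6 + 6) ?_ (by omega)
  refine run_block 6 28 rfl rfl rfl ?_
  simp (disch := decide) only [instructions, List.drop_succ_cons, List.drop_zero,
    List.take_succ_cons, List.take_zero, block, Function.update_self,
    Function.update_of_ne, f0, f1, f2, f7, c5]
  simp (disch := omega) only [natEval_mul, natEval_shl, natEval_div, one_mul]
  simp (disch := omega) only [natEval_add, hdiv]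
  refine params _ ?_ ?_ ?_ ?_ ?_ ?_ ?_ ?_ ?_ ?_ ?_ ?_
  all_goals simp (disch := decide) only [Function.update_self, Function.update_of_ne, f0, f1, f2,
    f6, f7, f8, f9, f24, f28]

end

end SetCover

/-! ### Many ways to split a cover -/

namespace SetCover

section Weights

variable {ι : Type*} [DecidableEq ι]

/-- Pairing up elements of similar weight yields many sets of almost the same weight: if `R`
has at least `2 * r` elements, then `2 ^ r` subsets of some `Q ⊆ R` have weights in `[lo, hi]`,
where `lo + hi` is the weight of `Q` and `hi - lo` is at most the range of the weights. -/
lemma exists_balanced (a : ι → ℕ) (B r : ℕ) : ∀ (R : Finset ι) (b : ℕ), 2 * r ≤ R.card →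
    (∀ x ∈ R, b ≤ a x ∧ a x ≤ B) → b ≤ B →
    ∃ Q ⊆ R, ∃ lo hi : ℕ, lo + hi = ∑ x ∈ Q, a x ∧ lo ≤ hi ∧ hi + b ≤ lo + B ∧
      ∃ 𝒯 : Finset (Finset ι), 𝒯.card = 2 ^ r ∧
        (∀ T ∈ 𝒯, T ⊆ Q ∧ lo ≤ ∑ x ∈ T, a x ∧ ∑ x ∈ T, a x ≤ hi) ∧
        ∃ T₀ ∈ 𝒯, ∑ x ∈ T₀, a x = lo := by
  induction r with
  | zero =>
    intro R b _ _ hb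
    exact ⟨∅, by simp, 0, 0, by simp, le_rfl, by omega, {∅}, by simp, by simp, ∅, by simp⟩
  | succ r ih =>
    intro R b hR hab hb
    -- pair up the two lightest elements
    obtain ⟨x, hx, hxmin⟩ := R.exists_min_image a (Finset.card_pos.1 (by omega))
    have hc1 : (R.erase x).card + 1 = R.card := Finset.card_erase_add_one hx
    obtain ⟨y, hy, hymin⟩ := (R.erase x).exists_min_image a (Finset.card_pos.1 (by omega))
    have hc2 : ((R.erase x).erase y).card + 1 = (R.erase x).card := Finset.card_erase_add_one hy
    have hyR := Finset.mem_of_mem_erase hy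
    have hyx := Finset.ne_of_mem_erase hy
    obtain ⟨Q, hQ, lo, hi, hsum, hlh, hrange, 𝒯, hcard, h𝒯, T₀, hT₀, hT₀lo⟩ :=
      ih ((R.erase x).erase y) (a y) (by omega) (fun z hz =>
        ⟨hymin z (Finset.mem_of_mem_erase hz),
          (hab z (Finset.mem_of_mem_erase (Finset.mem_of_mem_erase hz))).2⟩) (hab y hyR).2
    have hxQ : x ∉ Q := fun h => by
      have := Finset.mem_of_mem_erase (hQ h)
      exact Finset.ne_of_mem_erase this rfl
    have hyQ : y ∉ Q := fun h => Finset.ne_of_mem_erase (hQ h) rfl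
    have hxT : ∀ T ∈ 𝒯, x ∉ T := fun T hT h => hxQ ((h𝒯 T hT).1 h)
    have hyT : ∀ T ∈ 𝒯, y ∉ T := fun T hT h => hyQ ((h𝒯 T hT).1 h)
    have hxy := hxmin y hyR
    have hbx := (hab x hx).1
    refine ⟨insert x (insert y Q), ?_, lo + a x, hi + a y, ?_, by omega, by omega,
      𝒯.image (insert x) ∪ 𝒯.image (insert y), ?_, ?_, insert x T₀, ?_, ?_⟩
    · refine Finset.insert_subset hx (Finset.insert_subset hyR fun z hz => ?_)
      exact Finset.mem_of_mem_erase (Finset.mem_of_mem_erase (hQ hz))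
    · rw [Finset.sum_insert (by simp [hxQ, hyx.symm]), Finset.sum_insert hyQ]
      omega
    · rw [Finset.card_union_of_disjoint, Finset.card_image_of_injOn, Finset.card_image_of_injOn,
        hcard, pow_succ]
      · ring
      · intro T hT T' hT' h
        rw [← Finset.erase_insert (hyT T hT), h, Finset.erase_insert (hyT T' hT')]
      · intro T hT T' hT' h
        rw [← Finset.erase_insert (hxT T hT), h, Finset.erase_insert (hxT T' hT')]
      · rw [Finset.disjoint_left]
        intro Z hZ hZ'
        obtain ⟨T, _, rfl⟩ := Finset.mem_image.1 hZ
        obtain ⟨T', hT', h⟩ := Finset.mem_image.1 hZ'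
        have : x ∈ insert y T' := h ▸ Finset.mem_insert_self x T
        rcases Finset.mem_insert.1 this with h | h
        · exact hyx h.symm
        · exact hxT T' hT' h
    · intro Z hZ
      rcases Finset.mem_union.1 hZ with hZ | hZ
      · obtain ⟨T, hT, rfl⟩ := Finset.mem_image.1 hZ
        have := h𝒯 T hT
        rw [Finset.sum_insert (hxT T hT)]
        exact ⟨Finset.insert_subset_insert _ (this.1.trans (Finset.subset_insert _ _)), by omega,
          by omega⟩
      · obtain ⟨T, hT, rfl⟩ := Finset.mem_image.1 hZ
        have := h𝒯 T hT
        rw [Finset.sum_insert (hyT T hT)]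
        exact ⟨(Finset.insert_subset_insert _ this.1).trans (Finset.subset_insert _ _), by omega,
          by omega⟩
    · exact Finset.mem_union_left _ (Finset.mem_image_of_mem _ hT₀)
    · rw [Finset.sum_insert (hxT T₀ hT₀), hT₀lo, add_comm]

/-- If adding one element never jumps over the interval `(k, l)`, then some subset of `D` has its
weight in that interval, provided `D` is heavy enough. -/
lemma exists_sum_between (a : ι → ℕ) {k l lo : ℕ} (hlo : lo < l) (D : Finset ι)
    (hjump : ∀ B ⊆ D, ∀ i ∈ D \ B, lo + ∑ x ∈ B, a x ≤ k → lo + ∑ x ∈ B, a x + a i < l)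
    (hD : k < lo + ∑ x ∈ D, a x) :
    ∃ B ⊆ D, k < lo + ∑ x ∈ B, a x ∧ lo + ∑ x ∈ B, a x < l := by
  have key : ∀ B ⊆ D, lo + ∑ x ∈ B, a x ≤ k ∨
      ∃ B' ⊆ B, k < lo + ∑ x ∈ B', a x ∧ lo + ∑ x ∈ B', a x < l := by
    intro B
    induction B using Finset.induction_on with
    | empty =>
      intro _
      by_cases h : lo ≤ k
      · left; simpa using h
      · right; exact ⟨∅, by simp, by simpa using h, by simpa using hlo⟩
    | insert i B hi ih =>
      intro hB
      have hBD : B ⊆ D := (Finset.subset_insert _ _).trans hB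
      rcases ih hBD with h | ⟨B', hB', h⟩
      · have hj := hjump B hBD i
          (Finset.mem_sdiff.2 ⟨hB (Finset.mem_insert_self _ _), hi⟩) h
        by_cases h' : lo + ∑ x ∈ insert i B, a x ≤ k
        · exact Or.inl h'
        · refine Or.inr ⟨insert i B, Finset.Subset.refl _, by omega, ?_⟩
          rw [Finset.sum_insert hi]
          omega
      · exact Or.inr ⟨B', hB'.trans (Finset.subset_insert _ _), h⟩
  rcases key D (Finset.Subset.refl _) with h | ⟨B, hB, h⟩
  · omega
  · exact ⟨B, hB, h⟩

/-- A nonempty set of weight at most `k + e` is the disjoint union of a set of weight at most `k`,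
a single element and a set of weight at most `e`. -/
lemma exists_peel (a : ι → ℕ) {k e : ℕ} {T : Finset ι} (hT : T.Nonempty)
    (h : ∑ x ∈ T, a x ≤ k + e) :
    ∃ i ∈ T, ∃ T₁ ⊆ T.erase i, ∑ x ∈ T₁, a x ≤ k ∧ ∑ x ∈ T.erase i \ T₁, a x ≤ e := by
  by_cases hk : ∑ x ∈ T, a x ≤ k
  · obtain ⟨i, hi⟩ := hT
    refine ⟨i, hi, T.erase i, Finset.Subset.refl _, ?_, by simp⟩
    exact (Finset.sum_le_sum_of_subset (Finset.erase_subset _ _)).trans hk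
  · obtain ⟨T₁, hT₁, hmax⟩ := (T.powerset.filter fun B => ∑ x ∈ B, a x ≤ k).exists_max_image
      Finset.card ⟨∅, by simp⟩
    rw [Finset.mem_filter, Finset.mem_powerset] at hT₁
    obtain ⟨i, hi⟩ : (T \ T₁).Nonempty := by
      rw [Finset.sdiff_nonempty]
      intro hsub
      exact hk ((Finset.sum_le_sum_of_subset hsub).trans hT₁.2)
    rw [Finset.mem_sdiff] at hi
    have hins : k < a i + ∑ x ∈ T₁, a x := by
      by_contra hcon
      have := hmax (insert i T₁) (by
        rw [Finset.mem_filter, Finset.mem_powerset, Finset.sum_insert hi.2]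
        exact ⟨Finset.insert_subset hi.1 hT₁.1, not_lt.1 hcon⟩)
      rw [Finset.card_insert_of_notMem hi.2] at this
      omega
    have hsub : T₁ ⊆ T.erase i := fun z hz =>
      Finset.mem_erase.2 ⟨fun h => hi.2 (h ▸ hz), hT₁.1 hz⟩
    refine ⟨i, hi.1, T₁, hsub, hT₁.2, ?_⟩
    have h1 := Finset.sum_sdiff (f := a) hsub
    have h2 := Finset.add_sum_erase T a hi.1
    omega

end Weights

variable {n m s : ℕ} {N : Family n m}

/-- A partition of the universe into exactly `s` nonempty parts, each contained in a member of the
family. The parts are the fibres of a retraction `h` onto a set `R` of representatives, and `g r`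
is the member that contains the part of `r`. -/
structure Partition (N : Family n m) (s : ℕ) where
  h : Fin n → Fin n
  g : Fin n → Fin m
  R : Finset (Fin n)
  h_mem : ∀ u, h u ∈ R
  h_self : ∀ r ∈ R, h r = r
  card_R : R.card = s
  mem : ∀ u, u ∈ N (g (h u))

/-- A cover by at most `s ≤ n` sets can be refined to a partition into exactly `s` parts. -/
lemma HasCover.nonempty_partition (hs : s ≤ n) (hc : HasCover N s) :
    Nonempty (Partition N s) := by
  classical
  obtain ⟨S, hS, hcard⟩ := hc
  have hex : ∀ u, ∃ f ∈ S, u ∈ N f := fun u => by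
    have : u ∈ S.biUnion N := hS ▸ Finset.mem_univ u
    simpa using this
  choose g hgS hg using hex
  have himg : (Finset.univ.image g).card ≤ s :=
    (Finset.card_le_card (by
      intro f hf
      obtain ⟨u, _, rfl⟩ := Finset.mem_image.1 hf
      exact hgS u)).trans hcard
  have hrep : ∀ f : Set.range g, ∃ v, g v = f := fun f => f.2
  choose ρ hρ using hrep
  set p : Fin n → Fin n := fun u => ρ ⟨g u, u, rfl⟩ with hp
  have hgp : ∀ u, g (p u) = g u := fun u => hρ ⟨g u, u, rfl⟩
  have hpg : ∀ u u', g u = g u' → p u = p u' := fun u u' h => by simp only [hp, h]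
  have hR0 : (Finset.univ.image p).card ≤ s := by
    refine le_trans ?_ himg
    have : Finset.univ.image g = (Finset.univ.image p).image g := by
      ext f
      simp only [Finset.mem_image, Finset.mem_univ, true_and, exists_exists_eq_and, hgp]
    rw [this, Finset.card_image_of_injOn (s := Finset.univ.image p)]
    intro x hx y hy hxy
    obtain ⟨u, _, rfl⟩ := Finset.mem_image.1 hx
    obtain ⟨u', _, rfl⟩ := Finset.mem_image.1 hy
    exact hpg u u' (by rw [← hgp u, ← hgp u', hxy])
  obtain ⟨R, hR, hRcard⟩ := Finset.exists_superset_card_eq hR0 (by simpa using hs)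
  refine ⟨⟨fun u => if u ∈ R then u else p u, g, R, ?_, ?_, hRcard, ?_⟩⟩
  · intro u
    split
    · assumption
    · exact hR (Finset.mem_image_of_mem p (Finset.mem_univ u))
  · intro r hr
    exact if_pos hr
  · intro u
    split
    · exact hg u
    · rw [hgp]; exact hg u

namespace Partition

variable (p : Partition N s)

/-- The union of the parts with representatives in `T`. -/
def union (T : Finset (Fin n)) : Finset (Fin n) := Finset.univ.filter fun u => p.h u ∈ T

/-- The size of the part of `r`. -/
def size (r : Fin n) : ℕ := (Finset.univ.filter fun u => p.h u = r).card

@[simp] lemma mem_union (T : Finset (Fin n)) (u : Fin n) : u ∈ p.union T ↔ p.h u ∈ T := by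
  simp [union]

lemma card_union (T : Finset (Fin n)) : (p.union T).card = ∑ r ∈ T, p.size r := by
  rw [Finset.card_eq_sum_card_fiberwise (f := p.h) (t := T) fun u hu => by simpa using hu]
  refine Finset.sum_congr rfl fun r hr => congrArg Finset.card ?_
  ext u
  simp only [Finset.mem_filter, mem_union, Finset.mem_univ, true_and]
  exact ⟨fun h => h.2, fun h => ⟨h ▸ hr, h⟩⟩

lemma sum_size : ∑ r ∈ p.R, p.size r = n := by
  rw [← p.card_union]
  have : p.union p.R = Finset.univ := by ext u; simp [p.h_mem]
  rw [this, Finset.card_univ, Fintype.card_fin]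

lemma union_injOn : Set.InjOn p.union {T | T ⊆ p.R} := by
  intro T hT T' hT' h
  have key : ∀ T T' : Finset (Fin n), T ⊆ p.R → p.union T = p.union T' → T ⊆ T' := by
    intro T T' hT h r hr
    have : r ∈ p.union T := by rw [mem_union, p.h_self r (hT hr)]; exact hr
    rwa [h, mem_union, p.h_self r (hT hr)] at this
  exact Finset.Subset.antisymm (key T T' hT h) (key T' T hT' h.symm)

lemma coverBy (T : Finset (Fin n)) : CoverBy N T.card (mask (p.union T)) := by
  classical
  refine ⟨T.image p.g, Finset.card_image_le, fun i hi => ?_⟩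
  obtain ⟨u, hu, rfl⟩ := (testBit_mask_iff _ _).1 hi
  rw [mem_union] at hu
  exact ⟨p.g (p.h u), Finset.mem_image_of_mem _ hu, by
    rw [testBit_mask, decide_eq_true_iff]; exact p.mem u⟩

lemma pop_union (T : Finset (Fin n)) : pop (mask (p.union T)) = ∑ r ∈ T, p.size r := by
  rw [pop_mask, card_union]

lemma diff_full_union (T : Finset (Fin n)) :
    diff (full n) (mask (p.union T)) = mask (p.union (p.R \ T)) := by
  refine Nat.eq_of_testBit_eq fun i => ?_
  rw [testBit_diff, testBit_full]
  by_cases hi : i < n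
  · have h1 := testBit_mask (p.union T) ⟨i, hi⟩
    have h2 := testBit_mask (p.union (p.R \ T)) ⟨i, hi⟩
    simp only at h1 h2
    rw [h1, h2]
    simp [hi, p.h_mem]
  · rw [Nat.testBit_lt_two_pow ((mask_lt (p.union (p.R \ T))).trans_le
      (Nat.pow_le_pow_right (by norm_num) (by omega)))]
    simp [hi]

/-- What remains of a union of parts after removing some of them and a member that contains one
more of them. -/
lemma testBit_diff_diff {T T₁ : Finset (Fin n)} {r : Fin n} {i : ℕ}
    (hi : (diff (diff (mask (p.union T)) (mask (p.union (T.erase r \ T₁))))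
      (mask (N (p.g r)))).testBit i = true) : (mask (p.union T₁)).testBit i = true := by
  rw [testBit_diff, testBit_diff, Bool.and_eq_true, Bool.and_eq_true] at hi
  obtain ⟨⟨h1, h2⟩, h3⟩ := hi
  obtain ⟨u, hu, rfl⟩ := (testBit_mask_iff _ _).1 h1
  rw [testBit_mask, Bool.not_eq_true', decide_eq_false_iff_not] at h2 h3
  rw [testBit_mask, decide_eq_true_iff]
  rw [mem_union] at hu h2 ⊢
  have hne : p.h u ≠ r := fun h => h3 (h ▸ p.mem u)
  by_contra hcon
  exact h2 (Finset.mem_sdiff.2 ⟨Finset.mem_erase.2 ⟨hne, hu⟩, hcon⟩)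

end Partition

lemma coverBy_full_of_hasCover {N : Family n m} (h : HasCover N s) : CoverBy N s (full n) := by
  obtain ⟨S, hS, hcard⟩ := h
  refine ⟨S, hcard, fun i hi => ?_⟩
  rw [testBit_full, decide_eq_true_iff] at hi
  have : (⟨i, hi⟩ : Fin n) ∈ S.biUnion N := hS ▸ Finset.mem_univ _
  obtain ⟨f, hf, hfi⟩ := Finset.mem_biUnion.1 this
  exact ⟨f, hf, (testBit_mask_iff _ _).2 ⟨_, hfi, rfl⟩⟩

/-- With `Z ≤ Y` dropped from `TableInv.no_cover`: the cases are symmetric. -/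
lemma TableInv.no_split {k : ℕ} {mem : ℕ → ℕ} (hT : TableInv N s k mem (2 ^ n)) {Y Z : ℕ}
    (hY : Y < 2 ^ n) (hZ : Z < 2 ^ n) (hYk : pop Y ≤ k) (hZk : pop Z ≤ k) (f : Fin m)
    (hf : ∀ i < n, Y.testBit i = true ∨ Z.testBit i = true ∨ (mask (N f)).testBit i = true)
    {j j' : ℕ} (hj : CoverBy N j Y) (hj' : CoverBy N j' Z) : s < j + 1 + j' := by
  rcases le_total Z Y with h | h
  · exact hT.no_cover Y hY hY hYk Z h hZk f hf j j' hj hj'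
  · have := hT.no_cover Z hZ hZ hZk Y h hYk f (fun i hi => by
      rcases hf i hi with h | h | h
      · exact Or.inr (Or.inl h)
      · exact Or.inl h
      · exact Or.inr (Or.inr h)) j' j hj' hj
    omega

/-- If the table is complete, then the program finds every cover without sampling. -/
lemma TableInv.not_hasCover (hn : 1 ≤ n) {mem : ℕ → ℕ} (hT : TableInv N s n mem (2 ^ n)) :
    ¬ HasCover N s := by
  intro h
  have hfull : full n ≠ 0 := by
    have : 2 ^ 1 ≤ 2 ^ n := Nat.pow_le_pow_right (by norm_num) hn
    rw [full]
    omega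
  obtain ⟨f, hs, hc, hlt⟩ := (coverBy_full_of_hasCover h).exists_diff hfull
  have hlt' := hlt.trans (full_lt n)
  have := hT.no_split hlt' (Nat.two_pow_pos n) (pop_le_of_lt hlt') (by simp) f (fun i hi => by
    rw [testBit_diff, testBit_full]
    cases (mask (N f)).testBit i <;> simp [hi]) hc (CoverBy.zero N 0)
  omega

/-- A sample that is a union of parts leads to a cover if both it and its complement are nonempty
and have at most `k + e` elements: peel a small union of parts and one more part off each side. -/
lemma Partition.not_fails (p : Partition N s) {k e : ℕ} {T : Finset (Fin n)} (hT : T ⊆ p.R)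
    (hne : T.Nonempty) (hne' : (p.R \ T).Nonempty) (h1 : ∑ r ∈ T, p.size r ≤ k + e)
    (h2 : ∑ r ∈ p.R \ T, p.size r ≤ k + e) : ¬ Fails N s k e (mask (p.union T)) := by
  intro hF
  obtain ⟨r, hr, A, hA, hAk, hAe⟩ := exists_peel p.size hne h1
  obtain ⟨r', hr', A', hA', hAk', hAe'⟩ := exists_peel p.size hne' h2
  have hsub := fun i => p.testBit_diff_diff (T := T) (T₁ := A) (r := r) (i := i)
  have hsub' := fun i => p.testBit_diff_diff (T := p.R \ T) (T₁ := A') (r := r') (i := i)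
  have := hF (mask (p.union (T.erase r \ A))) (mask (p.union ((p.R \ T).erase r' \ A')))
    (mask_lt _) (mask_lt _) (by rw [p.pop_union]; exact hAe) (by rw [p.pop_union]; exact hAe')
    (p.g r) (p.g r') ((pop_mono hsub).trans (by rw [p.pop_union]; exact hAk))
    (by
      rw [p.diff_full_union]
      exact (pop_mono hsub').trans (by rw [p.pop_union]; exact hAk'))
    _ _ _ _ (p.coverBy _) ((p.coverBy A).mono le_rfl hsub) (p.coverBy _)
    (by
      rw [p.diff_full_union]
      exact (p.coverBy A').mono le_rfl hsub')
  have c1 := Finset.card_sdiff_add_card_eq_card hA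
  have c2 := Finset.card_sdiff_add_card_eq_card hA'
  have c3 := Finset.card_erase_add_one hr
  have c4 := Finset.card_erase_add_one hr'
  have c5 := Finset.card_sdiff_add_card_eq_card hT
  have c6 := p.card_R
  omega

/-- If filling the table does not reveal a cover, then there are many samples that do. -/
lemma exists_many_samples (hn : 1 ≤ n) (hs : s ≤ n) (hex : ¬ Exhaustive n s) {mem : ℕ → ℕ}
    (hT : TableInv N s (n / 2 - gap n s) mem (2 ^ n)) (hc : HasCover N s) :
    ∃ G : Finset ℕ, 2 ^ (s / 4) ≤ G.card ∧
      ∀ W ∈ G, W < 2 ^ n ∧ ¬ Fails N s (n / 2 - gap n s) (3 * gap n s) W := by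
  classical
  obtain ⟨p⟩ := hc.nonempty_partition hs
  have hd := one_le_gap hn hex
  have hgap := gap_mul_le hn hs
  have hds : 2 * n ≤ gap n s * s := not_lt.1 hex
  set d := gap n s
  set k := n / 2 - d with hk
  have hsum := p.sum_size
  have hcardR := p.card_R
  -- at most half of the parts have more than `d` elements
  have hsmall : 2 * (s / 4) ≤ (p.R.filter fun r => p.size r ≤ d).card := by
    have h1 := Finset.card_filter_add_card_filter_not (s := p.R) (fun r => p.size r ≤ d)
    have h2 : (p.R.filter fun r => ¬ p.size r ≤ d).card * d ≤ n := by
      calc _ = ∑ r ∈ p.R.filter fun r => ¬ p.size r ≤ d, d := by simp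
        _ ≤ ∑ r ∈ p.R.filter fun r => ¬ p.size r ≤ d, p.size r :=
          Finset.sum_le_sum fun r hr => by
            have := (Finset.mem_filter.1 hr).2
            omega
        _ ≤ ∑ r ∈ p.R, p.size r := Finset.sum_le_sum_of_subset (Finset.filter_subset _ _)
        _ = n := hsum
    have h3 : 2 * (p.R.filter fun r => ¬ p.size r ≤ d).card ≤ s := by
      refine Nat.le_of_mul_le_mul_right (c := d) ?_ hd
      calc _ = 2 * ((p.R.filter fun r => ¬ p.size r ≤ d).card * d) := by ring
        _ ≤ 2 * n := Nat.mul_le_mul_left _ h2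
        _ ≤ d * s := hds
        _ = s * d := mul_comm _ _
    omega
  obtain ⟨Q, hQ, lo, hi, hlohi, hlh, hrange, 𝒯, hcard, h𝒯, T₀, hT₀, hT₀lo⟩ :=
    exists_balanced p.size d (s / 4) _ 0 hsmall
      (fun r hr => ⟨Nat.zero_le _, (Finset.mem_filter.1 hr).2⟩) (Nat.zero_le _)
  have hQR : Q ⊆ p.R := hQ.trans (Finset.filter_subset _ _)
  have hQsum := Finset.sum_sdiff (f := p.size) hQR
  -- complete the balanced sets by a common set to sets with about half of the elements
  obtain ⟨B, hB, hBk, hBl⟩ := exists_sum_between p.size (k := k) (l := n - k) (lo := lo)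
    (by omega) (p.R \ Q) (by
      intro B hB i hi hBk
      by_contra hcon
      rw [Finset.mem_sdiff] at hi
      have hiR := (Finset.mem_sdiff.1 hi.1).1
      have hiQ := (Finset.mem_sdiff.1 hi.1).2
      have hT₀Q := (h𝒯 T₀ hT₀).1
      have hdisj : Disjoint T₀ B := Finset.disjoint_left.2 fun x hx hxB =>
        (Finset.mem_sdiff.1 (hB hxB)).2 (hT₀Q hx)
      have hsub : T₀ ∪ B ⊆ p.R.erase i := by
        intro x hx
        rcases Finset.mem_union.1 hx with hx | hx
        · exact Finset.mem_erase.2 ⟨fun h => hiQ (h ▸ hT₀Q hx), hQR (hT₀Q hx)⟩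
        · exact Finset.mem_erase.2 ⟨fun h => hi.2 (h ▸ hx), (Finset.mem_sdiff.1 (hB hx)).1⟩
      have hw := Finset.sum_union (f := p.size) hdisj
      have h1 := Finset.sum_sdiff (f := p.size) hsub
      have h2 := Finset.add_sum_erase p.R p.size hiR
      have h3 := Finset.card_sdiff_add_card_eq_card hsub
      have h4 := Finset.card_erase_add_one hiR
      have := hT.no_split (mask_lt (p.union (T₀ ∪ B)))
        (mask_lt (p.union (p.R.erase i \ (T₀ ∪ B)))) (by rw [p.pop_union]; omega)
        (by rw [p.pop_union]; omega) (p.g i) (fun j hj => by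
          have e1 := testBit_mask (p.union (T₀ ∪ B)) ⟨j, hj⟩
          have e2 := testBit_mask (p.union (p.R.erase i \ (T₀ ∪ B))) ⟨j, hj⟩
          have e3 := testBit_mask (N (p.g i)) ⟨j, hj⟩
          simp only at e1 e2 e3
          rw [e1, e2, e3]
          simp only [decide_eq_true_eq, Partition.mem_union]
          by_cases hji : p.h ⟨j, hj⟩ = i
          · right; right
            have := p.mem ⟨j, hj⟩
            rwa [hji] at this
          · by_cases hjT : p.h ⟨j, hj⟩ ∈ T₀ ∪ B
            · exact Or.inl hjT
            · exact Or.inr (Or.inl (Finset.mem_sdiff.2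
                ⟨Finset.mem_erase.2 ⟨hji, p.h_mem _⟩, hjT⟩)))
        (p.coverBy _) (p.coverBy _)
      omega) (by omega)
  have hBQ : ∀ T ∈ 𝒯, Disjoint B T := fun T hT => Finset.disjoint_left.2 fun x hx hxT =>
    (Finset.mem_sdiff.1 (hB hx)).2 ((h𝒯 T hT).1 hxT)
  have hBT : ∀ T ∈ 𝒯, B ∪ T ⊆ p.R := fun T hT => Finset.union_subset
    (hB.trans Finset.sdiff_subset) ((h𝒯 T hT).1.trans hQR)
  refine ⟨𝒯.image fun T => mask (p.union (B ∪ T)), ?_, ?_⟩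
  · rw [Finset.card_image_of_injOn, hcard]
    intro T hT T' hT' h
    have h' := p.union_injOn (hBT T hT) (hBT T' hT') (mask_injective h)
    rw [← Finset.union_sdiff_cancel_left (hBQ T hT), h',
      Finset.union_sdiff_cancel_left (hBQ T' hT')]
  · intro W hW
    obtain ⟨T, hT, rfl⟩ := Finset.mem_image.1 hW
    refine ⟨mask_lt _, ?_⟩
    have h1 := Finset.sum_union (f := p.size) (hBQ T hT)
    have h2 := (h𝒯 T hT).2
    have h3 := Finset.sum_sdiff (f := p.size) (hBT T hT)
    have nonempty : ∀ A : Finset (Fin n), 0 < ∑ r ∈ A, p.size r → A.Nonempty := fun A hA => by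
      by_contra h
      rw [Finset.not_nonempty_iff_eq_empty.1 h] at hA
      simp at hA
    exact p.not_fails (hBT T hT) (nonempty _ (by omega)) (nonempty _ (by omega)) (by omega)
      (by omega)

end SetCover

/-! ### Independent samples -/

namespace SetCover

open WordRAM MeasureTheory

lemma coinLaw_cylinder {κ : Type*} [Fintype κ] {e : κ → ℕ} (he : Function.Injective e)
    (b : κ → Bool) : coinLaw {ω | ∀ k, ω (e k) = b k} = (2⁻¹ : ENNReal) ^ Fintype.card κ := by
  classical
  have hset : {ω : ℕ → Bool | ∀ k, ω (e k) = b k} =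
      Set.pi (Finset.univ.image e : Finset ℕ) fun i => {x | ∀ k, e k = i → x = b k} := by
    ext ω
    simp only [Set.mem_ofPred_eq, Set.mem_pi, Finset.coe_image, Finset.coe_univ, Set.image_univ,
      Set.mem_range, forall_exists_index, forall_apply_eq_imp_iff]
    exact ⟨fun h k k' hk => by rw [← hk]; exact h k', fun h k => h k k rfl⟩
  rw [hset, coinLaw, Measure.infinitePi_pi _ (fun _ _ => MeasurableSet.of_discrete),
    Finset.prod_image he.injOn]
  have : ∀ k, (PMF.uniformOfFintype Bool).toMeasure {x | ∀ k', e k' = e k → x = b k'} = 2⁻¹ := by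
    intro k
    have h1 : {x : Bool | ∀ k', e k' = e k → x = b k'} = {b k} := by
      ext x
      simp only [Set.mem_ofPred_eq, Set.mem_singleton_iff]
      exact ⟨fun h => h k rfl, fun h k' hk => by rw [he hk]; exact h⟩
    rw [h1, PMF.toMeasure_apply_singleton _ _ (MeasurableSet.singleton _)]
    simp
  rw [Finset.prod_congr rfl fun k _ => this k, Finset.prod_const, Finset.card_univ]

/-- The outcomes of finitely many coin flips are uniformly distributed. -/
lemma coinLaw_finset {κ : Type*} [Fintype κ] {e : κ → ℕ} (he : Function.Injective e)
    (B : Finset (κ → Bool)) : coinLaw {ω | (fun k => ω (e k)) ∈ B} =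
      B.card * (2⁻¹ : ENNReal) ^ Fintype.card κ := by
  classical
  have hset : {ω : ℕ → Bool | (fun k => ω (e k)) ∈ B} =
      ⋃ b ∈ B, {ω : ℕ → Bool | ∀ k, ω (e k) = b k} := by
    ext ω
    simp only [Set.mem_ofPred_eq, Set.mem_iUnion, exists_prop]
    exact ⟨fun h => ⟨_, h, fun _ => rfl⟩, fun ⟨b, hb, h⟩ => by
      rwa [show (fun k => ω (e k)) = b from funext h]⟩
  have hmeas : ∀ b ∈ B, MeasurableSet {ω : ℕ → Bool | ∀ k, ω (e k) = b k} := by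
    intro b _
    rw [Set.ofPred_forall]
    exact MeasurableSet.iInter fun k =>
      measurableSet_eq_fun (measurable_pi_apply (e k)) measurable_const
  rw [hset, measure_biUnion_finset _ hmeas, Finset.sum_congr rfl fun b _ => coinLaw_cylinder he b,
    Finset.sum_const, nsmul_eq_mul]
  intro b _ b' _ hne
  rw [Function.onFun, Set.disjoint_left]
  intro ω h h'
  exact hne (funext fun k => (h k).symm.trans (h' k))

lemma sample_eq_iff {ω ω' : ℕ → Bool} {p p' i : ℕ} :
    sample ω p i = sample ω' p' i ↔ ∀ j < i, ω (p + j) = ω' (p' + j) := by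
  induction i with
  | zero => simp [sample]
  | succ i ih =>
    have h1 := Bool.toNat_lt (ω (p + i))
    have h2 := Bool.toNat_lt (ω' (p' + i))
    rw [sample, sample]
    constructor
    · intro h j hj
      rcases Nat.lt_succ_iff_lt_or_eq.1 hj with hj | rfl
      · exact ih.1 (by omega) j hj
      · have : (ω (p + j)).toNat = (ω' (p' + j)).toNat := by omega
        revert this
        cases ω (p + j) <;> cases ω' (p' + j) <;> simp
    · intro h
      rw [ih.2 fun j hj => h j (by omega), h i (by omega)]

/-- The number with the given binary digits. -/
def ofBits {n : ℕ} (c : Fin n → Bool) : ℕ :=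
  sample (fun t => if h : t < n then c ⟨t, h⟩ else false) 0 n

lemma sample_eq_ofBits (ω : ℕ → Bool) (p n : ℕ) :
    sample ω p n = ofBits fun j : Fin n => ω (p + j.val) :=
  sample_eq_iff.2 fun j hj => by simp [hj]

lemma ofBits_injective (n : ℕ) : Function.Injective (ofBits : (Fin n → Bool) → ℕ) := by
  intro c c' h
  funext j
  have := sample_eq_iff.1 h j.val j.2
  simpa using this

lemma image_ofBits (n : ℕ) :
    (Finset.univ : Finset (Fin n → Bool)).image ofBits = Finset.range (2 ^ n) := by
  refine Finset.eq_of_subset_of_card_le ?_ ?_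
  · intro x hx
    obtain ⟨c, _, rfl⟩ := Finset.mem_image.1 hx
    exact Finset.mem_range.2 (sample_lt _ _ _)
  · rw [Finset.card_image_of_injective _ (ofBits_injective n)]
    simp

lemma card_ofBits_notMem {n : ℕ} {G : Finset ℕ} (hG : ∀ W ∈ G, W < 2 ^ n) :
    (Finset.univ.filter fun c : Fin n → Bool => ofBits c ∉ G).card = 2 ^ n - G.card := by
  have hsub : G ⊆ Finset.range (2 ^ n) := fun W hW => Finset.mem_range.2 (hG W hW)
  rw [← Finset.card_image_of_injective _ (ofBits_injective n)]
  have : (Finset.univ.filter fun c : Fin n → Bool => ofBits c ∉ G).image ofBits =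
      Finset.range (2 ^ n) \ G := by
    rw [← image_ofBits]
    ext x
    simp only [Finset.mem_image, Finset.mem_filter, Finset.mem_univ, true_and, Finset.mem_sdiff]
    exact ⟨fun ⟨c, hc, h⟩ => ⟨⟨c, h⟩, h ▸ hc⟩, fun ⟨⟨c, h⟩, hx⟩ => ⟨c, h ▸ hx, h⟩⟩
  rw [this, Finset.card_sdiff_of_subset hsub, Finset.card_range]

/-- The samples are independent and uniformly distributed. -/
lemma coinLaw_samples {n M : ℕ} {G : Finset ℕ} (hG : ∀ W ∈ G, W < 2 ^ n) :
    coinLaw {ω | ∀ i < M, sample ω (i * n) n ∉ G} =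
      ((2 ^ n - G.card) ^ M : ℕ) * (2⁻¹ : ENNReal) ^ (M * n) := by
  classical
  have he : Function.Injective fun q : Fin M × Fin n => q.1.val * n + q.2.val := by
    rintro ⟨i, j⟩ ⟨i', j'⟩ h
    have hn : 0 < n := by have := j.2; omega
    have hi : i.val = i'.val := by
      have := congrArg (· / n) h
      simpa [Nat.add_comm, Nat.add_mul_div_right, Nat.div_eq_of_lt j.2, Nat.div_eq_of_lt j'.2,
        hn] using this
    have hj : j.val = j'.val := by
      simp only [hi] at h
      omega
    exact Prod.ext (Fin.ext hi) (Fin.ext hj)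
  set B : Finset (Fin M × Fin n → Bool) :=
    Finset.univ.filter fun b => ∀ i, ofBits (fun j => b (i, j)) ∉ G with hB
  have hset : {ω : ℕ → Bool | ∀ i < M, sample ω (i * n) n ∉ G} =
      {ω | (fun q : Fin M × Fin n => ω (q.1.val * n + q.2.val)) ∈ B} := by
    ext ω
    simp only [Set.mem_ofPred_eq, hB, Finset.mem_filter, Finset.mem_univ, true_and,
      sample_eq_ofBits]
    exact ⟨fun h i => h i.val i.2, fun h i hi => h ⟨i, hi⟩⟩
  have hcard : B.card = (2 ^ n - G.card) ^ M := by
    have h1 : (Fintype.piFinset fun _ : Fin M =>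
        Finset.univ.filter fun c : Fin n → Bool => ofBits c ∉ G).card = (2 ^ n - G.card) ^ M := by
      rw [Fintype.card_piFinset, Finset.prod_const, card_ofBits_notMem hG, Finset.card_univ,
        Fintype.card_fin]
    rw [← h1]
    refine Finset.card_equiv (Equiv.curry (Fin M) (Fin n) Bool) fun b => ?_
    simp only [hB, Finset.mem_filter, Finset.mem_univ, true_and, Fintype.mem_piFinset]
    exact Iff.rfl
  rw [hset, coinLaw_finset he B, hcard, Fintype.card_prod, Fintype.card_fin, Fintype.card_fin]

/-- If `G` has at least `2 ^ r` elements, then `2 * 2 ^ (n - r)` samples miss it with probability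
at most `1 / 4`. -/
lemma coinLaw_samples_le {n r : ℕ} (hr : r ≤ n) {G : Finset ℕ} (hG : ∀ W ∈ G, W < 2 ^ n)
    (hcard : 2 ^ r ≤ G.card) :
    coinLaw {ω | ∀ i < 2 * 2 ^ (n - r), sample ω (i * n) n ∉ G} ≤ 1 / 4 := by
  have hGn : G.card ≤ 2 ^ n := by
    have := Finset.card_le_card (s := G) (t := Finset.range (2 ^ n))
      fun W hW => Finset.mem_range.2 (hG W hW)
    simpa using this
  rw [coinLaw_samples hG]
  set M := 2 * 2 ^ (n - r) with hM
  have hreal : ((2 : ℝ) ^ n - G.card) ^ M * 4 ≤ 2 ^ (M * n) := by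
    have hpos : (0 : ℝ) < 2 ^ n := by positivity
    have hG' : (G.card : ℝ) ≤ 2 ^ n := by exact_mod_cast hGn
    have h1 : (2 : ℝ) ^ n - G.card ≤ 2 ^ n * Real.exp (-(G.card / 2 ^ n)) := by
      have := Real.add_one_le_exp (-((G.card : ℝ) / 2 ^ n))
      calc (2 : ℝ) ^ n - G.card = 2 ^ n * (-((G.card : ℝ) / 2 ^ n) + 1) := by field_simp; ring
        _ ≤ _ := mul_le_mul_of_nonneg_left this hpos.le
    have h2 : ((2 : ℝ) ^ n - G.card) ^ M ≤ (2 ^ n * Real.exp (-(G.card / 2 ^ n))) ^ M :=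
      pow_le_pow_left₀ (by linarith) h1 M
    have h3 : (2 : ℝ) ≤ M * (G.card / 2 ^ n) := by
      have hc : (2 : ℝ) ^ r ≤ G.card := by exact_mod_cast hcard
      have hsplit : (2 : ℝ) ^ n = 2 ^ (n - r) * 2 ^ r := by
        rw [← pow_add, Nat.sub_add_cancel hr]
      rw [← mul_div_assoc, le_div_iff₀ hpos, hM, hsplit]
      push_cast
      have : (0 : ℝ) < 2 ^ (n - r) := by positivity
      nlinarith
    have h4 : Real.exp (-(G.card / 2 ^ n)) ^ M * 4 ≤ 1 := by
      rw [← Real.exp_nat_mul]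
      have h5 : Real.exp (M * -(G.card / 2 ^ n)) ≤ Real.exp (-2) :=
        Real.exp_le_exp.2 (by linarith)
      have h6 : (2 : ℝ) ≤ Real.exp 1 := by
        have := Real.add_one_le_exp (1 : ℝ)
        linarith
      have h7 : Real.exp (-2) * (Real.exp 1 * Real.exp 1) = 1 := by
        rw [← Real.exp_add, ← Real.exp_add]
        norm_num
      have h8 := Real.exp_pos (-2)
      have h9 : Real.exp (-2) * 4 ≤ Real.exp (-2) * (Real.exp 1 * Real.exp 1) :=
        mul_le_mul_of_nonneg_left (by nlinarith) h8.le
      linarith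
    calc ((2 : ℝ) ^ n - G.card) ^ M * 4
        ≤ (2 ^ n * Real.exp (-(G.card / 2 ^ n))) ^ M * 4 := by linarith
      _ = 2 ^ (M * n) * (Real.exp (-(G.card / 2 ^ n)) ^ M * 4) := by
        rw [mul_pow, ← pow_mul, Nat.mul_comm n M]; ring
      _ ≤ 2 ^ (M * n) * 1 := mul_le_mul_of_nonneg_left h4 (by positivity)
      _ = _ := mul_one _
  have hnat : (2 ^ n - G.card) ^ M * 4 ≤ 2 ^ (M * n) := by
    have : (((2 ^ n - G.card) ^ M * 4 : ℕ) : ℝ) ≤ ((2 ^ (M * n) : ℕ) : ℝ) := by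
      push_cast [Nat.cast_sub hGn]
      exact hreal
    exact_mod_cast this
  rw [← ENNReal.inv_pow, ← div_eq_mul_inv]
  refine ENNReal.div_le_of_le_mul ?_
  rw [mul_comm, mul_one_div]
  rw [ENNReal.le_div_iff_mul_le (by norm_num) (by norm_num)]
  exact_mod_cast hnat

end SetCover

/-! ### The running time -/

namespace SetCover

lemma sum_range_two_mul (f : ℕ → ℝ) (k : ℕ) :
    ∑ i ∈ Finset.range (2 * k), f i = ∑ i ∈ Finset.range k, (f (2 * i) + f (2 * i + 1)) := by
  induction k with
  | zero => simp
  | succ k ih =>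
    rw [show 2 * (k + 1) = 2 * k + 1 + 1 by ring, Finset.sum_range_succ, Finset.sum_range_succ, ih,
      Finset.sum_range_succ]
    ring

lemma sum_pow_pop (y : ℝ) (n : ℕ) : ∑ x ∈ Finset.range (2 ^ n), y ^ pop x = (1 + y) ^ n := by
  induction n with
  | zero => simp
  | succ n ih =>
    rw [pow_succ 2 n, mul_comm, sum_range_two_mul, pow_succ, ← ih, Finset.sum_mul]
    refine Finset.sum_congr rfl fun x _ => ?_
    rw [pop_two_mul, pop_two_mul_add_one, pow_succ]
    ring

/-- Markov's inequality for the number of ones. -/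
lemma remaining_mul_pow_le {y : ℝ} (hy0 : 0 < y) (hy1 : y ≤ 1) (n b : ℕ) :
    remaining n b 0 * y ^ b ≤ (1 + y) ^ n := by
  rw [← sum_pow_pop, remaining, ← nsmul_eq_mul, ← Finset.sum_const]
  calc _ ≤ ∑ x ∈ (Finset.Ico 0 (2 ^ n)).filter (fun x => pop x ≤ b), y ^ pop x :=
        Finset.sum_le_sum fun x hx =>
          pow_le_pow_of_le_one hy0.le hy1 (Finset.mem_filter.1 hx).2
    _ ≤ _ := by
        refine Finset.sum_le_sum_of_subset_of_nonneg (fun x hx => ?_)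
          fun x _ _ => (pow_pos hy0 _).le
        exact Finset.mem_range.2 (Finset.mem_Ico.1 (Finset.mem_filter.1 hx).1).2

lemma remaining_le_two_pow (n b : ℕ) : remaining n b 0 ≤ 2 ^ n := by
  refine (Finset.card_le_card (Finset.filter_subset _ _)).trans ?_
  simp

/-- The Chernoff bound for the number of sets of at most `n / 2 - d` elements. -/
lemma remaining_half_le {n d : ℕ} (hn : 1 ≤ n) (hd : d ≤ n / 2) :
    (remaining n (n / 2 - d) 0 : ℝ) ≤ 2 ^ n * Real.exp (-(2 * (d : ℝ) ^ 2 / n)) := by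
  have hn0 : (0 : ℝ) < n := by exact_mod_cast hn
  set b := n / 2 - d with hb
  set l : ℝ := 2 * d / n with hl
  have hl0 : 0 ≤ l := by positivity
  have h1 := remaining_mul_pow_le (Real.exp_pos (-(2 * l))) (Real.exp_le_one_iff.2 (by linarith))
    n b
  have h2 : 1 + Real.exp (-(2 * l)) ≤ 2 * Real.exp (-l + l ^ 2 / 2) := by
    have hc := Real.cosh_le_exp_half_sq l
    have he : 1 + Real.exp (-(2 * l)) = Real.exp (-l) * (2 * Real.cosh l) := by
      rw [Real.cosh_eq]
      have e1 : Real.exp (-l) * Real.exp l = 1 := by rw [← Real.exp_add]; simp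
      have e2 : Real.exp (-l) * Real.exp (-l) = Real.exp (-(2 * l)) := by
        rw [← Real.exp_add]; ring_nf
      calc 1 + Real.exp (-(2 * l))
          = Real.exp (-l) * Real.exp l + Real.exp (-l) * Real.exp (-l) := by rw [e1, e2]
        _ = _ := by ring
    rw [he, Real.exp_add]
    have := Real.exp_pos (-l)
    nlinarith
  have h3 : (1 + Real.exp (-(2 * l))) ^ n ≤ 2 ^ n * Real.exp (n * (-l + l ^ 2 / 2)) := by
    calc _ ≤ (2 * Real.exp (-l + l ^ 2 / 2)) ^ n :=
          pow_le_pow_left₀ (by positivity) h2 n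
      _ = _ := by rw [mul_pow, ← Real.exp_nat_mul]
  rw [← Real.exp_nat_mul] at h1
  have h4 : (remaining n b 0 : ℝ) ≤
      2 ^ n * Real.exp (n * (-l + l ^ 2 / 2)) * Real.exp (b * (2 * l)) := by
    calc (remaining n b 0 : ℝ)
        = remaining n b 0 * Real.exp (b * -(2 * l)) * Real.exp (b * (2 * l)) := by
          rw [mul_assoc, ← Real.exp_add]; simp
      _ ≤ _ := mul_le_mul_of_nonneg_right (h1.trans h3) (Real.exp_pos _).le
  refine h4.trans ?_
  rw [mul_assoc, ← Real.exp_add]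
  refine mul_le_mul_of_nonneg_left (Real.exp_le_exp.2 ?_) (by positivity)
  have hb2 : 2 * (b : ℝ) ≤ n - 2 * d := by
    have : 2 * b + 2 * d ≤ n := by omega
    have : (2 : ℝ) * b + 2 * d ≤ n := by exact_mod_cast this
    linarith
  have hln : l * n = 2 * d := by rw [hl]; field_simp
  have e1 : (n : ℝ) * (-l + l ^ 2 / 2) = -(2 * d) + l * d := by
    calc _ = -(l * n) + l * (l * n) / 2 := by ring
      _ = _ := by rw [hln]; ring
  have e2 : 2 * (d : ℝ) ^ 2 / n = l * d := by rw [hl]; ring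
  have e3 : (b : ℝ) * (2 * l) ≤ (n - 2 * d) * l := by nlinarith
  have e4 : ((n : ℝ) - 2 * d) * l = 2 * d - 2 * (l * d) := by
    calc _ = l * n - 2 * (l * d) := by ring
      _ = _ := by rw [hln]
  linarith

lemma exp_neg_le_two_rpow {x : ℝ} (hx : 0 ≤ x) : Real.exp (-x) ≤ (2 : ℝ) ^ (-x) := by
  rw [Real.rpow_def_of_pos (by norm_num)]
  refine Real.exp_le_exp.2 ?_
  have := Real.log_two_lt_d9
  nlinarith

lemma exp_le_two_rpow {x : ℝ} (hx : 0 ≤ x) : Real.exp x ≤ (2 : ℝ) ^ (2 * x) := by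
  rw [Real.rpow_def_of_pos (by norm_num)]
  refine Real.exp_le_exp.2 ?_
  have := Real.log_two_gt_d9
  nlinarith

lemma le_two_rpow (x : ℝ) : x ≤ 2 * (2 : ℝ) ^ x := by
  rcases le_total x 0 with hx | hx
  · exact hx.trans (by positivity)
  · rw [Real.rpow_def_of_pos (by norm_num)]
    have h1 := Real.add_one_le_exp (Real.log 2 * x)
    have := Real.log_two_gt_d9
    nlinarith

/-- The number of small sets that are tried for every sample. -/
lemma remaining_small_le {n s d : ℕ} (hs1 : 1 ≤ s) (hs : s ≤ n) (hd : d * (8192 * n) ≤ s * s) :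
    (remaining n (3 * d) 0 : ℝ) ≤ (2 : ℝ) ^ ((s : ℝ) / 16) := by
  have hs0 : (0 : ℝ) < s := by exact_mod_cast hs1
  have hsn : (s : ℝ) ≤ n := by exact_mod_cast hs
  have hn0 : (0 : ℝ) < n := hs0.trans_le hsn
  have hdr : (d : ℝ) * (8192 * n) ≤ s * s := by exact_mod_cast hd
  set y : ℝ := s / n / 64 with hy
  have hy0 : 0 < y := by positivity
  have hy1 : y ≤ 1 := by
    have : (s : ℝ) / n ≤ 1 := (div_le_one hn0).2 hsn
    rw [hy]
    linarith
  have h1 := remaining_mul_pow_le hy0 hy1 n (3 * d)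
  have h2 : (1 + y) ^ n ≤ (2 : ℝ) ^ ((s : ℝ) / 32) := by
    calc (1 + y) ^ n ≤ (Real.exp y) ^ n := by
          refine pow_le_pow_left₀ (by positivity) ?_ n
          have := Real.add_one_le_exp y
          linarith
      _ = Real.exp (s / 64) := by
          rw [← Real.exp_nat_mul, hy]
          congr 1
          field_simp
      _ ≤ (2 : ℝ) ^ (2 * ((s : ℝ) / 64)) := exp_le_two_rpow (by positivity)
      _ = _ := by congr 1; ring
  have h3 : (y⁻¹) ^ (3 * d) ≤ (2 : ℝ) ^ ((s : ℝ) / 32) := by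
    have h4 : y⁻¹ ≤ (2 : ℝ) ^ (y⁻¹) := by
      rw [Real.rpow_def_of_pos (by norm_num)]
      have h5 := Real.quadratic_le_exp_of_nonneg (x := Real.log 2 * y⁻¹) (by positivity)
      have h6 := Real.log_two_gt_d9
      have h7 : (0.69 : ℝ) * y⁻¹ ≤ Real.log 2 * y⁻¹ :=
        mul_le_mul_of_nonneg_right (by linarith) (by positivity)
      nlinarith [sq_nonneg (Real.log 2 * y⁻¹ - 1), inv_pos.2 hy0]
    calc (y⁻¹) ^ (3 * d) ≤ ((2 : ℝ) ^ (y⁻¹)) ^ (3 * d) :=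
          pow_le_pow_left₀ (by positivity) h4 _
      _ = (2 : ℝ) ^ (y⁻¹ * (3 * d : ℕ)) := by rw [Real.rpow_mul_natCast (by norm_num)]
      _ ≤ _ := by
          refine Real.rpow_le_rpow_of_exponent_le (by norm_num) ?_
          have : y⁻¹ = 64 * n / s := by rw [hy]; field_simp
          rw [this, div_mul_eq_mul_div, div_le_iff₀ hs0]
          push_cast
          nlinarith
  calc (remaining n (3 * d) 0 : ℝ)
      = remaining n (3 * d) 0 * y ^ (3 * d) * (y⁻¹) ^ (3 * d) := by
        rw [mul_assoc, ← mul_pow, mul_inv_cancel₀ hy0.ne', one_pow, mul_one]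
    _ ≤ (2 : ℝ) ^ ((s : ℝ) / 32) * (2 : ℝ) ^ ((s : ℝ) / 32) :=
        mul_le_mul (h1.trans h2) h3 (by positivity) (by positivity)
    _ = _ := by
        rw [← Real.rpow_add (by norm_num)]
        congr 1
        ring

lemma samples_le {n s : ℕ} (hs : s ≤ n) :
    (samples n s : ℝ) ≤ 4 * (2 : ℝ) ^ ((n : ℝ) - s / 4) := by
  have h : ((n - s / 4 : ℕ) : ℝ) ≤ (n : ℝ) - s / 4 + 1 := by
    have h2 : 4 * (n - s / 4) + s ≤ 4 * n + 4 := by omega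
    have h3 : 4 * ((n - s / 4 : ℕ) : ℝ) + s ≤ 4 * n + 4 := by exact_mod_cast h2
    linarith
  calc (samples n s : ℝ) = 2 * (2 : ℝ) ^ ((n - s / 4 : ℕ) : ℝ) := by
        rw [samples, Real.rpow_natCast]; push_cast; ring
    _ ≤ 2 * (2 : ℝ) ^ ((n : ℝ) - s / 4 + 1) := by
        have := Real.rpow_le_rpow_of_exponent_le (x := 2) (by norm_num) h
        linarith
    _ = _ := by
        rw [Real.rpow_add (by norm_num), Real.rpow_one]; ring

/-- The running time is `O(2 ^ ((1 - c * σ ^ 4) * n) * m)`. -/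
lemma timeBound_le {n m s : ℕ} (hn : 1 ≤ n) (hm : 1 ≤ m) (hs : s ≤ n) :
    (timeBound n m s : ℝ) ≤ 2000000 *
      (2 : ℝ) ^ ((1 - (1 / 2 ^ 28 : ℝ) * ((s : ℝ) / (n : ℝ)) ^ 4) * (n : ℝ)) * (m : ℝ) := by
  have hn1 : (1 : ℝ) ≤ n := by exact_mod_cast hn
  have hm1 : (1 : ℝ) ≤ m := by exact_mod_cast hm
  have hn0 : (0 : ℝ) < n := by linarith
  have hsn : (s : ℝ) ≤ n := by exact_mod_cast hs
  have hs0 : (0 : ℝ) ≤ s := Nat.cast_nonneg s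
  set σ : ℝ := s / n with hσ
  have hσn : σ * n = s := by rw [hσ]; field_simp
  have hσ0 : 0 ≤ σ := by positivity
  have hσ1 : σ ≤ 1 := (div_le_one hn0).2 hsn
  have hσ3 : σ ^ 4 ≤ σ ^ 3 := pow_le_pow_of_le_one hσ0 hσ1 (by norm_num)
  have hσ4 : σ ^ 4 ≤ σ := by
    simpa using pow_le_pow_of_le_one hσ0 hσ1 (show 1 ≤ 4 by norm_num)
  set L : ℝ := σ ^ 4 * n with hL
  have hL0 : 0 ≤ L := by positivity
  have hLs : L ≤ s := by rw [hL, ← hσn]; exact mul_le_mul_of_nonneg_right hσ4 hn0.le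
  have hexp : (1 - (1 / 2 ^ 28 : ℝ) * σ ^ 4) * (n : ℝ) = n - L / 2 ^ 28 := by rw [hL]; ring
  rw [hexp]
  set E : ℝ := (2 : ℝ) ^ ((n : ℝ) - L / 2 ^ 28) with hE
  have hE1 : 1 ≤ E := Real.one_le_rpow (by norm_num) (by
    have : L / 2 ^ 28 ≤ L := div_le_self hL0 (by norm_num)
    linarith)
  have hnE : (n : ℝ) ≤ 4 * E := by
    have h1 := le_two_rpow ((n : ℝ) / 2)
    have h2 : (2 : ℝ) ^ ((n : ℝ) / 2) ≤ E :=
      Real.rpow_le_rpow_of_exponent_le (by norm_num) (by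
        have : L / 2 ^ 28 ≤ L / 2 := div_le_div_of_nonneg_left hL0 (by norm_num) (by norm_num)
        linarith)
    linarith
  have hmE : (m : ℝ) ≤ E * m := by nlinarith
  -- reading the input
  have hread : (100 + m * (7 * n + 10) : ℝ) ≤ 168 * (E * m) := by
    have h1 : (m : ℝ) * n ≤ 4 * E * m := by nlinarith
    have h2 : (m : ℝ) ≤ m * n := by nlinarith
    nlinarith
  have hdle : gap n s * (8192 * n) ≤ s * s := Nat.div_mul_le_self _ _
  have hdlt : s * s < (gap n s + 1) * (8192 * n) := by
    have := Nat.lt_div_mul_add (a := s * s) (b := 8192 * n) (by omega)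
    rw [gap, add_mul, one_mul]
    exact this
  by_cases hex : Exhaustive n s
  · -- here `L` is bounded
    have hL1 : L ≤ 2 ^ 28 := by
      have h1 : s * s * s ≤ (3 * n) * (8192 * n) := by
        have h2 : gap n s * s + s ≤ 3 * n := by
          have : gap n s * s < 2 * n := hex
          omega
        calc s * s * s ≤ (gap n s + 1) * (8192 * n) * s := Nat.mul_le_mul_right _ hdlt.le
          _ = (gap n s * s + s) * (8192 * n) := by ring
          _ ≤ _ := Nat.mul_le_mul_right _ h2
      have h2 : (s : ℝ) * s * s ≤ (3 * n) * (8192 * n) := by exact_mod_cast h1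
      have h3 : σ ^ 3 * n ^ 3 = s * s * s := by rw [← mul_pow, hσn]; ring
      have h4 : σ ^ 3 * n ≤ 24576 := by
        have h5 : (σ ^ 3 * n) * (n : ℝ) ^ 2 ≤ 24576 * (n : ℝ) ^ 2 := by
          calc (σ ^ 3 * n) * (n : ℝ) ^ 2 = σ ^ 3 * n ^ 3 := by ring
            _ ≤ (3 * (n : ℝ)) * (8192 * n) := by rw [h3]; exact h2
            _ = _ := by ring
        exact le_of_mul_le_mul_right h5 (by positivity)
      have h6 : L ≤ σ ^ 3 * n := mul_le_mul_of_nonneg_right hσ3 hn0.le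
      linarith
    have h2n : (2 : ℝ) ^ n ≤ 2 * E := by
      calc (2 : ℝ) ^ n = (2 : ℝ) ^ ((L / 2 ^ 28) + ((n : ℝ) - L / 2 ^ 28)) := by
            rw [add_sub_cancel, Real.rpow_natCast]
        _ = (2 : ℝ) ^ (L / 2 ^ 28) * E := by rw [Real.rpow_add (by norm_num)]
        _ ≤ (2 : ℝ) ^ (1 : ℝ) * E := by
            refine mul_le_mul_of_nonneg_right ?_ (by linarith)
            exact Real.rpow_le_rpow_of_exponent_le (by norm_num)
              ((div_le_one (by norm_num)).2 hL1)
        _ = 2 * E := by rw [Real.rpow_one]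
    have hrem : (remaining n n 0 : ℝ) ≤ 2 * E :=
      le_trans (by exact_mod_cast remaining_le_two_pow n n) h2n
    rw [timeBound, if_pos hex]
    push_cast
    have h1 : (remaining n n 0 : ℝ) * (20 * m + 40) ≤ 2 * E * (60 * m) :=
      mul_le_mul hrem (by linarith) (by positivity) (by linarith)
    nlinarith
  · have hd1 := one_le_gap hn hex
    have hds : 2 * n ≤ gap n s * s := not_lt.1 hex
    have hgap := gap_mul_le hn hs
    have hs1 : 1 ≤ s := by
      by_contra h
      have : s = 0 := by omega
      rw [this, Nat.mul_zero] at hds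
      omega
    -- the table
    have hrem : (remaining n (n / 2 - gap n s) 0 : ℝ) ≤ E := by
      refine (remaining_half_le hn (by omega)).trans ?_
      have h1 : L / 2 ^ 28 ≤ 2 * (gap n s : ℝ) ^ 2 / n := by
        have h2 : (s : ℝ) * s ≤ 2 * gap n s * (8192 * n) := by
          have : s * s ≤ 2 * gap n s * (8192 * n) :=
            hdlt.le.trans (Nat.mul_le_mul_right _ (by omega))
          exact_mod_cast this
        have h3 : σ ^ 2 * n ≤ 16384 * gap n s := by
          have h4 : (σ ^ 2 * n) * n ≤ (16384 * gap n s) * n := by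
            calc (σ ^ 2 * n) * n = (σ * n) * (σ * n) := by ring
              _ ≤ 2 * gap n s * (8192 * n) := by rw [hσn]; exact h2
              _ = _ := by ring
          exact le_of_mul_le_mul_right h4 hn0
        have h5 : L * n ≤ (16384 * gap n s) ^ 2 := by
          calc L * n = (σ ^ 2 * n) ^ 2 := by rw [hL]; ring
            _ ≤ _ := pow_le_pow_left₀ (by positivity) h3 2
        rw [div_le_div_iff₀ (by norm_num) hn0]
        nlinarith
      calc 2 ^ n * Real.exp (-(2 * (gap n s : ℝ) ^ 2 / n))
          ≤ (2 : ℝ) ^ (n : ℝ) * (2 : ℝ) ^ (-(2 * (gap n s : ℝ) ^ 2 / n)) := by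
            rw [Real.rpow_natCast]
            exact mul_le_mul_of_nonneg_left (exp_neg_le_two_rpow (by positivity)) (by positivity)
        _ = (2 : ℝ) ^ ((n : ℝ) - 2 * (gap n s : ℝ) ^ 2 / n) := by
            rw [← Real.rpow_add (by norm_num), sub_eq_add_neg]
        _ ≤ E := Real.rpow_le_rpow_of_exponent_le (by norm_num) (by linarith)
    have htab : (remaining n (n / 2 - gap n s) 0 : ℝ) * (20 * m + 40) ≤ E * (60 * m) :=
      mul_le_mul hrem (by linarith) (by positivity) (by linarith)
    -- the samples
    have hns : (n : ℝ) ≤ 4096 * (2 : ℝ) ^ ((s : ℝ) / 16) := by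
      have h1 : n ≤ s * s := by
        have h2 : n * n ≤ (s * s) * (s * s) := by
          calc n * n ≤ (2 * n) * (8192 * n) := by nlinarith
            _ ≤ (gap n s * s) * (8192 * n) := Nat.mul_le_mul_right _ hds
            _ = (gap n s * (8192 * n)) * s := by ring
            _ ≤ (s * s) * s := Nat.mul_le_mul_right _ hdle
            _ ≤ (s * s) * (s * s) := Nat.mul_le_mul_left _ (Nat.le_mul_of_pos_left s hs1)
        exact Nat.mul_self_le_mul_self_iff.1 h2
      have h3 : (n : ℝ) ≤ s * s := by exact_mod_cast h1
      have h4 : (s : ℝ) ≤ 64 * (2 : ℝ) ^ ((s : ℝ) / 32) := by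
        have := le_two_rpow ((s : ℝ) / 32)
        linarith
      calc (n : ℝ) ≤ s * s := h3
        _ ≤ (64 * (2 : ℝ) ^ ((s : ℝ) / 32)) * (64 * (2 : ℝ) ^ ((s : ℝ) / 32)) :=
          mul_le_mul h4 h4 hs0 (by positivity)
        _ = 4096 * ((2 : ℝ) ^ ((s : ℝ) / 32) * (2 : ℝ) ^ ((s : ℝ) / 32)) := by ring
        _ = _ := by
          rw [← Real.rpow_add (by norm_num)]
          congr 2
          ring
    set F : ℝ := (2 : ℝ) ^ ((s : ℝ) / 16) with hF
    have hF1 : 1 ≤ F := Real.one_le_rpow (by norm_num) (by positivity)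
    have hsmall : (remaining n (3 * gap n s) 0 : ℝ) ≤ F := remaining_small_le hs1 hs hdle
    have hround : (6 * n + 20 + remaining n (3 * gap n s) 0 * (20 * m + 40) : ℝ) ≤
        86 * 4096 * (F * F) * m := by
      have h1 : (remaining n (3 * gap n s) 0 : ℝ) * (20 * m + 40) ≤ F * (60 * m) :=
        mul_le_mul hsmall (by linarith) (by positivity) (by linarith)
      have h2 : F ≤ F * F := by nlinarith
      have h3 : F * F ≤ F * F * m := le_mul_of_one_le_right (by positivity) hm1
      have h4 : F * m ≤ F * F * m := mul_le_mul_of_nonneg_right h2 (by linarith)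
      linarith
    have hsam : (samples n s : ℝ) *
        (6 * n + 20 + remaining n (3 * gap n s) 0 * (20 * m + 40)) ≤ 344 * 4096 * E * m := by
      have h1 : (2 : ℝ) ^ ((n : ℝ) - s / 4) * (F * F) ≤ E := by
        rw [hF, ← Real.rpow_add (by norm_num), ← Real.rpow_add (by norm_num)]
        refine Real.rpow_le_rpow_of_exponent_le (by norm_num) ?_
        have : L / 2 ^ 28 ≤ L / 8 := div_le_div_of_nonneg_left hL0 (by norm_num) (by norm_num)
        linarith
      calc _ ≤ (4 * (2 : ℝ) ^ ((n : ℝ) - s / 4)) * (86 * 4096 * (F * F) * m) :=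
            mul_le_mul (samples_le hs) hround (by positivity) (by positivity)
        _ = 344 * 4096 * ((2 : ℝ) ^ ((n : ℝ) - s / 4) * (F * F)) * m := by ring
        _ ≤ _ := by
            refine mul_le_mul_of_nonneg_right ?_ (by linarith)
            linarith
    have hEm : 0 ≤ E * m := by positivity
    rw [timeBound, if_neg hex]
    push_cast
    linarith

end SetCover

/-! ### The error probability -/

namespace SetCover

open WordRAM MeasureTheory

variable {n m s w : ℕ} {N : Family n m} {ω : ℕ → Bool}

lemma fits_of_le (hn : 1 ≤ n) (hm : 1 ≤ m) (hs : s ≤ n) (hw : 20 * (n + Nat.log 2 m + 1) ≤ w) :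
    Fits n m s w := by
  refine ⟨hn, hm, hs, ?_⟩
  set x := n + Nat.log 2 m + 1 with hx
  have h4 : 2 ^ 2 ≤ 2 ^ x := Nat.pow_le_pow_right (by norm_num) (by omega)
  have hny : n ≤ 2 ^ x := (Nat.lt_two_pow_self).le.trans
    (Nat.pow_le_pow_right (by norm_num) (by omega))
  have h2n : 2 ^ n ≤ 2 ^ x := Nat.pow_le_pow_right (by norm_num) (by omega)
  have hmy : m ≤ 2 ^ x := (Nat.lt_pow_succ_log_self (by norm_num) m).le.trans
    (Nat.pow_le_pow_right (by norm_num) (by omega))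
  have hwy : (2 ^ x) ^ 20 ≤ 2 ^ w := by
    rw [← pow_mul, mul_comm]
    exact Nat.pow_le_pow_right (by norm_num) hw
  refine lt_of_lt_of_le ?_ hwy
  generalize 2 ^ x = y at *
  have h18 : 2 ^ 36 ≤ y ^ 18 := by
    calc 2 ^ 36 = (2 ^ 2) ^ 18 := by norm_num
      _ ≤ y ^ 18 := Nat.pow_le_pow_left h4 18
  have h1 : y ≤ y * y := Nat.le_mul_of_pos_left y (by omega)
  have h2 : m * n ≤ y * y := Nat.mul_le_mul hmy hny
  have h3 : n * n ≤ y * y := Nat.mul_le_mul hny hny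
  have h5 : y * y * 2 ^ 36 ≤ y ^ 20 := by
    calc y * y * 2 ^ 36 ≤ y * y * y ^ 18 := Nat.mul_le_mul_left _ h18
      _ = y ^ 20 := by ring
  omega

/-- The program always halts in time; it answers YES only if there is a cover. -/
lemma prog_answersIn (hfit : Fits n m s w) (ω : ℕ → Bool) :
    (AnswersIn prog w (input N s) ω (timeBound n m s) false ∧ NoReport N s ω) ∨
      (AnswersIn prog w (input N s) ω (timeBound n m s) true ∧ HasCover N s) := by
  obtain ⟨t, ht, ⟨h, h'⟩ | ⟨h, h'⟩⟩ := run_prog (N := N) (ω := ω) hfit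
  · exact Or.inl ⟨((answersIn_iff _ _ _ _ _ _).2 h).mono ht, h'⟩
  · exact Or.inr ⟨((answersIn_iff _ _ _ _ _ _).2 h').mono ht, h⟩

lemma noReport_of_answers_false (hfit : Fits n m s w)
    (h : Answers prog w (input N s) ω false) : NoReport N s ω := by
  rcases prog_answersIn (N := N) hfit ω with ⟨_, h'⟩ | ⟨h', _⟩
  · exact h'
  · exact absurd (h.unique ⟨_, h'⟩) (by decide)

/-- The program answers NO on an instance with a cover only if all samples miss the good ones. -/
lemma coinLaw_answers_false_le (hfit : Fits n m s w) (hc : HasCover N s) :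
    coinLaw {ω | Answers prog w (input N s) ω false} ≤ 1 / 4 := by
  rcases Set.eq_empty_or_nonempty {ω | Answers prog w (input N s) ω false} with h0 | ⟨ω₀, h0⟩
  · rw [h0, measure_empty]
    exact bot_le
  rcases noReport_of_answers_false hfit h0 with ⟨_, mem, hT⟩ | ⟨hex, ⟨mem, hT⟩, _⟩
  · exact absurd hc (hT.not_hasCover hfit.n_pos)
  obtain ⟨G, hcard, hG⟩ := exists_many_samples hfit.n_pos hfit.s_le hex hT hc
  have hr : s / 4 ≤ n := (Nat.div_le_self s 4).trans hfit.s_le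
  refine (measure_mono fun ω hω => ?_).trans
    (coinLaw_samples_le hr (fun W hW => (hG W hW).1) hcard)
  rcases noReport_of_answers_false hfit hω with ⟨hex', _⟩ | ⟨_, _, hfail⟩
  · exact absurd hex' hex
  · exact fun i hi hmem => (hG _ hmem).2 (hfail i hi)

end SetCover

theorem theorem1 :
    ∃ (P : WordRAM.Program) (K : ℕ) (C c : ℝ), 0 < c ∧
      ∀ (n m s : ℕ) (N : SetCover.Family n m), 1 ≤ n → 1 ≤ m → s ≤ n →
        ∀ w : ℕ, K * (n + Nat.log 2 m + 1) ≤ w →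
          -- running time, for every outcome of the coin flips
          (∀ ω : ℕ → Bool, ∃ (t : ℕ) (b : Bool),
            WordRAM.AnswersIn P w (SetCover.input N s) ω t b ∧
            (t : ℝ) ≤ C * (2 : ℝ) ^ ((1 - c * ((s : ℝ) / (n : ℝ)) ^ 4) * (n : ℝ)) * (m : ℝ)) ∧
          -- no false positives
          (¬ SetCover.HasCover N s →
            ∀ ω : ℕ → Bool, ¬ WordRAM.Answers P w (SetCover.input N s) ω true) ∧
          -- false negatives have probability at most 1/4
          (SetCover.HasCover N s →
            WordRAM.coinLaw {ω | WordRAM.Answers P w (SetCover.input N s) ω false} ≤ 1 / 4) := by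
  refine ⟨SetCover.prog, 20, 2000000, 1 / 2 ^ 28, by norm_num, ?_⟩
  intro n m s N hn hm hs w hw
  have hfit := SetCover.fits_of_le hn hm hs hw
  refine ⟨fun ω => ?_, fun hno ω hyes => ?_, SetCover.coinLaw_answers_false_le hfit⟩
  · rcases SetCover.prog_answersIn (N := N) hfit ω with ⟨h, _⟩ | ⟨h, _⟩ <;>
      exact ⟨_, _, h, SetCover.timeBound_le hn hm hs⟩
  · rcases SetCover.prog_answersIn (N := N) hfit ω with ⟨h, _⟩ | ⟨_, h⟩
    · exact absurd (hyes.unique ⟨_, h⟩) (by decide)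
    · exact hno h
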